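/- Let $\mathcal M=(M;<,+,\dots)$ be an o-minimal expansion of an ordered group; "definable" means definable in $\mathcal M$ with parameters. The affine topology $\tau^{af}$ on $M^k$ is the product of the order topologies, and every subset of $M^k$ carries the induced topology, also denoted $\tau^{af}$. Let $X\subseteq M^n$ be a definable bounded set with $\dim X=1$, and let $\tau$ be a definable Hausdorff topology on $X$, that is, a Hausdorff topology with a basis $\mathcal B=\{\varphi(M^n,b): b\in M^m\}$ for some formula $\varphi(x,y)$ with parameters. For $x\in X$ let $\mathcal B_x=\{U\in\mathcal B: x\in U\}$, and let $\mathcal B^{af}_x$ be the family of all sets $V\cap X$, where $V\subseteq M^n$ is an open box containing $x$. For families $S,T$ of subsets of $X$ write $S\preceq T$ if every $U\in S$ contains some $V\in T$. For a definable $A\subseteq X$, call $A$ definably connected (with respect to $\tau$) if $A$ is not the union of two disjoint nonempty definable subsets that are open in the subspace topology $\tau|_A$. A definably connected component of $A$ is a definable, definably connected subset of $A$ that is maximal among such subsets; $A$ has finitely many definably connected components if it is a disjoint union of finitely many of them. Then the following are equivalent: 1. $(X,\tau)$ is definably homeomorphic to a definable set $Y\subseteq M^k$, for some $k$, with its affine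 topology; that is, there is a homeomorphism $(X,\tau)\to(Y,\tau^{af})$ whose graph is definable. 2. Every definable subset of $X$ has finitely many definably connected components with respect to $\tau$. 3. For all but finitely many $x\in X$, $\mathcal B_x\preceq\mathcal B_x^{af}$. 4. There is a finite set $G\subseteq X$ such that every $\tau$-open subset of $X\setminus G$ is $\tau^{af}$-open in $X$. -/

import Mathlib

open FirstOrder Set Topology

namespace OMin

section Structure

/-- `s` is a point or an open interval with endpoints in `M ∪ {-∞, +∞}`. -/
def IsPointOrInterval {M : Type*} [LinearOrder M] (s : Set M) : Prop :=
  s = univ ∨ (∃ a, s = {a}) ∨ (∃ a, s = Iio a) ∨ (∃ a, s = Ioi a) ∨ ∃ a b, s = Ioo a b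

/-- The `L`-structure on the ordered set `M` is o-minimal: the order is definable, and every
definable (with parameters) subset of `M` is a finite union of points and open intervals with
endpoints in `M ∪ {-∞, +∞}`. -/
structure IsOMinimal (L : Language) (M : Type*) [L.Structure M] [LinearOrder M] : Prop where
  definable_lt : (univ : Set M).Definable₂ L {p : M × M | p.1 < p.2}
  definable₁ : ∀ s : Set M, (univ : Set M).Definable₁ L s →
    ∃ F : Set (Set M), F.Finite ∧ (∀ I ∈ F, IsPointOrInterval I) ∧ s = ⋃₀ F

/-- `M` is an o-minimal expansion of the ordered group `(M; <, +)`; the compatibility of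
addition with the order is supplied separately, by type classes. -/
structure IsOMinimalExpansion (L : Language) (M : Type*) [L.Structure M] [LinearOrder M]
    [AddGroup M] : Prop extends IsOMinimal L M where
  definable_add : (univ : Set M).Definable L {v : Fin 3 → M | v 0 + v 1 = v 2}

/-- `X ⊆ M^n` has o-minimal dimension `d`: `d` is the largest `k` such that the image of `X` under
some coordinate projection `M^n → M^k` has nonempty interior (for the product of the order
topologies). -/
def HasDim {M : Type*} [TopologicalSpace M] {n : ℕ} (X : Set (Fin n → M)) (d : ℕ) : Prop :=
  IsGreatest {k : ℕ | ∃ ι : Fin k ↪o Fin n,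
    (interior ((fun (x : Fin n → M) (i : Fin k) => x (ι i)) '' X)).Nonempty} d

/-- `X ⊆ M^n` is bounded: it is contained in a box. -/
def IsBdd {M : Type*} [LinearOrder M] {n : ℕ} (X : Set (Fin n → M)) : Prop :=
  ∃ a b : Fin n → M, X ⊆ Icc a b

end Structure

section Families

/-- A subset of the set `X ⊆ M^n` is definable (with parameters). -/
def DefinableIn (L : Language) {M : Type*} [L.Structure M] {n : ℕ} {X : Set (Fin n → M)}
    (A : Set X) : Prop :=
  (univ : Set M).Definable L (((↑) : X → Fin n → M) '' A)

/-- A collection `B` of subsets of `X` is definable: it consists of the fibres `φ(X, b)`,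
`b ∈ M^m`, of one definable relation `φ(x, y)`. -/
def DefinableFamily (L : Language) {M : Type*} [L.Structure M] {n : ℕ} {X : Set (Fin n → M)}
    (B : Set (Set X)) : Prop :=
  ∃ (m : ℕ) (φ : Set (Fin n ⊕ Fin m → M)), (univ : Set M).Definable L φ ∧
    B = {U | ∃ b : Fin m → M, U = {x : X | Sum.elim (x : Fin n → M) b ∈ φ}}

/-- The members of the family `B` that contain `a`. -/
def familyAt {T : Type*} (B : Set (Set T)) (a : T) : Set (Set T) :=
  {U | U ∈ B ∧ a ∈ U}

/-- `S ⪯ T` for families of sets: every member of `S` contains a member of `T`. -/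
def FamilyLE {Y : Type*} (S T : Set (Set Y)) : Prop :=
  ∀ U ∈ S, ∃ V ∈ T, V ⊆ U

/-- The standard basis of the affine topology on `X ⊆ M^n`: traces on `X` of open boxes. -/
def affineBasis {M : Type*} [LinearOrder M] {n : ℕ} (X : Set (Fin n → M)) : Set (Set X) :=
  {V | ∃ b c : Fin n → M, V = {x : X | ∀ i, b i < (x : Fin n → M) i ∧ (x : Fin n → M) i < c i}}

end Families

section Connectedness

/-- The set `A ⊆ X` is definably connected for the subspace topology of `τ`: it is not the union
of two disjoint nonempty definable relatively open subsets. -/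
def DefConnected (L : Language) {M : Type*} [L.Structure M] {n : ℕ} {X : Set (Fin n → M)}
    (τ : TopologicalSpace X) (A : Set X) : Prop :=
  ¬ ∃ U W : Set X, DefinableIn L U ∧ DefinableIn L W ∧ U.Nonempty ∧ W.Nonempty ∧
    (∃ O : Set X, IsOpen[τ] O ∧ U = A ∩ O) ∧ (∃ O : Set X, IsOpen[τ] O ∧ W = A ∩ O) ∧
    U ∩ W = ∅ ∧ U ∪ W = A

/-- `C` is a definably connected component of `A`: a definable, maximal definably connected
subset of `A`. -/
def IsDefComponent (L : Language) {M : Type*} [L.Structure M] {n : ℕ} {X : Set (Fin n → M)}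
    (τ : TopologicalSpace X) (A C : Set X) : Prop :=
  Maximal (fun D : Set X => D ⊆ A ∧ DefinableIn L D ∧ DefConnected L τ D) C

/-- `A` decomposes into finitely many definably connected components. -/
def FinitelyManyDefComponents (L : Language) {M : Type*} [L.Structure M] {n : ℕ}
    {X : Set (Fin n → M)} (τ : TopologicalSpace X) (A : Set X) : Prop :=
  ∃ F : Set (Set X), F.Finite ∧ (∀ C ∈ F, IsDefComponent L τ A C) ∧
    F.PairwiseDisjoint id ∧ ⋃₀ F = A

end Connectedness

/-- `(X, τ)` is definably homeomorphic to a definable subset of some `M^k` with its affine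
topology (the subspace topology of the product of order topologies). -/
def DefHomeomorphicToAffine (L : Language) {M : Type*} [L.Structure M] [TopologicalSpace M]
    {n : ℕ} {X : Set (Fin n → M)} (τ : TopologicalSpace X) : Prop :=
  ∃ (k : ℕ) (Y : Set (Fin k → M)), (univ : Set M).Definable L Y ∧
    ∃ f : @Homeomorph X Y τ instTopologicalSpaceSubtype,
      (univ : Set M).Definable L
        {z : Fin n ⊕ Fin k → M | ∃ x : X, z = Sum.elim (x : Fin n → M) (f x : Fin k → M)}

end OMin

/-!
A bounded definable set `X` of dimension one is, up to a definable bijection, a bounded definable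
subset of the line, and a definable Hausdorff topology on such a set is governed by what happens at
the one-sided germs of the line. The order topology of the line, pulled back along the bijection
`ε : X → M`, serves as a common yardstick: all four conditions say that it refines `τ` at all but
finitely many points.

*The coordinate.* Since no projection of `X` to two coordinates contains a box, `X` injects
definably into the line (`IsThin.exists_injOn`). By induction on the number of coordinates it is
enough to treat planar sets. There uniform finiteness (`exists_peel_iterate_empty`) bounds the
number of points in the finite fibres, so the set decomposes into finitely many graphs and finitely
many vertical segments, and these can be placed side by side on the line. The functions expressing
the original coordinates in terms of `ε` are continuous off a finite set, and therefore the affine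
topology is the order topology at all but finitely many points
(`IsCoordinate.finite_nhds_affine_ne`).

*Definable compactness.* A point in the closure of a definable set, but not in it, is the limit of a
one-sided germ of the line along which the set is present (`IsDefBasis.exists_germ_of_mem_closure`).
In a Hausdorff topology a germ has at most one limit. If the order topology refines `τ` off a finite
set, then the germs that can converge to a point other than their own base point sit over finitely
many points of the line; hence the two topologies agree off a finite set
(`IsDefBasis.finite_nhds_ne`).

*The embedding.* In that situation `X` is a finite graph: finitely many vertices, and open intervals
whose ends are attached to at most one vertex each. Tent functions over the edges and over the
halves of the edges, and the truncated distances to the vertices along the edges, are definable and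
continuous, and together they induce `τ` (`IsDefBasis.exists_isInducing`). Conversely, a topology
induced by finitely many definable functions of `ε` is refined by the order topology off the
discontinuities of these functions (`finite_not_comap_nhds_le_of_isInducing`).

*Connectedness.* If the order topology refines `τ` off a finite set, every definable set is a finite
union of points and intervals that are definably connected for `τ`, so it has finitely many
components (`finitelyManyDefComponents_sUnion`). If the order topology fails to refine `τ` at
infinitely many points, then, by uniformity, on some interval every point has a neighbourhood that
misses the rest of the interval on a fixed side. Initial segments of that interval are open and
closed in it, and the interval is infinite with only singleton components
(`IsDefBasis.hasSeparatedSet`).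
-/

set_option linter.unusedSectionVars false

namespace OMin

/-! ### Definable predicates and definable functions -/

section Definability

variable (L : Language) {M : Type*} [L.Structure M] {α β : Type*}

/-- The predicate `P` on tuples indexed by `α` is definable with parameters. It is a structure, so
that unification does not see through it to the underlying set. -/
structure DefPred (P : (α → M) → Prop) : Prop where
  definable : (univ : Set M).Definable L {v | P v}

/-- The function `f` on tuples indexed by `α` is definable with parameters. -/
structure DefFun (f : (α → M) → M) : Prop where
  definableFun : (univ : Set M).DefinableFun L f

/-- A definable (with parameters) subset of the line, given as a predicate. -/
def DefPred₁ (P : M → Prop) : Prop := DefPred L fun v : Fin 1 → M => P (v 0)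

/-- A definable (with parameters) binary relation. -/
def DefPred₂ (Q : M → M → Prop) : Prop := DefPred L fun v : Fin 2 → M => Q (v 0) (v 1)

/-- A definable (with parameters) family of subsets of the line, indexed by tuples. -/
def DefRel (R : M → (β → M) → Prop) : Prop :=
  DefPred L fun v : Unit ⊕ β → M => R (v (Sum.inl ())) fun i => v (Sum.inr i)

/-- A definable (with parameters) function of one variable. -/
def DefFun₁ (f : M → M) : Prop := DefPred₂ L fun x y => f x = y

variable {L}

theorem DefPred.of_iff {P Q : (α → M) → Prop} (h : ∀ v, P v ↔ Q v) (hQ : DefPred L Q) :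
    DefPred L P := by
  have : P = Q := funext fun v => propext (h v)
  rwa [this]

theorem DefPred.const (p : Prop) : DefPred L fun _ : α → M => p := by
  constructor
  by_cases hp : p
  · simp [hp]
  · simp [hp]

theorem DefPred.and {P Q : (α → M) → Prop} (hP : DefPred L P) (hQ : DefPred L Q) :
    DefPred L fun v => P v ∧ Q v := ⟨hP.1.inter hQ.1⟩

theorem DefPred.or {P Q : (α → M) → Prop} (hP : DefPred L P) (hQ : DefPred L Q) :
    DefPred L fun v => P v ∨ Q v := ⟨hP.1.union hQ.1⟩

theorem DefPred.not {P : (α → M) → Prop} (hP : DefPred L P) :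
    DefPred L fun v => ¬ P v := ⟨hP.1.compl⟩

theorem DefPred.imp {P Q : (α → M) → Prop} (hP : DefPred L P) (hQ : DefPred L Q) :
    DefPred L fun v => P v → Q v :=
  (hP.not.or hQ).of_iff fun _ => imp_iff_not_or

theorem DefPred.forall_finite {ι : Type*} [Finite ι] {P : ι → (α → M) → Prop}
    (hP : ∀ i, DefPred L (P i)) : DefPred L fun v => ∀ i, P i v := by
  have : {v : α → M | ∀ i, P i v} = ⋂ i, {v | P i v} := by ext; simp
  constructor
  rw [this]
  exact definable_iInter_of_finite fun i => (hP i).1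

theorem DefPred.exists_finite {ι : Type*} [Finite ι] {P : ι → (α → M) → Prop}
    (hP : ∀ i, DefPred L (P i)) : DefPred L fun v => ∃ i, P i v :=
  (DefPred.forall_finite fun i => (hP i).not).not.of_iff fun v => by simp

theorem DefPred.exT [Finite β] {P : (α → M) → (β → M) → Prop}
    (hP : DefPred L fun w : α ⊕ β → M => P (fun a => w (Sum.inl a)) fun b => w (Sum.inr b)) :
    DefPred L fun v => ∃ u : β → M, P v u :=
  ⟨Definable.exists_of_finite hP.1⟩

theorem DefPred.allT [Finite β] {P : (α → M) → (β → M) → Prop}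
    (hP : DefPred L fun w : α ⊕ β → M => P (fun a => w (Sum.inl a)) fun b => w (Sum.inr b)) :
    DefPred L fun v => ∀ u : β → M, P v u :=
  ⟨Definable.forall_of_finite hP.1⟩

theorem DefPred.ex {P : (α → M) → M → Prop}
    (hP : DefPred L fun w : α ⊕ Unit → M => P (fun a => w (Sum.inl a)) (w (Sum.inr ()))) :
    DefPred L fun v => ∃ y, P v y :=
  (DefPred.exT (β := Unit) (P := fun v u => P v (u ())) hP).of_iff fun _ =>
    ⟨fun ⟨y, h⟩ => ⟨fun _ => y, h⟩, fun ⟨u, h⟩ => ⟨u (), h⟩⟩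

theorem DefPred.all {P : (α → M) → M → Prop}
    (hP : DefPred L fun w : α ⊕ Unit → M => P (fun a => w (Sum.inl a)) (w (Sum.inr ()))) :
    DefPred L fun v => ∀ y, P v y :=
  (DefPred.allT (β := Unit) (P := fun v u => P v (u ())) hP).of_iff fun _ =>
    ⟨fun h (u : Unit → M) => h (u ()), fun h y => h fun _ => y⟩

theorem DefFun.var (a : α) : DefFun L fun v : α → M => v a := ⟨DefinableFun.proj L⟩

theorem DefFun.const (c : M) : DefFun L fun _ : α → M => c :=
  ⟨L.definableFun_const α (mem_univ c)⟩

theorem DefPred.subst [Finite β] {P : (β → M) → Prop} (hP : DefPred L P) {t : β → (α → M) → M}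
    (ht : ∀ b, DefFun L (t b)) : DefPred L fun v => P fun b => t b v :=
  ⟨Definable.preimage_map (F := fun v b => t b v) (fun b => (ht b).1) hP.1⟩

theorem DefPred.reindex {P : (β → M) → Prop} (hP : DefPred L P) (f : β → α) :
    DefPred L fun v : α → M => P fun b => v (f b) :=
  ⟨hP.1.preimage_comp f⟩

theorem DefPred.eq {s t : (α → M) → M} (hs : DefFun L s) (ht : DefFun L t) :
    DefPred L fun v => s v = t v := ⟨hs.1.ofPred_eq ht.1⟩

theorem DefPred₁.app {P : M → Prop} (hP : DefPred₁ L P) {t : (α → M) → M} (ht : DefFun L t) :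
    DefPred L fun v => P (t v) := DefPred.subst (t := fun _ => t) hP fun _ => ht

theorem DefPred₂.app {Q : M → M → Prop} (hQ : DefPred₂ L Q) {s t : (α → M) → M}
    (hs : DefFun L s) (ht : DefFun L t) : DefPred L fun v => Q (s v) (t v) := by
  have := DefPred.subst (t := ![s, t]) hQ (by simp [Fin.forall_fin_two, hs, ht])
  exact this.of_iff fun v => by simp

theorem DefRel.app [Finite β] {R : M → (β → M) → Prop} (hR : DefRel L R) {s : (α → M) → M}
    {t : β → (α → M) → M} (hs : DefFun L s) (ht : ∀ b, DefFun L (t b)) :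
    DefPred L fun v => R (s v) fun b => t b v :=
  DefPred.subst (t := Sum.elim (fun _ => s) t) hR (by rintro (_ | b) <;> simp [hs, ht])

/-- A function is definable as soon as its graph is. -/
theorem DefFun.of_graph {f : (α → M) → M}
    (h : DefPred L fun w : Option α → M => f (fun a => w (some a)) = w none) : DefFun L f :=
  ⟨h.1⟩

theorem DefFun.reindex {f : (β → M) → M} (hf : DefFun L f) (g : β → α) :
    DefFun L fun v : α → M => f fun b => v (g b) :=
  .of_graph <| (DefPred.mk hf.1).reindex (P := fun w : Option β → M => f (w ∘ some) = w none)
    (Option.map g)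

theorem DefFun.comp [Finite β] {f : (β → M) → M} (hf : DefFun L f) {t : β → (α → M) → M}
    (ht : ∀ b, DefFun L (t b)) : DefFun L fun v => f fun b => t b v :=
  ⟨DefinableFun.comp (g := fun v b => t b v) (fun b => (ht b).1) hf.1⟩

theorem DefFun₁.app {f : M → M} (hf : DefFun₁ L f) {t : (α → M) → M} (ht : DefFun L t) :
    DefFun L fun v => f (t v) := by
  have h : DefFun L fun v : Fin 1 → M => f (v 0) :=
    DefFun.of_graph (DefPred₂.app hf (DefFun.var _) (DefFun.var _))
  exact DefFun.comp (t := fun _ => t) h fun _ => ht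

theorem DefFun₁.of_defFun {f : M → M} (hf : DefFun L fun v : Fin 2 → M => f (v 0)) :
    DefFun₁ L f :=
  DefPred.eq hf (DefFun.var 1)

theorem DefFun.ite {P : (α → M) → Prop} [DecidablePred P] {f g : (α → M) → M} (hP : DefPred L P)
    (hf : DefFun L f) (hg : DefFun L g) : DefFun L fun v => if P v then f v else g v :=
  ⟨DefinableFun.ite hP.1 hf.1 hg.1⟩

/-- A functional definable relation is contained in the graph of a definable function. -/
theorem exists_defFun₁ [Nonempty M] {G : M → M → Prop} (hG : DefPred₂ L G)
    (huniq : ∀ t y z, G t y → G t z → y = z) : ∃ f, DefFun₁ L f ∧ ∀ t y, G t y → f t = y := by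
  classical
  let o : M := Classical.arbitrary M
  let f : M → M := fun t => if h : ∃ y, G t y then h.choose else o
  have hf : ∀ t y, G t y → f t = y := fun t y h => by
    have h' : ∃ y, G t y := ⟨y, h⟩
    simp only [f, dif_pos h']
    exact huniq t _ _ h'.choose_spec h
  refine ⟨f, ?_, hf⟩
  have : DefPred₂ L fun t y => G t y ∨ ((¬ ∃ z, G t z) ∧ y = o) := by
    apply_rules [DefPred.or, DefPred.and, DefPred.not, DefPred.ex, DefPred.eq, hG.app, DefFun.var,
      DefFun.const]
  refine DefPred.of_iff (fun v => ?_) this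
  constructor
  · intro h
    by_cases h' : ∃ y, G (v 0) y
    · obtain ⟨y, hy⟩ := h'
      have := hf _ _ hy
      left
      rw [← h, this]
      exact hy
    · exact Or.inr ⟨h', by simpa [f, h'] using h.symm⟩
  · rintro (h | ⟨h, h'⟩)
    · exact hf _ _ h
    · rw [h']
      simp [f, h]

end Definability

section Order

variable {L : Language} {M : Type*} [L.Structure M] [LinearOrder M] {α : Type*}

theorem DefPred.lt (hM : IsOMinimal L M) {s t : (α → M) → M} (hs : DefFun L s)
    (ht : DefFun L t) : DefPred L fun v => s v < t v :=
  DefPred₂.app (Q := fun x y => x < y) ⟨hM.definable_lt⟩ hs ht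

theorem DefPred.le (hM : IsOMinimal L M) {s t : (α → M) → M} (hs : DefFun L s)
    (ht : DefFun L t) : DefPred L fun v => s v ≤ t v :=
  (DefPred.lt hM ht hs).not.of_iff fun _ => not_lt.symm

theorem DefFun.min (hM : IsOMinimal L M) {s t : (α → M) → M} (hs : DefFun L s)
    (ht : DefFun L t) : DefFun L fun v => min (s v) (t v) := by
  simpa only [min_def] using DefFun.ite (DefPred.le hM hs ht) hs ht

theorem DefFun.max (hM : IsOMinimal L M) {s t : (α → M) → M} (hs : DefFun L s)
    (ht : DefFun L t) : DefFun L fun v => max (s v) (t v) := by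
  simpa only [max_def] using DefFun.ite (DefPred.le hM hs ht) ht hs

theorem DefFun.add [AddGroup M] (hM : IsOMinimalExpansion L M) {s t : (α → M) → M}
    (hs : DefFun L s) (ht : DefFun L t) : DefFun L fun v => s v + t v := by
  refine DefFun.of_graph ?_
  have := DefPred.subst (P := fun v : Fin 3 → M => v 0 + v 1 = v 2) ⟨hM.definable_add⟩
    (t := ![fun w : Option α → M => s fun a => w (some a), fun w => t fun a => w (some a),
      fun w => w none]) ?_
  · exact this.of_iff fun v => by simp
  · intro b
    fin_cases b
    · exact hs.reindex _
    · exact ht.reindex _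
    · exact DefFun.var _

theorem DefFun.neg [AddGroup M] (hM : IsOMinimalExpansion L M) {s : (α → M) → M}
    (hs : DefFun L s) : DefFun L fun v => - s v := by
  refine DefFun.of_graph ?_
  refine DefPred.of_iff (Q := fun w : Option α → M => s (fun a => w (some a)) + w none = 0)
    (fun w => neg_eq_iff_add_eq_zero) ?_
  exact DefPred.eq (DefFun.add hM (hs.reindex _) (DefFun.var _))
    (DefFun.const _)

theorem DefFun.sub [AddGroup M] (hM : IsOMinimalExpansion L M) {s t : (α → M) → M}
    (hs : DefFun L s) (ht : DefFun L t) : DefFun L fun v => s v - t v := by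
  simpa only [sub_eq_add_neg] using DefFun.add hM hs (DefFun.neg hM ht)

end Order

/-! ### Commutativity and divisibility of an o-minimal ordered group -/

section Group

variable {L : Language} {M : Type*} [L.Structure M]

/-- A definable subset of the line is a finite union of points and intervals. -/
theorem DefPred₁.exists_finite_sUnion [LinearOrder M] (hM : IsOMinimal L M) {P : M → Prop}
    (hP : DefPred₁ L P) :
    ∃ F : Set (Set M), F.Finite ∧ (∀ I ∈ F, IsPointOrInterval I) ∧ {x | P x} = ⋃₀ F :=
  hM.definable₁ {x | P x} hP.1

theorem DefPred₁.exists_Ioi_of_not_bddAbove [LinearOrder M] [Nonempty M] (hM : IsOMinimal L M)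
    {P : M → Prop} (hP : DefPred₁ L P) (hb : ¬ BddAbove {x | P x}) : ∃ a, ∀ x, a < x → P x := by
  obtain ⟨F, hF, hI, hPF⟩ := hP.exists_finite_sUnion hM
  have : ∃ I ∈ F, ¬ BddAbove I := by
    by_contra! h
    refine hb ?_
    rw [hPF, sUnion_eq_biUnion]
    exact hF.bddAbove_biUnion.2 h
  obtain ⟨I, hIF, hIb⟩ := this
  have hsub : ∀ x ∈ I, P x := fun x hx => by
    have : x ∈ {x | P x} := hPF ▸ mem_sUnion_of_mem hx hIF
    exact this
  rcases hI I hIF with rfl | ⟨a, rfl⟩ | ⟨a, rfl⟩ | ⟨a, rfl⟩ | ⟨a, b, rfl⟩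
  · exact ⟨Classical.arbitrary M, fun x _ => hsub x trivial⟩
  · exact absurd bddAbove_singleton hIb
  · exact absurd bddAbove_Iio hIb
  · exact ⟨a, hsub⟩
  · exact absurd bddAbove_Ioo hIb

theorem IsPointOrInterval.exists_isLUB [LinearOrder M] {I : Set M} (hI : IsPointOrInterval I)
    (hne : I.Nonempty) (hb : BddAbove I) : ∃ p, IsLUB I p := by
  by_cases hmax : ∃ p ∈ I, p ∈ upperBounds I
  · obtain ⟨p, hp, hp'⟩ := hmax
    exact ⟨p, hp', fun u hu => hu hp⟩
  push Not at hmax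
  obtain ⟨x, hx⟩ := hne
  obtain ⟨u, hu⟩ := hb
  rcases hI with rfl | ⟨a, rfl⟩ | ⟨a, rfl⟩ | ⟨a, rfl⟩ | ⟨a, b, rfl⟩
  · exact absurd hu (hmax u trivial)
  · exact ⟨a, isLUB_singleton⟩
  · refine ⟨a, fun y hy => le_of_lt hy, fun v hv => ?_⟩
    by_contra! h
    exact hmax v h hv
  · exact absurd hu (hmax u (lt_of_lt_of_le hx (hu hx)))
  · refine ⟨b, fun y hy => hy.2.le, fun v hv => ?_⟩
    by_contra! h
    exact hmax v ⟨lt_of_lt_of_le hx.1 (hv hx), h⟩ hv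

/-- O-minimal structures are definably complete. -/
theorem DefPred₁.exists_isLUB [LinearOrder M] (hM : IsOMinimal L M) {P : M → Prop}
    (hP : DefPred₁ L P) (hne : ∃ x, P x) (hb : BddAbove {x | P x}) : ∃ p, IsLUB {x | P x} p := by
  obtain ⟨F, hF, hI, hPF⟩ := hP.exists_finite_sUnion hM
  rw [hPF] at hb ⊢
  have hne : (⋃₀ F).Nonempty := hPF ▸ hne
  clear hPF hP
  induction F, hF using Set.Finite.induction_on with
  | empty => simp at hne
  | @insert I F _ _ ih =>
    rw [sUnion_insert] at hb hne ⊢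
    have hb' := bddAbove_union.1 hb
    rcases I.eq_empty_or_nonempty with rfl | hIne
    · simp only [empty_union] at hne ⊢
      exact ih hb'.2 (fun J hJ => hI J (mem_insert_of_mem _ hJ)) hne
    obtain ⟨p, hp⟩ := (hI I (mem_insert _ _)).exists_isLUB hIne hb'.1
    rcases (⋃₀ F).eq_empty_or_nonempty with h | hFne
    · exact ⟨p, by simpa [h] using hp⟩
    obtain ⟨q, hq⟩ := ih hb'.2 (fun J hJ => hI J (mem_insert_of_mem _ hJ)) hFne
    exact ⟨_, hp.union hq⟩

/-- A nonzero definable subgroup has no supremum, so it is unbounded; then it contains a half-line,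
and hence everything. -/
theorem definable_addSubgroup_eq_top [AddGroup M] [LinearOrder M] [AddLeftMono M] [AddRightMono M]
    (hM : IsOMinimal L M) (H : AddSubgroup M) (hH : DefPred₁ L (· ∈ H)) {h : M} (hmem : h ∈ H)
    (h0 : h ≠ 0) : H = ⊤ := by
  wlog hpos : 0 < h generalizing h
  · exact this (H.neg_mem hmem) (neg_ne_zero.2 h0)
      (by simpa using lt_of_le_of_ne (not_lt.1 hpos) h0)
  have hb : ¬ BddAbove {x | x ∈ H} := by
    intro hb
    obtain ⟨s, hs⟩ := hH.exists_isLUB hM ⟨h, hmem⟩ hb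
    have : s - h ∈ upperBounds {x | x ∈ H} := fun x hx =>
      le_sub_iff_add_le.2 (hs.1 (H.add_mem hx hmem))
    exact absurd (hs.2 this) (not_le.2 (sub_lt_self s hpos))
  obtain ⟨a, ha⟩ := hH.exists_Ioi_of_not_bddAbove hM hb
  have : NoMaxOrder M := ⟨fun x => ⟨x + h, lt_add_of_pos_right x hpos⟩⟩
  refine (AddSubgroup.eq_top_iff' H).2 fun x => ?_
  obtain ⟨y, hy⟩ := exists_gt (max a (-x + a))
  have h1 : y ∈ H := ha y ((le_max_left _ _).trans_lt hy)
  have h2 : x + y ∈ H := by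
    refine ha _ ?_
    have := (le_max_right a (-x + a)).trans_lt hy
    simpa using add_lt_add_right this x
  simpa using H.sub_mem h2 h1

theorem add_comm_of_isOMinimalExpansion [AddGroup M] [LinearOrder M] [AddLeftMono M]
    [AddRightMono M] (hM : IsOMinimalExpansion L M) (x y : M) : x + y = y + x := by
  rcases eq_or_ne y 0 with rfl | hy
  · simp
  have : AddSubgroup.centralizer {y} = ⊤ := by
    refine definable_addSubgroup_eq_top hM.1 _ ?_ (h := y) ?_ hy
    · have : DefPred₁ L fun x => y + x = x + y := by
        apply_rules [DefPred.eq, DefFun.add, DefFun.var, DefFun.const]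
      exact this.of_iff fun v => by simp [AddSubgroup.mem_centralizer_iff]
    · simp [AddSubgroup.mem_centralizer_iff]
  have h : x ∈ AddSubgroup.centralizer {y} := this ▸ AddSubgroup.mem_top x
  simpa [AddSubgroup.mem_centralizer_iff, eq_comm] using h

theorem exists_add_self_eq [AddCommGroup M] [LinearOrder M] [IsOrderedAddMonoid M]
    (hM : IsOMinimalExpansion L M) (x : M) : ∃ y, y + y = x := by
  rcases eq_or_ne x 0 with rfl | hx
  · exact ⟨0, by simp⟩
  have : (nsmulAddMonoidHom (α := M) 2).range = ⊤ := by
    refine definable_addSubgroup_eq_top hM.1 _ ?_ (h := x + x) ⟨x, by simp [two_nsmul]⟩ ?_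
    · have : DefPred₁ L fun x : M => ∃ y, y + y = x := by
        apply_rules [DefPred.ex, DefPred.eq, DefFun.add, DefFun.var, DefFun.const]
      exact this.of_iff fun v => by simp [two_nsmul]
    · simpa [← two_nsmul] using hx
  have h : x ∈ (nsmulAddMonoidHom (α := M) 2).range := this ▸ AddSubgroup.mem_top x
  simpa [two_nsmul] using h

theorem denselyOrdered_of_isOMinimalExpansion [AddCommGroup M] [LinearOrder M]
    [IsOrderedAddMonoid M] (hM : IsOMinimalExpansion L M) : DenselyOrdered M := by
  refine ⟨fun a b hab => ?_⟩
  obtain ⟨y, hy⟩ := exists_add_self_eq hM (b - a)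
  have h0 : 0 < y + y := hy ▸ sub_pos.2 hab
  have h1 : 0 < y := by
    by_contra! h
    exact absurd h0 (not_lt.2 (add_nonpos h h))
  refine ⟨a + y, lt_add_of_pos_right a h1, ?_⟩
  rw [← lt_sub_iff_add_lt', ← hy]
  exact lt_add_of_pos_right y h1

end Group

/-! ### One-sided germs and definable subsets of the line -/

section Line

variable {L : Language} {M : Type*} [L.Structure M] [AddCommGroup M] [LinearOrder M]
  [IsOrderedAddMonoid M] [Nontrivial M] [TopologicalSpace M] [OrderTopology M] [DenselyOrdered M]
  {α : Type*}

/-- The filter of one-sided punctured neighbourhoods of `p`: right ones for `true`, left ones for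
`false`. -/
def side {M : Type*} [LinearOrder M] [TopologicalSpace M] (s : Bool) (p : M) : Filter M :=
  if s then 𝓝[>] p else 𝓝[<] p

@[simp] theorem side_true (p : M) : side true p = 𝓝[>] p := rfl

@[simp] theorem side_false (p : M) : side false p = 𝓝[<] p := rfl

theorem side_le_nhdsNE (s : Bool) (p : M) : side s p ≤ 𝓝[≠] p := by
  cases s
  · exact nhdsWithin_mono _ fun x hx => ne_of_lt hx
  · exact nhdsWithin_mono _ fun x hx => ne_of_gt hx

theorem side_le_nhds (s : Bool) (p : M) : side s p ≤ 𝓝 p :=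
  (side_le_nhdsNE s p).trans nhdsWithin_le_nhds

instance side_neBot (s : Bool) (p : M) : (side s p).NeBot := by
  cases s
  · exact inferInstanceAs (𝓝[<] p).NeBot
  · exact inferInstanceAs (𝓝[>] p).NeBot

theorem nhdsNE_eq_sup_side (p : M) : 𝓝[≠] p = side false p ⊔ side true p := by
  rw [side_true, side_false, ← nhdsWithin_union, Iio_union_Ioi]

theorem eventually_side_true {p : M} {P : M → Prop} :
    (∀ᶠ x in side true p, P x) ↔ ∃ u, p < u ∧ ∀ x, p < x → x < u → P x := by
  rw [side_true, Filter.Eventually, mem_nhdsGT_iff_exists_Ioo_subset]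
  exact ⟨fun ⟨u, hu, h⟩ => ⟨u, hu, fun x h1 h2 => h ⟨h1, h2⟩⟩,
    fun ⟨u, hu, h⟩ => ⟨u, hu, fun x hx => h x hx.1 hx.2⟩⟩

theorem eventually_side_false {p : M} {P : M → Prop} :
    (∀ᶠ x in side false p, P x) ↔ ∃ u, u < p ∧ ∀ x, u < x → x < p → P x := by
  rw [side_false, Filter.Eventually, mem_nhdsLT_iff_exists_Ioo_subset]
  exact ⟨fun ⟨u, hu, h⟩ => ⟨u, hu, fun x h1 h2 => h ⟨h1, h2⟩⟩,
    fun ⟨u, hu, h⟩ => ⟨u, hu, fun x hx => h x hx.1 hx.2⟩⟩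

theorem eventually_nhds_iff_Ioo {p : M} {P : M → Prop} :
    (∀ᶠ x in 𝓝 p, P x) ↔ ∃ u v, u < p ∧ p < v ∧ ∀ x, u < x → x < v → P x := by
  rw [Filter.Eventually, mem_nhds_iff_exists_Ioo_subset]
  exact ⟨fun ⟨u, v, h, h'⟩ => ⟨u, v, h.1, h.2, fun x h1 h2 => h' ⟨h1, h2⟩⟩,
    fun ⟨u, v, h1, h2, h⟩ => ⟨u, v, ⟨h1, h2⟩, fun x hx => h x hx.1 hx.2⟩⟩

theorem DefPred.eventually_side (hM : IsOMinimal L M) (s : Bool) {t : (α → M) → M}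
    {P : (α → M) → M → Prop} (ht : DefFun L t)
    (hP : DefPred L fun w : (α ⊕ Unit) ⊕ Unit → M =>
      P (fun a => w (Sum.inl (Sum.inl a))) (w (Sum.inr ()))) :
    DefPred L fun v => ∀ᶠ x in side s (t v), P v x := by
  cases s
  · simp only [eventually_side_false]
    apply_rules [DefPred.ex, DefPred.and, DefPred.all, DefPred.imp, DefPred.lt, DefFun.var,
      ht.reindex]
  · simp only [eventually_side_true]
    apply_rules [DefPred.ex, DefPred.and, DefPred.all, DefPred.imp, DefPred.lt, DefFun.var,
      ht.reindex]

theorem DefPred.eventually_nhds (hM : IsOMinimal L M) {t : (α → M) → M}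
    {P : (α → M) → M → Prop} (ht : DefFun L t)
    (hP : DefPred L fun w : ((α ⊕ Unit) ⊕ Unit) ⊕ Unit → M =>
      P (fun a => w (Sum.inl (Sum.inl (Sum.inl a)))) (w (Sum.inr ()))) :
    DefPred L fun v => ∀ᶠ x in 𝓝 (t v), P v x := by
  simp only [eventually_nhds_iff_Ioo]
  apply_rules [DefPred.ex, DefPred.and, DefPred.all, DefPred.imp, DefPred.lt, DefFun.var,
      ht.reindex]

theorem eventually_side_Iio (s : Bool) (p a : M) :
    (∀ᶠ x in side s p, x < a) ∨ ∀ᶠ x in side s p, ¬ x < a := by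
  cases s
  · rcases le_or_gt p a with h | h
    · left
      exact Filter.mem_of_superset self_mem_nhdsWithin fun x hx => lt_of_lt_of_le hx h
    · right
      exact Filter.Eventually.mono (side_le_nhds false p (lt_mem_nhds h)) fun x hx => not_lt.2 hx.le
  · rcases lt_or_ge p a with h | h
    · left
      exact side_le_nhds true p (gt_mem_nhds h)
    · right
      exact Filter.mem_of_superset self_mem_nhdsWithin fun x hx => not_lt.2 (h.trans (le_of_lt hx))

theorem eventually_side_Ioi (s : Bool) (p a : M) :
    (∀ᶠ x in side s p, a < x) ∨ ∀ᶠ x in side s p, ¬ a < x := by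
  have hne : ∀ᶠ x in side s p, x ≠ p := side_le_nhdsNE s p self_mem_nhdsWithin
  by_cases hpa : p = a
  · subst hpa
    rcases eventually_side_Iio s p p with h | h
    · exact Or.inr (h.mono fun x hx => not_lt.2 hx.le)
    · exact Or.inl ((h.and hne).mono fun x hx => lt_of_le_of_ne (not_lt.1 hx.1) hx.2.symm)
  · rcases lt_or_gt_of_ne hpa with h | h
    · exact Or.inr (Filter.Eventually.mono (side_le_nhds s p (gt_mem_nhds h)) fun x hx =>
        not_lt.2 (le_of_lt hx))
    · exact Or.inl (side_le_nhds s p (lt_mem_nhds h))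

theorem IsPointOrInterval.eventually_side_or {I : Set M} (hI : IsPointOrInterval I) (s : Bool)
    (p : M) : (∀ᶠ x in side s p, x ∈ I) ∨ ∀ᶠ x in side s p, x ∉ I := by
  rcases hI with rfl | ⟨a, rfl⟩ | ⟨a, rfl⟩ | ⟨a, rfl⟩ | ⟨a, b, rfl⟩
  · simp
  · right
    rcases eventually_side_Iio s p a with h | h
    · exact h.mono fun x hx => ne_of_lt hx
    rcases eventually_side_Ioi s p a with h' | h'
    · exact h'.mono fun x hx => ne_of_gt hx
    · have : ∀ᶠ x in side s p, x = a :=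
        (h.and h').mono fun x hx => le_antisymm (not_lt.1 hx.2) (not_lt.1 hx.1)
      by_cases hpa : p = a
      · have hne : ∀ᶠ x in side s p, x ≠ p := side_le_nhdsNE s p self_mem_nhdsWithin
        exact hne.mono fun x hx => by simpa [hpa] using hx
      · exact side_le_nhds s p (isOpen_ne.mem_nhds hpa)
  · exact eventually_side_Iio s p a
  · exact eventually_side_Ioi s p a
  · rcases eventually_side_Iio s p b with h | h
    · rcases eventually_side_Ioi s p a with h' | h'
      · exact Or.inl ((h.and h').mono fun x hx => ⟨hx.2, hx.1⟩)
      · exact Or.inr (h'.mono fun x hx hx' => hx hx'.1)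
    · exact Or.inr (h.mono fun x hx hx' => hx hx'.2)

/-- A definable subset of the line either contains a one-sided neighbourhood of `p` or is disjoint
from one. -/
theorem DefPred₁.eventually_side_or (hM : IsOMinimal L M) {P : M → Prop} (hP : DefPred₁ L P)
    (s : Bool) (p : M) : (∀ᶠ x in side s p, P x) ∨ ∀ᶠ x in side s p, ¬ P x := by
  obtain ⟨F, hF, hI, hPF⟩ := hP.exists_finite_sUnion hM
  by_cases h : ∃ I ∈ F, ∀ᶠ x in side s p, x ∈ I
  · obtain ⟨I, hIF, h⟩ := h
    refine Or.inl (h.mono fun x hx => ?_)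
    have : x ∈ {x | P x} := hPF ▸ mem_sUnion_of_mem hx hIF
    exact this
  · push Not at h
    right
    have : ∀ᶠ x in side s p, ∀ I ∈ F, x ∉ I :=
      (Filter.eventually_all_finite hF).2 fun I hIF =>
        ((hI I hIF).eventually_side_or s p).resolve_left (Filter.not_eventually.2 (h I hIF))
    refine this.mono fun x hx hPx => ?_
    have : x ∈ ⋃₀ F := hPF ▸ hPx
    obtain ⟨I, hIF, hxI⟩ := this
    exact hx I hIF hxI

/-- An infinite definable subset of the line contains an interval. -/
theorem DefPred₁.exists_Ioo_of_infinite (hM : IsOMinimal L M) {P : M → Prop} (hP : DefPred₁ L P)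
    (hinf : {x | P x}.Infinite) : ∃ c d, c < d ∧ ∀ x, c < x → x < d → P x := by
  obtain ⟨F, hF, hI, hPF⟩ := hP.exists_finite_sUnion hM
  have : ∃ I ∈ F, I.Infinite := by
    by_contra! h
    exact hinf (hPF ▸ hF.sUnion h)
  obtain ⟨I, hIF, hIi⟩ := this
  have hsub : ∀ x ∈ I, P x := fun x hx => by
    have : x ∈ {x | P x} := hPF ▸ mem_sUnion_of_mem hx hIF
    exact this
  rcases hI I hIF with rfl | ⟨a, rfl⟩ | ⟨a, rfl⟩ | ⟨a, rfl⟩ | ⟨a, b, rfl⟩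
  · obtain ⟨c, d, hcd⟩ := exists_pair_lt M
    exact ⟨c, d, hcd, fun x _ _ => hsub x trivial⟩
  · exact absurd (finite_singleton a) hIi
  · obtain ⟨c, hc⟩ := exists_lt a
    exact ⟨c, a, hc, fun x _ hx => hsub x hx⟩
  · obtain ⟨c, hc⟩ := exists_gt a
    exact ⟨a, c, hc, fun x hx _ => hsub x hx⟩
  · obtain ⟨x, hx⟩ := hIi.nonempty
    exact ⟨a, b, hx.1.trans hx.2, fun x h1 h2 => hsub x ⟨h1, h2⟩⟩

/-- Every interval contains a subinterval on which a given definable property is constant. -/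
theorem DefPred₁.exists_Ioo_subset (hM : IsOMinimal L M) {P : M → Prop} (hP : DefPred₁ L P)
    {a b : M} (hab : a < b) : ∃ c d, a ≤ c ∧ c < d ∧ d ≤ b ∧
      ((∀ x, c < x → x < d → P x) ∨ ∀ x, c < x → x < d → ¬ P x) := by
  rcases hP.eventually_side_or hM true a with h | h <;>
  · obtain ⟨u, hu, h⟩ := eventually_side_true.1 h
    refine ⟨a, min u b, le_rfl, lt_min hu hab, min_le_right _ _, ?_⟩
    first
    | exact Or.inl fun x h1 h2 => h x h1 (h2.trans_le (min_le_left _ _))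
    | exact Or.inr fun x h1 h2 => h x h1 (h2.trans_le (min_le_left _ _))

theorem eventually_nhds_or_of_notMem_frontier {P : M → Prop} {p : M}
    (h : p ∉ frontier {x | P x}) : (∀ᶠ x in 𝓝 p, P x) ∨ ∀ᶠ x in 𝓝 p, ¬ P x := by
  rw [frontier, mem_sdiff, not_and, not_not] at h
  by_cases hp : p ∈ closure {x | P x}
  · exact Or.inl (mem_interior_iff_mem_nhds.1 (h hp))
  · rw [← mem_compl_iff, ← interior_compl] at hp
    exact Or.inr (mem_interior_iff_mem_nhds.1 hp)

theorem DefPred₁.finite_frontier (hM : IsOMinimal L M) {P : M → Prop} (hP : DefPred₁ L P) :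
    (frontier {x | P x}).Finite := by
  have hd : DefPred₁ L fun p =>
      ¬ ((∀ᶠ x in 𝓝 p, P x) ∨ ∀ᶠ x in 𝓝 p, ¬ P x) := by
    apply_rules [DefPred.not, DefPred.or, DefPred.eventually_nhds, hP.app, DefFun.var, hM]
  by_contra hinf
  have hinf : {p | ¬ ((∀ᶠ x in 𝓝 p, P x) ∨ ∀ᶠ x in 𝓝 p, ¬ P x)}.Infinite := by
    refine Set.Infinite.mono (fun p hp h => ?_) hinf
    rcases h with h | h
    · exact hp.2 (mem_interior_iff_mem_nhds.2 h)
    · exact absurd hp.1 (by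
        rw [← mem_compl_iff, ← interior_compl]; exact mem_interior_iff_mem_nhds.2 h)
  obtain ⟨c, d, hcd, h⟩ := hd.exists_Ioo_of_infinite hM hinf
  obtain ⟨c', d', hc, hcd', hd', h'⟩ := hP.exists_Ioo_subset hM hcd
  obtain ⟨x, hx⟩ := exists_between hcd'
  refine h x (hc.trans_lt hx.1) (hx.2.trans_le hd') ?_
  rcases h' with h' | h'
  · exact Or.inl (eventually_nhds_iff_Ioo.2 ⟨c', d', hx.1, hx.2, h'⟩)
  · exact Or.inr (eventually_nhds_iff_Ioo.2 ⟨c', d', hx.1, hx.2, h'⟩)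

/-- Order-convex subsets of the line are definably connected. -/
theorem DefPred₁.of_ordConnected (hM : IsOMinimal L M) {P : M → Prop} (hP : DefPred₁ L P)
    {I : Set M} (hI : I.OrdConnected)
    (hloc : ∀ t ∈ I, (∀ᶠ x in 𝓝[I] t, P x) ∨ ∀ᶠ x in 𝓝[I] t, ¬ P x) {a b : M} (ha : a ∈ I)
    (hb : b ∈ I) (hPa : P a) : P b := by
  wlog hab : a < b generalizing a b P
  · rcases eq_or_lt_of_le (not_lt.1 hab) with rfl | hba
    · exact hPa
    by_contra hPb
    exact this (P := fun x => ¬ P x) hP.not (fun t ht => by simpa using (hloc t ht).symm) hb ha hPb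
      hba hPa
  by_contra hPb
  have hd : DefPred₁ L fun x => a ≤ x ∧ x ≤ b ∧ ∀ y, a ≤ y → y ≤ x → P y := by
    apply_rules [DefPred.and, DefPred.all, DefPred.imp, DefPred.le, hP.app, DefFun.var,
      DefFun.const, hM]
  obtain ⟨p, hp⟩ := hd.exists_isLUB hM
    ⟨a, le_rfl, hab.le, fun y h1 h2 => (le_antisymm h1 h2) ▸ hPa⟩ ⟨b, fun x hx => hx.2.1⟩
  have hap : a ≤ p := hp.1 ⟨le_rfl, hab.le, fun y h1 h2 => (le_antisymm h1 h2) ▸ hPa⟩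
  have hpb : p ≤ b := hp.2 fun x hx => hx.2.1
  have hlow : ∀ y, a ≤ y → y < p → P y := fun y h1 h2 => by
    obtain ⟨x, hx, hyx⟩ := (lt_isLUB_iff hp).1 h2
    exact hx.2.2 y h1 hyx.le
  have hpI : p ∈ I := hI.out ha hb ⟨hap, hpb⟩
  rcases hloc p hpI with h | h
  · have hPp : P p := h.self_of_nhdsWithin hpI
    have hpb' : p < b := lt_of_le_of_ne hpb fun h => hPb (h ▸ hPp)
    obtain ⟨u, v, hu, hv, huv⟩ := eventually_nhds_iff_Ioo.1 (eventually_nhdsWithin_iff.1 h)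
    obtain ⟨q, hq1, hq2⟩ := exists_between (lt_min hv hpb')
    have hq := lt_min_iff.1 hq2
    refine absurd (hp.1 (show q ∈ {x | a ≤ x ∧ x ≤ b ∧ ∀ y, a ≤ y → y ≤ x → P y} from
      ⟨hap.trans hq1.le, hq.2.le, fun y h1 h2 => ?_⟩)) (not_le.2 hq1)
    rcases lt_or_ge y p with h3 | h3
    · exact hlow y h1 h3
    · exact huv y (hu.trans_le h3) (h2.trans_lt hq.1) (hI.out ha hb ⟨h1, h2.trans hq.2.le⟩)
  · have hPp : ¬ P p := h.self_of_nhdsWithin hpI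
    have hap' : a < p := lt_of_le_of_ne hap fun h => hPp (h ▸ hPa)
    obtain ⟨u, v, hu, hv, huv⟩ := eventually_nhds_iff_Ioo.1 (eventually_nhdsWithin_iff.1 h)
    obtain ⟨q, hq1, hq2⟩ := exists_between (max_lt hu hap')
    have hq := max_lt_iff.1 hq1
    exact huv q hq.1 (hq2.trans hv) (hI.out ha hb ⟨hq.2.le, hq2.le.trans hpb⟩) (hlow q hq.2.le hq2)

end Line

/-! ### Definable functions of one variable -/

section Functions

variable {L : Language} {M : Type*} [L.Structure M] [AddCommGroup M] [LinearOrder M]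
  [IsOrderedAddMonoid M] [Nontrivial M] [TopologicalSpace M] [OrderTopology M] [DenselyOrdered M]
  {α : Type*}

/-- A definable function with infinite fibres is constant on an interval; one with finite fibres
has, on an interval of its image, an injective section. -/
theorem DefFun₁.exists_const_or_injOn (hM : IsOMinimal L M) {f : M → M} (hf : DefFun₁ L f)
    {a b : M} (hab : a < b) : ∃ c d, a ≤ c ∧ c < d ∧ d ≤ b ∧
      ((∃ k, ∀ x ∈ Ioo c d, f x = k) ∨ InjOn f (Ioo c d)) := by
  by_cases hfib : ∃ k, {x | a < x ∧ x < b ∧ f x = k}.Infinite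
  · obtain ⟨k, hk⟩ := hfib
    have hd : DefPred₁ L fun x => a < x ∧ x < b ∧ f x = k := by
      apply_rules [DefPred.and, DefPred.eq, DefPred.lt, hf.app, DefFun.var, DefFun.const, hM]
    obtain ⟨c, d, hcd, h⟩ := hd.exists_Ioo_of_infinite hM hk
    refine ⟨c, d, ?_, hcd, ?_, Or.inl ⟨k, fun x hx => (h x hx.1 hx.2).2.2⟩⟩
    · by_contra! hca
      obtain ⟨x, hx⟩ := exists_between (lt_min hca hcd)
      have := lt_min_iff.1 hx.2
      exact lt_asymm this.1 (h x hx.1 this.2).1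
    · by_contra! hca
      obtain ⟨x, hx⟩ := exists_between (max_lt hca hcd)
      have := max_lt_iff.1 hx.1
      exact lt_asymm this.1 (h x this.2 hx.2).2.1
  simp only [not_exists, not_infinite] at hfib
  have himg : DefPred₁ L fun y => ∃ x, a < x ∧ x < b ∧ f x = y := by
    apply_rules [DefPred.ex, DefPred.and, DefPred.eq, DefPred.lt, hf.app, DefFun.var,
      DefFun.const, hM]
  have hinf : {y | ∃ x, a < x ∧ x < b ∧ f x = y}.Infinite := by
    intro hfin
    refine (Ioo_infinite hab) (Set.Finite.subset (hfin.biUnion fun y _ => hfib y) ?_)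
    intro x hx
    simp only [mem_iUnion]
    exact ⟨f x, ⟨x, hx.1, hx.2, rfl⟩, hx.1, hx.2, rfl⟩
  -- The set of points that are the first in their fibre maps onto the infinite image.
  have hmin : DefPred₁ L fun x => a < x ∧ x < b ∧ ∀ y, a < y → y < x → f y ≠ f x := by
    apply_rules [DefPred.and, DefPred.all, DefPred.not, DefPred.imp, DefPred.eq, DefPred.lt,
      hf.app, DefFun.var, DefFun.const, hM]
  have hinf' : {x | a < x ∧ x < b ∧ ∀ y, a < y → y < x → f y ≠ f x}.Infinite := by
    refine Set.Infinite.of_image f (hinf.mono ?_)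
    rintro y ⟨x, h1, h2, hxy⟩
    obtain ⟨z, hz, hzmin⟩ := Set.exists_min_image _ id (hfib y) ⟨x, h1, h2, hxy⟩
    refine ⟨z, ⟨hz.1, hz.2.1, fun w hw hwz hwe => ?_⟩, hz.2.2⟩
    exact absurd (hzmin w ⟨hw, hwz.trans hz.2.1, hwe.trans hz.2.2⟩) (not_le.2 hwz)
  obtain ⟨c, d, hcd, h⟩ := hmin.exists_Ioo_of_infinite hM hinf'
  refine ⟨c, d, ?_, hcd, ?_, Or.inr fun x hx y hy hxy => ?_⟩
  · by_contra! hca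
    obtain ⟨x, hx⟩ := exists_between (lt_min hca hcd)
    have := lt_min_iff.1 hx.2
    exact lt_asymm this.1 (h x hx.1 this.2).1
  · by_contra! hca
    obtain ⟨x, hx⟩ := exists_between (max_lt hca hcd)
    have := max_lt_iff.1 hx.1
    exact lt_asymm this.1 (h x this.2 hx.2).2.1
  · rcases lt_trichotomy x y with hlt | rfl | hlt
    · exact absurd hxy ((h y hy.1 hy.2).2.2 x (h x hx.1 hx.2).1 hlt)
    · rfl
    · exact absurd hxy.symm ((h x hx.1 hx.2).2.2 y (h y hy.1 hy.2).1 hlt)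

/-- A positive definable function is bounded away from zero on some interval. In the injective case
the images of two disjoint intervals are disjoint definable sets, so they cannot both accumulate
at `0`. -/
theorem DefFun₁.exists_pos_le (hM : IsOMinimal L M) {f : M → M} (hf : DefFun₁ L f)
    {a b : M} (hab : a < b) (hpos : ∀ x ∈ Ioo a b, 0 < f x) : ∃ c d, a ≤ c ∧ c < d ∧ d ≤ b ∧
      ∃ ε, 0 < ε ∧ ∀ x ∈ Ioo c d, ε ≤ f x := by
  obtain ⟨c, d, hac, hcd, hdb, h⟩ := hf.exists_const_or_injOn hM hab
  rcases h with ⟨k, hk⟩ | hinj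
  · obtain ⟨x, hx⟩ := exists_between hcd
    exact ⟨c, d, hac, hcd, hdb, k, hk x hx ▸ hpos x ⟨hac.trans_lt hx.1, hx.2.trans_le hdb⟩,
      fun y hy => (hk y hy).ge⟩
  obtain ⟨m, hcm, hmd⟩ := exists_between hcd
  have himg : ∀ u v, DefPred₁ L fun y => ∃ x, u < x ∧ x < v ∧ f x = y := fun u v => by
    apply_rules [DefPred.ex, DefPred.and, DefPred.eq, DefPred.lt, hf.app, DefFun.var,
      DefFun.const, hM]
  have key : ∀ u v, c ≤ u → v ≤ d → (∀ᶠ y in side true 0, ¬ ∃ x, u < x ∧ x < v ∧ f x = y) →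
      ∃ ε, 0 < ε ∧ ∀ x ∈ Ioo u v, ε ≤ f x := by
    intro u v hu hv h
    obtain ⟨ε, hε, h⟩ := eventually_side_true.1 h
    refine ⟨ε, hε, fun x hx => not_lt.1 fun hlt => h (f x) (hpos x ?_) hlt ⟨x, hx.1, hx.2, rfl⟩⟩
    exact ⟨(hac.trans hu).trans_lt hx.1, hx.2.trans_le (hv.trans hdb)⟩
  rcases (himg c m).eventually_side_or hM true 0 with h1 | h1
  · rcases (himg m d).eventually_side_or hM true 0 with h2 | h2
    · obtain ⟨y, ⟨x, hx1, hx2, hxy⟩, ⟨z, hz1, hz2, hzy⟩⟩ := (h1.and h2).exists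
      have := hinj ⟨hx1, hx2.trans hmd⟩ ⟨hcm.trans hz1, hz2⟩ (hxy.trans hzy.symm)
      exact absurd (hx2.trans hz1) (this ▸ lt_irrefl _)
    · exact ⟨m, d, hac.trans hcm.le, hmd, hdb, key m d hcm.le le_rfl h2⟩
  · exact ⟨c, m, hac, hcm, hmd.le.trans hdb, key c m le_rfl hmd.le h1⟩

/-- If for each `t` in an interval the property `W t r` holds for all small `r > 0`, then some
fixed `r > 0` works for all `t` in a subinterval. -/
theorem DefPred₂.exists_uniform (hM : IsOMinimal L M) {W : M → M → Prop} (hW : DefPred₂ L W)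
    (hmono : ∀ t r r', 0 < r' → r' ≤ r → W t r → W t r') {a b : M} (hab : a < b)
    (h : ∀ t ∈ Ioo a b, ∃ r, 0 < r ∧ W t r) : ∃ c d, a ≤ c ∧ c < d ∧ d ≤ b ∧
      ∃ ε, 0 < ε ∧ ∀ t ∈ Ioo c d, W t ε := by
  obtain ⟨u, hu⟩ := exists_gt (0 : M)
  have hG : DefPred₂ L fun t δ => (∀ r, 0 < r → r ≤ u → W t r → r ≤ δ) ∧
      ∀ δ', (∀ r, 0 < r → r ≤ u → W t r → r ≤ δ') → δ ≤ δ' := by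
    apply_rules [DefPred.and, DefPred.all, DefPred.imp, DefPred.le, DefPred.lt, hW.app, DefFun.var,
      DefFun.const, hM]
  obtain ⟨f, hf, hfG⟩ := exists_defFun₁ hG
    fun t y z hy hz => le_antisymm (hy.2 z hz.1) (hz.2 y hy.1)
  have hlub : ∀ t ∈ Ioo a b, IsLUB {r | 0 < r ∧ r ≤ u ∧ W t r} (f t) := by
    intro t ht
    have hd : DefPred₁ L fun r => 0 < r ∧ r ≤ u ∧ W t r := by
      apply_rules [DefPred.and, DefPred.le, DefPred.lt, hW.app, DefFun.var, DefFun.const, hM]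
    obtain ⟨r, hr, hWr⟩ := h t ht
    obtain ⟨p, hp⟩ := hd.exists_isLUB hM ⟨min r u, lt_min hr hu, min_le_right _ _,
      hmono t r _ (lt_min hr hu) (min_le_left _ _) hWr⟩ ⟨u, fun x hx => hx.2.1⟩
    rwa [hfG t p ⟨fun r h1 h2 h3 => hp.1 ⟨h1, h2, h3⟩,
      fun δ' hδ' => hp.2 fun r hr => hδ' r hr.1 hr.2.1 hr.2.2⟩]
  obtain ⟨c, d, hac, hcd, hdb, ε, hε, hle⟩ := hf.exists_pos_le hM hab fun t ht => by
    obtain ⟨r, hr, hWr⟩ := h t ht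
    exact lt_of_lt_of_le (lt_min hr hu) ((hlub t ht).1 ⟨lt_min hr hu, min_le_right _ _,
      hmono t r _ (lt_min hr hu) (min_le_left _ _) hWr⟩)
  obtain ⟨ε', hε', hlt⟩ := exists_between hε
  refine ⟨c, d, hac, hcd, hdb, ε', hε', fun t ht => ?_⟩
  have ht' : t ∈ Ioo a b := ⟨hac.trans_lt ht.1, ht.2.trans_le hdb⟩
  obtain ⟨r, hr, hr'⟩ := (lt_isLUB_iff (hlub t ht')).1 (hlt.trans_le (hle t ht))
  exact hmono t r ε' hε' hr'.le hr.2.2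

/-- If for each `t` in an interval `Q t s` holds for all `s > t` near `t`, then on a subinterval
`Q t s` holds for all `t < s`. -/
theorem DefPred₂.exists_Ioo_forall_lt (hM : IsOMinimalExpansion L M) {Q : M → M → Prop}
    (hQ : DefPred₂ L Q) {a b : M} (hab : a < b)
    (h : ∀ t ∈ Ioo a b, ∀ᶠ s in side true t, Q t s) : ∃ c d, a ≤ c ∧ c < d ∧ d ≤ b ∧
      ∀ t s, c < t → t < s → s < d → Q t s := by
  have hW : DefPred₂ L fun t r => ∀ s, t < s → s < t + r → Q t s := by
    apply_rules [DefPred.all, DefPred.imp, DefPred.lt, hQ.app, DefFun.add, DefFun.var, hM, hM.1]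
  obtain ⟨c, d, hac, hcd, hdb, ε, hε, hW⟩ := hW.exists_uniform hM.1
    (fun t r r' _ hr' hr s h1 h2 => hr s h1 (h2.trans_le (by gcongr))) hab fun t ht => by
      obtain ⟨u, hu, h⟩ := eventually_side_true.1 (h t ht)
      exact ⟨u - t, sub_pos.2 hu, fun s h1 h2 => h s h1 (by simpa using h2)⟩
  refine ⟨c, min d (c + ε), hac, lt_min hcd (by simpa using hε), (min_le_left _ _).trans hdb,
    fun t s hct hts hsd => ?_⟩
  have := lt_min_iff.1 hsd
  exact hW t ⟨hct, hts.trans this.1⟩ s hts (this.2.trans (by gcongr))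

theorem neg_mem_side_false {t : M} {P : M → Prop} (h : ∀ᶠ s in side false (-t), P s) :
    ∀ᶠ s in side true t, P (-s) := by
  obtain ⟨u, hu, h⟩ := eventually_side_false.1 h
  exact eventually_side_true.2 ⟨-u, lt_neg_of_lt_neg hu, fun x h1 h2 =>
    h _ (lt_neg_of_lt_neg h2) (neg_lt_neg h1)⟩

/-- The left-sided version of `DefPred₂.exists_Ioo_forall_lt`. -/
theorem DefPred₂.exists_Ioo_forall_gt (hM : IsOMinimalExpansion L M) {Q : M → M → Prop}
    (hQ : DefPred₂ L Q) {a b : M} (hab : a < b)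
    (h : ∀ t ∈ Ioo a b, ∀ᶠ s in side false t, Q t s) : ∃ c d, a ≤ c ∧ c < d ∧ d ≤ b ∧
      ∀ t s, c < s → s < t → t < d → Q t s := by
  have hQ' : DefPred₂ L fun t s => Q (-t) (-s) := by
    apply_rules [hQ.app, DefFun.neg, DefFun.var, hM]
  obtain ⟨c, d, hac, hcd, hdb, h'⟩ := hQ'.exists_Ioo_forall_lt hM (neg_lt_neg hab) fun t ht =>
    neg_mem_side_false (h (-t) ⟨lt_neg_of_lt_neg ht.2, neg_lt_of_neg_lt ht.1⟩)
  refine ⟨-d, -c, le_neg_of_le_neg hdb, neg_lt_neg hcd, neg_le_of_neg_le hac,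
    fun t s h1 h2 h3 => ?_⟩
  simpa using h' (-t) (-s) (lt_neg_of_lt_neg h3) (neg_lt_neg h2) (neg_lt_of_neg_lt h1)

theorem DefFun₁.exists_continuousAt_of_strictMonoOn (hM : IsOMinimal L M) {f : M → M}
    (hf : DefFun₁ L f) {a b : M} (hab : a < b) (hmono : StrictMonoOn f (Ioo a b)) :
    ∃ x ∈ Ioo a b, ContinuousAt f x := by
  have himg : DefPred₁ L fun y => ∃ x, a < x ∧ x < b ∧ f x = y := by
    apply_rules [DefPred.ex, DefPred.and, DefPred.eq, DefPred.lt, hf.app, DefFun.var,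
      DefFun.const, hM]
  have hinf : {y | ∃ x, a < x ∧ x < b ∧ f x = y}.Infinite := by
    refine ((Ioo_infinite hab).image hmono.injOn).mono ?_
    rintro _ ⟨x, hx, rfl⟩
    exact ⟨x, hx.1, hx.2, rfl⟩
  obtain ⟨p, q, hpq, h⟩ := himg.exists_Ioo_of_infinite hM hinf
  obtain ⟨y, hy⟩ := exists_between hpq
  obtain ⟨x, hax, hxb, rfl⟩ := h y hy.1 hy.2
  refine ⟨x, ⟨hax, hxb⟩, continuousAt_of_monotoneOn_of_image_mem_nhds hmono.monotoneOn
    (Ioo_mem_nhds hax hxb) (Filter.mem_of_superset (Ioo_mem_nhds hy.1 hy.2) ?_)⟩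
  intro y hy
  obtain ⟨z, h1, h2, rfl⟩ := h y hy.1 hy.2
  exact ⟨z, ⟨h1, h2⟩, rfl⟩

theorem DefFun₁.exists_continuousAt (hM : IsOMinimalExpansion L M) {f : M → M}
    (hf : DefFun₁ L f) {a b : M} (hab : a < b) : ∃ x ∈ Ioo a b, ContinuousAt f x := by
  obtain ⟨c, d, hac, hcd, hdb, h⟩ := hf.exists_const_or_injOn hM.1 hab
  rcases h with ⟨k, hk⟩ | hinj
  · obtain ⟨x, hx⟩ := exists_between hcd
    refine ⟨x, ⟨hac.trans_lt hx.1, hx.2.trans_le hdb⟩, ?_⟩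
    exact continuousAt_const.congr
      (Filter.mem_of_superset (Ioo_mem_nhds hx.1 hx.2) fun y hy => (hk y hy).symm)
  have hlt : DefPred₂ L fun t s => f t < f s := by
    apply_rules [DefPred.lt, hf.app, DefFun.var, hM.1]
  have hgt : DefPred₂ L fun t s => f s < f t := by
    apply_rules [DefPred.lt, hf.app, DefFun.var, hM.1]
  have hinc : DefPred₁ L fun t => ∀ᶠ s in side true t, f t < f s := by
    apply_rules [DefPred.eventually_side, hlt.app, DefFun.var, hM.1]
  obtain ⟨c', d', hcc', hcd', hdd', h⟩ := hinc.exists_Ioo_subset hM.1 hcd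
  rcases h with h | h
  · obtain ⟨c2, d2, h1, h2, h3, h⟩ := hlt.exists_Ioo_forall_lt hM hcd' fun t ht => h t ht.1 ht.2
    obtain ⟨x, hx, hc⟩ := hf.exists_continuousAt_of_strictMonoOn hM.1 h2
      fun t ht s hs hts => h t s ht.1 hts hs.2
    exact ⟨x, ⟨(hac.trans (hcc'.trans h1)).trans_lt hx.1,
      hx.2.trans_le (h3.trans (hdd'.trans hdb))⟩, hc⟩
  · have hdec : ∀ t ∈ Ioo c' d', ∀ᶠ s in side true t, f s < f t := by
      intro t ht
      have hd : DefPred₁ L fun s => f t < f s := by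
        apply_rules [hlt.app, DefFun.var, DefFun.const]
      have h1 := (hd.eventually_side_or hM.1 true t).resolve_left (h t ht.1 ht.2)
      have h2 : ∀ᶠ s in side true t, s ∈ Ioo c d :=
        side_le_nhds _ _ (Ioo_mem_nhds (hcc'.trans_lt ht.1) (ht.2.trans_le hdd'))
      have h3 : ∀ᶠ s in side true t, s ≠ t := side_le_nhdsNE true t self_mem_nhdsWithin
      filter_upwards [h1, h2, h3] with s h1 h2 h3
      refine lt_of_le_of_ne (not_lt.1 h1) fun he => h3 (hinj h2 ?_ he)
      exact ⟨hcc'.trans_lt ht.1, ht.2.trans_le hdd'⟩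
    obtain ⟨c2, d2, h1, h2, h3, h⟩ := hgt.exists_Ioo_forall_lt hM hcd' hdec
    have hneg : DefFun₁ L fun x => - f x := by
      refine DefFun₁.of_defFun ?_
      apply_rules [DefFun.neg, hf.app, DefFun.var, hM]
    obtain ⟨x, hx, hc⟩ := hneg.exists_continuousAt_of_strictMonoOn hM.1 h2
      fun t ht s hs hts => neg_lt_neg (h t s ht.1 hts hs.2)
    refine ⟨x, ⟨(hac.trans (hcc'.trans h1)).trans_lt hx.1,
      hx.2.trans_le (h3.trans (hdd'.trans hdb))⟩, ?_⟩
    exact hc.neg.congr (.of_forall fun y => neg_neg (f y))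

theorem continuousAt_iff_Ioo {f : M → M} {x : M} : ContinuousAt f x ↔
    ∀ u v, u < f x → f x < v → ∀ᶠ y in 𝓝 x, u < f y ∧ f y < v := by
  rw [ContinuousAt, (nhds_basis_Ioo (f x)).tendsto_right_iff]
  exact ⟨fun h u v hu hv => h (u, v) ⟨hu, hv⟩, fun h p hp => h p.1 p.2 hp.1 hp.2⟩

/-- A definable function of one variable has finitely many discontinuities. -/
theorem DefFun₁.finite_not_continuousAt (hM : IsOMinimalExpansion L M) {f : M → M}
    (hf : DefFun₁ L f) : {x | ¬ ContinuousAt f x}.Finite := by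
  have hd : DefPred₁ L fun x => ¬ ∀ u v, u < f x → f x < v → ∀ᶠ y in 𝓝 x, u < f y ∧ f y < v := by
    apply_rules [DefPred.not, DefPred.all, DefPred.imp, DefPred.eventually_nhds, DefPred.and,
      DefPred.lt, hf.app, DefFun.var, hM.1]
  by_contra hinf
  simp only [continuousAt_iff_Ioo] at hinf
  obtain ⟨c, d, hcd, h⟩ := hd.exists_Ioo_of_infinite hM.1 hinf
  obtain ⟨x, hx, hc⟩ := hf.exists_continuousAt hM hcd
  exact h x hx.1 hx.2 (continuousAt_iff_Ioo.1 hc)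

/-- Definable choice: a definable family of nonempty sets, uniformly bounded below, has a definable
selection on some interval. -/
theorem DefPred₂.exists_selection (hM : IsOMinimalExpansion L M) {S : M → M → Prop}
    (hS : DefPred₂ L S) {k : M} (hk : ∀ t y, S t y → k ≤ y) {a b : M} (hab : a < b)
    (h : ∀ t ∈ Ioo a b, ∃ y, S t y) : ∃ c d, a ≤ c ∧ c < d ∧ d ≤ b ∧
      ∃ f, DefFun₁ L f ∧ ∀ t ∈ Ioo c d, S t (f t) := by
  have hG : DefPred₂ L fun t p => (∀ y, S t y → p ≤ y) ∧ ∀ q, (∀ y, S t y → q ≤ y) → q ≤ p := by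
    apply_rules [DefPred.and, DefPred.all, DefPred.imp, DefPred.le, hS.app, DefFun.var, hM.1]
  obtain ⟨f, hf, hfG⟩ := exists_defFun₁ hG
    fun t y z hy hz => le_antisymm (hz.2 y hy.1) (hy.2 z hz.1)
  have hglb : ∀ t ∈ Ioo a b, IsGLB {y | S t y} (f t) := by
    intro t ht
    obtain ⟨y, hy⟩ := h t ht
    have hd : DefPred₁ L fun p => ∀ y, S t y → p ≤ y := by
      apply_rules [DefPred.all, DefPred.imp, DefPred.le, hS.app, DefFun.var, DefFun.const, hM.1]
    obtain ⟨p, hp⟩ := hd.exists_isLUB hM.1 ⟨k, hk t⟩ ⟨y, fun p hp => hp y hy⟩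
    have hp' : IsGLB {y | S t y} p := isLUB_lowerBounds.1 hp
    rwa [hfG t p ⟨hp'.1, fun q hq => hp'.2 hq⟩]
  have hatt : DefPred₁ L fun t => S t (f t) := by
    apply_rules [hS.app, hf.app, DefFun.var]
  obtain ⟨c, d, hac, hcd, hdb, h'⟩ := hatt.exists_Ioo_subset hM.1 hab
  rcases h' with h' | h'
  · exact ⟨c, d, hac, hcd, hdb, f, hf, fun t ht => h' t ht.1 ht.2⟩
  -- The infimum is not attained, so it is the left endpoint of an interval in the fibre.
  have hW : DefPred₂ L fun t r => ∀ y, f t < y → y < f t + r → S t y := by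
    apply_rules [DefPred.all, DefPred.imp, DefPred.lt, hS.app, hf.app, DefFun.add, DefFun.var, hM,
      hM.1]
  obtain ⟨c', d', hac', hcd', hdb', ε, hε, hW⟩ := hW.exists_uniform hM.1
    (fun t r r' _ hr' hr s h1 h2 => hr s h1 (h2.trans_le (by gcongr))) hcd fun t ht => by
      have hd : DefPred₁ L fun y => S t y := by
        apply_rules [hS.app, DefFun.var, DefFun.const]
      have hg := hglb t ⟨hac.trans_lt ht.1, ht.2.trans_le hdb⟩
      rcases hd.eventually_side_or hM.1 true (f t) with h1 | h1
      · obtain ⟨u, hu, h1⟩ := eventually_side_true.1 h1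
        exact ⟨u - f t, sub_pos.2 hu, fun y h2 h3 => h1 y h2 (by simpa using h3)⟩
      · obtain ⟨u, hu, h1⟩ := eventually_side_true.1 h1
        obtain ⟨y, hy, hyu⟩ := (isGLB_lt_iff hg).1 hu
        exact absurd hy (h1 y (lt_of_le_of_ne (hg.1 hy) fun he => h' t ht.1 ht.2 (he ▸ hy)) hyu)
  obtain ⟨ε', hε', hlt⟩ := exists_between hε
  refine ⟨c', d', hac.trans hac', hcd', hdb'.trans hdb, fun t => f t + ε', ?_, fun t ht =>
    hW t ht _ (lt_add_of_pos_right _ hε') (by simpa using hlt)⟩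
  refine DefFun₁.of_defFun ?_
  apply_rules [DefFun.add, hf.app, DefFun.var, DefFun.const, hM]

end Functions

/-! ### Planar sets with finite fibres -/

section Planar

variable {L : Language} {M : Type*} [L.Structure M] [AddCommGroup M] [LinearOrder M]
  [IsOrderedAddMonoid M] [Nontrivial M] [TopologicalSpace M] [OrderTopology M] [DenselyOrdered M]

/-- The points of a planar set that are not the lowest ones in their fibre. -/
def peel {M : Type*} [LT M] (A : M → M → Prop) (t y : M) : Prop := A t y ∧ ∃ z, z < y ∧ A t z

theorem DefPred₂.peel (hM : IsOMinimal L M) {A : M → M → Prop} (hA : DefPred₂ L A) :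
    DefPred₂ L (peel A) := by
  have : DefPred₂ L fun t y => A t y ∧ ∃ z, z < y ∧ A t z := by
    apply_rules [DefPred.ex, DefPred.and, DefPred.lt, hA.app, DefFun.var]
  exact this

theorem DefPred₂.peel_iterate (hM : IsOMinimal L M) {A : M → M → Prop} (hA : DefPred₂ L A)
    (n : ℕ) : DefPred₂ L (OMin.peel^[n] A) := by
  induction n with
  | zero => exact hA
  | succ n ih =>
    rw [Function.iterate_succ_apply']
    exact ih.peel hM

theorem peel_iterate_subset {A : M → M → Prop} (n : ℕ) {t y : M} (h : peel^[n] A t y) :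
    A t y := by
  induction n with
  | zero => exact h
  | succ n ih =>
    rw [Function.iterate_succ_apply'] at h
    exact ih h.1

theorem not_peel_iterate_of_le {A : M → M → Prop} {m n : ℕ} (hmn : m ≤ n) {t : M}
    (h : ∀ y, ¬ peel^[m] A t y) (y : M) : ¬ peel^[n] A t y := by
  obtain ⟨k, rfl⟩ := Nat.exists_eq_add_of_le' hmn
  rw [Function.iterate_add_apply]
  exact fun h' => h y (peel_iterate_subset k h')

theorem exists_not_peel_iterate {A : M → M → Prop} {t : M} (hfin : {y | A t y}.Finite) :
    ∃ n, ∀ y, ¬ peel^[n] A t y := by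
  suffices ∀ n (A : M → M → Prop), {y | A t y}.Finite → {y | A t y}.ncard ≤ n →
      ∀ y, ¬ peel^[n] A t y from ⟨_, this _ A hfin le_rfl⟩
  intro n
  induction n with
  | zero =>
    intro A hfin hn y hy
    have := (Set.ncard_eq_zero hfin).1 (Nat.le_zero.1 hn)
    exact (this ▸ hy : y ∈ (∅ : Set M))
  | succ n ih =>
    intro A hfin hn
    rw [Function.iterate_succ_apply]
    have hsub : {y | peel A t y} ⊆ {y | A t y} := fun y hy => hy.1
    refine ih _ (hfin.subset hsub) ?_
    rcases {y | A t y}.eq_empty_or_nonempty with h | hne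
    · have : {y | peel A t y} = ∅ := subset_empty_iff.1 (h ▸ hsub)
      simp [this]
    · obtain ⟨z, hz, hzmin⟩ := Set.exists_min_image _ id hfin hne
      have : {y | peel A t y} ⊂ {y | A t y} := by
        refine ⟨hsub, fun h => ?_⟩
        obtain ⟨_, w, hw, hAw⟩ := h hz
        exact absurd (hzmin w hAw) (not_le.2 hw)
      have := Set.ncard_lt_ncard this hfin
      omega

/-- Near `(a, y)` the set `A` is empty, or it contains `(a, y)` and is the graph of a function that
is continuous at `a`. -/
def IsNormalPt (A : M → M → Prop) (a y : M) : Prop :=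
  (A a y ∧ (∃ v₁ v₂, v₁ < y ∧ y < v₂ ∧ ∀ᶠ t in 𝓝 a, ∀ z z', v₁ < z → z < v₂ → v₁ < z' → z' < v₂ →
      A t z → A t z' → z = z') ∧
    ∀ w₁ w₂, w₁ < y → y < w₂ → ∀ᶠ t in 𝓝 a, ∃ z, w₁ < z ∧ z < w₂ ∧ A t z) ∨
  ∃ v₁ v₂, v₁ < y ∧ y < v₂ ∧ ∀ᶠ t in 𝓝 a, ∀ z, v₁ < z → z < v₂ → ¬ A t z

theorem DefPred₂.isNormalPt (hM : IsOMinimal L M) {A : M → M → Prop} (hA : DefPred₂ L A) :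
    DefPred₂ L (IsNormalPt A) := by
  unfold IsNormalPt
  apply_rules (maxDepth := 200) [DefPred.or, DefPred.and, DefPred.ex, DefPred.all, DefPred.not,
    DefPred.imp,
    DefPred.eventually_nhds, DefPred.lt, DefPred.eq, hA.app, DefFun.var]

/-- A form of compactness of the vertical segment below `c`. -/
theorem eventually_empty_below (hM : IsOMinimal L M) {A : M → M → Prop} (hA : DefPred₂ L A)
    {k : M} (hk : ∀ t y, A t y → k ≤ y) {a : M} (ha : ∀ y, IsNormalPt A a y) {c : M}
    (hc : ∀ y, y ≤ c → ¬ A a y) : ∀ᶠ t in 𝓝 a, ∀ y, y ≤ c → ¬ A t y := by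
  rcases lt_or_ge c k with hck | hck
  · exact .of_forall fun t y hy h => absurd (hk t y h) (not_le.2 (hy.trans_lt hck))
  have hd : DefPred₁ L fun s => s ≤ c ∧ ∀ᶠ t in 𝓝 a, ∀ z, z ≤ s → ¬ A t z := by
    apply_rules [DefPred.and, DefPred.all, DefPred.not, DefPred.imp, DefPred.eventually_nhds,
      DefPred.le, hA.app, DefFun.var, DefFun.const]
  obtain ⟨k', hk'⟩ := exists_lt k
  obtain ⟨p, hp⟩ := hd.exists_isLUB hM ⟨k', hk'.le.trans hck, .of_forall fun t y hy h =>
    absurd (hk t y h) (not_le.2 (hy.trans_lt hk'))⟩ ⟨c, fun s hs => hs.1⟩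
  have hpc : p ≤ c := hp.2 fun s hs => hs.1
  rcases ha p with h | ⟨v₁, v₂, h1, h2, h⟩
  · exact absurd h.1 (hc p hpc)
  obtain ⟨s, hs, hvs⟩ := (lt_isLUB_iff hp).1 h1
  have key : ∀ᶠ t in 𝓝 a, ∀ z, z < v₂ → ¬ A t z := by
    filter_upwards [h, hs.2] with t ht ht' z hz
    rcases le_or_gt z s with hzs | hzs
    · exact ht' z hzs
    · exact ht z (hvs.trans hzs) hz
  rcases eq_or_lt_of_le hpc with rfl | hlt
  · exact key.mono fun t ht y hy => ht y (hy.trans_lt h2)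
  · obtain ⟨q, hq1, hq2⟩ := exists_between (lt_min h2 hlt)
    have hq := lt_min_iff.1 hq2
    exact absurd (hp.1 ⟨hq.2.le, key.mono fun t ht z hz => ht z (hz.trans_lt hq.1)⟩)
      (not_le.2 hq1)

/-- If all points over `a` are normal, removing the lowest points of the fibres keeps them normal:
the lowest points over the parameters near `a` lie near the lowest point over `a`. -/
theorem isNormalPt_peel (hM : IsOMinimal L M) {A : M → M → Prop} (hA : DefPred₂ L A)
    {k : M} (hk : ∀ t y, A t y → k ≤ y) {a : M} (hfin : {y | A a y}.Finite)
    (ha : ∀ y, IsNormalPt A a y) (y : M) : IsNormalPt (peel A) a y := by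
  rcases ha y with ⟨hy, ⟨v₁, v₂, h1, h2, huniq⟩, hex⟩ | ⟨v₁, v₂, h1, h2, h⟩
  swap
  · exact Or.inr ⟨v₁, v₂, h1, h2, h.mono fun t ht z hz1 hz2 hz => ht z hz1 hz2 hz.1⟩
  obtain ⟨y₀, hy₀, hmin⟩ := Set.exists_min_image _ id hfin ⟨y, hy⟩
  rcases eq_or_lt_of_le (hmin y hy) with heq | hlt
  · simp only [id] at heq
    subst heq
    obtain ⟨v, hv1, hv2⟩ := exists_between h1
    have hbelow := eventually_empty_below hM hA hk ha (c := v) fun z hz h =>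
      absurd (hmin z h) (not_le.2 (hz.trans_lt hv2))
    refine Or.inr ⟨v, v₂, hv2, h2, ?_⟩
    filter_upwards [huniq, hbelow] with t h3 h4 z hz1 hz2 ⟨hz, w, hwz, hw⟩
    have hvw : v < w := not_le.1 fun h => h4 w h hw
    exact absurd (h3 z w (hv1.trans hz1) hz2 (hv1.trans hvw) (hwz.trans hz2) hz hw) (ne_of_gt hwz)
  · simp only [id] at hlt
    refine Or.inl ⟨⟨hy, y₀, hlt, hy₀⟩, ⟨v₁, v₂, h1, h2, huniq.mono fun t ht z z' a b c d e f =>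
      ht z z' a b c d e.1 f.1⟩, fun w₁ w₂ hw₁ hw₂ => ?_⟩
    obtain ⟨m, hm1, hm2⟩ := exists_between hlt
    rcases ha y₀ with ⟨_, _, hex₀⟩ | ⟨u₁, u₂, hu1, hu2, h⟩
    · obtain ⟨l, hl⟩ := exists_lt y₀
      filter_upwards [hex (max w₁ m) w₂ (max_lt hw₁ hm2) hw₂, hex₀ l m hl hm1]
        with t ⟨z, hz1, hz2, hz⟩ ⟨z', _, hz', hz''⟩
      have := max_lt_iff.1 hz1
      exact ⟨z, this.1, hz2, hz, z', hz'.trans this.2, hz''⟩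
    · exact absurd hy₀ (h.self_of_nhds y₀ hu1 hu2)

theorem eventually_nonempty_or (hM : IsOMinimal L M) {A : M → M → Prop} (hA : DefPred₂ L A)
    {k k' : M} (hk : ∀ t y, A t y → k ≤ y) (hk' : ∀ t y, A t y → y ≤ k') {a : M}
    (ha : ∀ y, IsNormalPt A a y) :
    (∀ᶠ t in 𝓝 a, ∃ y, A t y) ∨ ∀ᶠ t in 𝓝 a, ¬ ∃ y, A t y := by
  by_cases h : ∃ y, A a y
  · obtain ⟨y, hy⟩ := h
    rcases ha y with ⟨_, _, hex⟩ | ⟨v₁, v₂, h1, h2, h⟩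
    · obtain ⟨w₁, hw₁⟩ := exists_lt y
      obtain ⟨w₂, hw₂⟩ := exists_gt y
      exact Or.inl ((hex w₁ w₂ hw₁ hw₂).mono fun t ⟨z, _, _, hz⟩ => ⟨z, hz⟩)
    · exact absurd hy (h.self_of_nhds y h1 h2)
  · right
    filter_upwards [eventually_empty_below hM hA hk ha (c := k') fun y _ hy => h ⟨y, hy⟩]
      with t ht ⟨y, hy⟩
    exact ht y (hk' t y hy) hy

/-- Over a parameter all of whose points are normal, the statement that the fibre has more than `n`
elements is locally constant. -/
theorem eventually_peel_iterate_or (hM : IsOMinimal L M) {A : M → M → Prop} (hA : DefPred₂ L A)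
    {k k' : M} (hk : ∀ t y, A t y → k ≤ y) (hk' : ∀ t y, A t y → y ≤ k') {a : M}
    (hfin : {y | A a y}.Finite) (ha : ∀ y, IsNormalPt A a y) (n : ℕ) :
    (∀ᶠ t in 𝓝 a, ∃ y, peel^[n] A t y) ∨ ∀ᶠ t in 𝓝 a, ¬ ∃ y, peel^[n] A t y := by
  refine eventually_nonempty_or hM (hA.peel_iterate hM n) (fun t y h =>
    hk t y (peel_iterate_subset n h)) (fun t y h => hk' t y (peel_iterate_subset n h)) ?_
  induction n with
  | zero => exact ha
  | succ n ih =>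
    rw [Function.iterate_succ_apply']
    exact isNormalPt_peel hM (hA.peel_iterate hM n) (fun t y h =>
      hk t y (peel_iterate_subset n h)) (hfin.subset fun y h => peel_iterate_subset n h) ih

/-- A selection of non-normal points over an interval would be continuous, together with the
neighbouring points of `A` below and above it, at some `t₀`; its value at `t₀` is then normal. -/
theorem finite_not_isNormalPt (hM : IsOMinimalExpansion L M) {A : M → M → Prop}
    (hA : DefPred₂ L A) {k : M} (hk : ∀ t y, A t y → k ≤ y)
    (hfin : ∀ t, {y | A t y}.Finite) : {a | ∃ y, ¬ IsNormalPt A a y}.Finite := by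
  have hN := hA.isNormalPt hM.1
  have hNN : DefPred₂ L fun a y => ¬ IsNormalPt A a y := by
    apply_rules [DefPred.not, hN.app, DefFun.var]
  have hd : DefPred₁ L fun a => ∃ y, ¬ IsNormalPt A a y := by
    apply_rules [DefPred.ex, hNN.app, DefFun.var]
  by_contra hinf
  obtain ⟨c, d, hcd, h⟩ := hd.exists_Ioo_of_infinite hM.1 hinf
  have hkN : ∀ a y, ¬ IsNormalPt A a y → k ≤ y := by
    intro a y hy
    by_contra! hlt
    obtain ⟨w, hw⟩ := exists_lt y
    exact hy (Or.inr ⟨w, k, hw, hlt, .of_forall fun t z _ hz hA => absurd (hk t z hA)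
      (not_le.2 hz)⟩)
  obtain ⟨c', d', hcc', hcd', hdd', β, hβ, hβN⟩ := hNN.exists_selection hM hkN hcd
    fun t ht => h t ht.1 ht.2
  obtain ⟨u, hu⟩ := exists_gt (0 : M)
  have hlow : DefPred₂ L fun t z => (A t z ∧ z < β t ∧ ∀ z', A t z' → z' < β t → z' ≤ z) ∨
      ((¬ ∃ z', z' < β t ∧ A t z') ∧ z = β t - u) := by
    apply_rules [DefPred.or, DefPred.and, DefPred.not, DefPred.all, DefPred.ex, DefPred.imp,
      DefPred.lt, DefPred.le, DefPred.eq, DefFun.sub, hA.app, hβ.app, DefFun.var, DefFun.const,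
      hM, hM.1]
  have hupp : DefPred₂ L fun t z => (A t z ∧ β t < z ∧ ∀ z', A t z' → β t < z' → z ≤ z') ∨
      ((¬ ∃ z', β t < z' ∧ A t z') ∧ z = β t + u) := by
    apply_rules [DefPred.or, DefPred.and, DefPred.not, DefPred.all, DefPred.ex, DefPred.imp,
      DefPred.lt, DefPred.le, DefPred.eq, DefFun.add, hA.app, hβ.app, DefFun.var, DefFun.const,
      hM, hM.1]
  obtain ⟨f, hf, hfG⟩ := exists_defFun₁ hlow (by
    rintro t y z (hy | hy) (hz | hz)
    · exact le_antisymm (hz.2.2 _ hy.1 hy.2.1) (hy.2.2 _ hz.1 hz.2.1)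
    · exact absurd ⟨y, hy.2.1, hy.1⟩ hz.1
    · exact absurd ⟨z, hz.2.1, hz.1⟩ hy.1
    · rw [hy.2, hz.2])
  obtain ⟨g, hg, hgG⟩ := exists_defFun₁ hupp (by
    rintro t y z (hy | hy) (hz | hz)
    · exact le_antisymm (hy.2.2 _ hz.1 hz.2.1) (hz.2.2 _ hy.1 hy.2.1)
    · exact absurd ⟨y, hy.2.1, hy.1⟩ hz.1
    · exact absurd ⟨z, hz.2.1, hz.1⟩ hy.1
    · rw [hy.2, hz.2])
  have hfspec : ∀ t, f t < β t ∧ ∀ z, A t z → z < β t → z ≤ f t := by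
    intro t
    by_cases hne : ∃ z', z' < β t ∧ A t z'
    · obtain ⟨z, hz, hmax⟩ := Set.exists_max_image {z | z < β t ∧ A t z} id
        ((hfin t).subset fun z hz => hz.2) hne
      rw [hfG t z (Or.inl ⟨hz.2, hz.1, fun z' h1 h2 => hmax z' ⟨h2, h1⟩⟩)]
      exact ⟨hz.1, fun z' h1 h2 => hmax z' ⟨h2, h1⟩⟩
    · rw [hfG t _ (Or.inr ⟨hne, rfl⟩)]
      exact ⟨sub_lt_self _ hu, fun z h1 h2 => absurd ⟨z, h2, h1⟩ hne⟩
  have hgspec : ∀ t, β t < g t ∧ ∀ z, A t z → β t < z → g t ≤ z := by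
    intro t
    by_cases hne : ∃ z', β t < z' ∧ A t z'
    · obtain ⟨z, hz, hmin⟩ := Set.exists_min_image {z | β t < z ∧ A t z} id
        ((hfin t).subset fun z hz => hz.2) hne
      rw [hgG t z (Or.inl ⟨hz.2, hz.1, fun z' h1 h2 => hmin z' ⟨h2, h1⟩⟩)]
      exact ⟨hz.1, fun z' h1 h2 => hmin z' ⟨h2, h1⟩⟩
    · rw [hgG t _ (Or.inr ⟨hne, rfl⟩)]
      exact ⟨lt_add_of_pos_right _ hu, fun z h1 h2 => absurd ⟨z, h2, h1⟩ hne⟩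
  have hAβ : DefPred₁ L fun t => A t (β t) := by
    apply_rules [hA.app, hβ.app, DefFun.var]
  obtain ⟨t₀, ht₀, hnot⟩ := ((Ioo_infinite hcd').sdiff
    (((hβ.finite_not_continuousAt hM).union (hf.finite_not_continuousAt hM)).union
    ((hg.finite_not_continuousAt hM).union (hAβ.finite_frontier hM.1)))).nonempty
  simp only [mem_union, mem_ofPred_eq, not_or, not_not] at hnot
  obtain ⟨⟨hcβ, hcf⟩, hcg, hfr⟩ := hnot
  obtain ⟨v₁, hv₁, hv₁'⟩ := exists_between (hfspec t₀).1
  obtain ⟨v₂, hv₂, hv₂'⟩ := exists_between (hgspec t₀).1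
  have hloc : ∀ᶠ t in 𝓝 t₀, ∀ z, v₁ < z → z < v₂ → A t z → z = β t := by
    filter_upwards [hcf (gt_mem_nhds hv₁), hcg (lt_mem_nhds hv₂')] with t h1 h2 z hz1 hz2 hz
    rcases lt_trichotomy z (β t) with hlt | heq | hgt
    · exact absurd (((hfspec t).2 z hz hlt).trans_lt h1) (not_lt.2 hz1.le)
    · exact heq
    · exact absurd (h2.trans_le ((hgspec t).2 z hz hgt)) (not_lt.2 hz2.le)
  refine hβN t₀ ht₀ ?_
  rcases eventually_nhds_or_of_notMem_frontier hfr with h | h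
  · refine Or.inl ⟨h.self_of_nhds, ⟨v₁, v₂, hv₁', hv₂, hloc.mono fun t ht z z' h1 h2 h3 h4 h5 h6 =>
      (ht z h1 h2 h5).trans (ht z' h3 h4 h6).symm⟩, fun w₁ w₂ hw₁ hw₂ => ?_⟩
    filter_upwards [h, hcβ (Ioo_mem_nhds hw₁ hw₂)] with t h1 h2
    exact ⟨β t, h2.1, h2.2, h1⟩
  · refine Or.inr ⟨v₁, v₂, hv₁', hv₂, ?_⟩
    filter_upwards [hloc, h] with t h1 h2 z hz1 hz2 hz
    exact h2 (h1 z hz1 hz2 hz ▸ hz)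

/-- A point between two elements of a finite set but not in it lies in a gap of that set. -/
theorem exists_gap {C : Set M} (hC : C.Finite) {t a b : M} (ht : t ∉ C) (ha : a ∈ C) (hb : b ∈ C)
    (hat : a < t) (htb : t < b) :
    ∃ p ∈ C, ∃ q ∈ C, p < t ∧ t < q ∧ ∀ x, p < x → x < q → x ∉ C := by
  obtain ⟨p, hp, hpmax⟩ := Set.exists_max_image {x ∈ C | x < t} id
    (hC.subset (sep_subset _ _)) ⟨a, ha, hat⟩
  obtain ⟨q, hq, hqmin⟩ := Set.exists_min_image {x ∈ C | t < x} id
    (hC.subset (sep_subset _ _)) ⟨b, hb, htb⟩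
  refine ⟨p, hp.1, q, hq.1, hp.2, hq.2, fun x h1 h2 hx => ?_⟩
  rcases lt_trichotomy x t with h | rfl | h
  · exact absurd (hpmax x ⟨hx, h⟩) (not_le.2 h1)
  · exact ht hx
  · exact absurd (hqmin x ⟨hx, h⟩) (not_le.2 h2)

/-- Uniform finiteness: the fibres of a bounded definable planar set with finite fibres have
bounded cardinality. The statement that a fibre has more than `n` elements is constant between two
consecutive parameters with non-normal points, so one sample fibre in each gap suffices. -/
theorem exists_peel_iterate_empty (hM : IsOMinimalExpansion L M) {A : M → M → Prop}
    (hA : DefPred₂ L A) {k k' : M}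
    (hk : ∀ t y, A t y → (k ≤ t ∧ t ≤ k') ∧ k ≤ y ∧ y ≤ k')
    (hfin : ∀ t, {y | A t y}.Finite) : ∃ n, ∀ t y, ¬ peel^[n] A t y := by
  have hB := finite_not_isNormalPt hM hA (fun t y h => (hk t y h).2.1) hfin
  set B := {a | ∃ y, ¬ IsNormalPt A a y} with hBdef
  obtain ⟨l, hl⟩ := exists_lt k
  obtain ⟨l', hl'⟩ := exists_gt k'
  let C : Set M := insert l (insert l' B)
  have hC : C.Finite := (hB.insert l').insert l
  -- One sample point in each gap of `C`.
  have hmid : ∀ p q : M, ∃ r, p < q → p < r ∧ r < q := fun p q => by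
    by_cases h : p < q
    · obtain ⟨r, hr⟩ := exists_between h
      exact ⟨r, fun _ => hr⟩
    · exact ⟨p, fun h' => absurd h' h⟩
  choose mid hmid using hmid
  let R : Set M := C ∪ image2 mid C C
  have hR : R.Finite := hC.union (hC.image2 mid hC)
  choose N hN using fun t => exists_not_peel_iterate (hfin t)
  obtain ⟨n, hn⟩ := (hR.image N).bddAbove
  have hRn : ∀ r ∈ R, ∀ y, ¬ peel^[n] A r y := fun r hr =>
    not_peel_iterate_of_le (hn (mem_image_of_mem N hr)) (hN r)
  refine ⟨n, fun t y hy => ?_⟩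
  by_cases htC : t ∈ C
  · exact hRn t (Or.inl htC) y hy
  have htk := (hk t y (peel_iterate_subset n hy)).1
  obtain ⟨p, hp, q, hq, hpt, htq, hgap⟩ := exists_gap hC htC (mem_insert l _)
    (mem_insert_of_mem _ (mem_insert l' _)) (hl.trans_le htk.1) (htk.2.trans_lt hl')
  have hd : DefPred₁ L fun t => ∃ y, peel^[n] A t y := by
    have := hA.peel_iterate hM.1 n
    apply_rules [DefPred.ex, this.app, DefFun.var]
  have hr := hmid p q (hpt.trans htq)
  obtain ⟨z, hz⟩ := hd.of_ordConnected hM.1 (I := Ioo p q) ordConnected_Ioo (fun s hs => by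
    have : ∀ y, IsNormalPt A s y := by
      by_contra h
      push Not at h
      exact hgap s hs.1 hs.2 (Or.inr (Or.inr h))
    exact (eventually_peel_iterate_or hM.1 hA (fun t y h => (hk t y h).2.1)
      (fun t y h => (hk t y h).2.2) (hfin s) this n).imp (fun h => nhdsWithin_le_nhds h)
      (fun h => nhdsWithin_le_nhds h)) ⟨hpt, htq⟩ hr ⟨y, hy⟩
  exact hRn _ (Or.inr (mem_image2_of_mem hp hq)) z hz

end Planar

/-! ### One-dimensional bounded sets inject definably into the line -/

section Embedding

variable {L : Language} {M : Type*} [L.Structure M] [AddCommGroup M] [LinearOrder M]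
  [IsOrderedAddMonoid M] [Nontrivial M] [TopologicalSpace M] [OrderTopology M] [DenselyOrdered M]

/-- The planar set `A` has a definable injection to a bounded subset of the line. -/
def PlaneEmbeds (L : Language) {M : Type*} [L.Structure M] [LinearOrder M] (A : M → M → Prop) :
    Prop :=
  ∃ e : M → M → M, DefFun L (fun v : Fin 2 → M => e (v 0) (v 1)) ∧
    (∀ t y t' y', A t y → A t' y' → e t y = e t' y' → t = t' ∧ y = y') ∧
    ∃ k k', ∀ t y, A t y → k ≤ e t y ∧ e t y ≤ k'

theorem PlaneEmbeds.of_subset {A B : M → M → Prop} (hB : PlaneEmbeds L B)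
    (h : ∀ t y, A t y → B t y) : PlaneEmbeds L A := by
  obtain ⟨e, he, hinj, k, k', hk⟩ := hB
  exact ⟨e, he, fun t y t' y' h1 h2 => hinj t y t' y' (h _ _ h1) (h _ _ h2), k, k',
    fun t y h1 => hk t y (h _ _ h1)⟩

/-- Two bounded images on the line are made disjoint by a translation. -/
theorem PlaneEmbeds.union (hM : IsOMinimalExpansion L M) {A B : M → M → Prop}
    (hA : DefPred₂ L A) (hAe : PlaneEmbeds L A) (hBe : PlaneEmbeds L B) :
    PlaneEmbeds L fun t y => A t y ∨ B t y := by
  classical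
  obtain ⟨e, he, hinj, k, k', hk⟩ := hAe
  obtain ⟨f, hf, finj, l, l', hl⟩ := hBe
  obtain ⟨u, hu⟩ := exists_gt (0 : M)
  -- The image of `B` is translated beyond that of `A`.
  have hsep : ∀ t y t' y', A t y → B t' y' → e t y < f t' y' + (k' - l + u) := by
    intro t y t' y' h1 h2
    have := (hk t y h1).2
    have := (hl t' y' h2).1
    grind
  refine ⟨fun t y => if A t y then e t y else f t y + (k' - l + u), ?_, ?_,
    min k (l + (k' - l + u)), max k' (l' + (k' - l + u)), ?_⟩
  · refine DefFun.ite (hA.app (DefFun.var _) (DefFun.var _)) he ?_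
    exact DefFun.add hM hf (DefFun.const _)
  · intro t y t' y' h1 h2 heq
    by_cases hA1 : A t y <;> by_cases hA2 : A t' y' <;> simp only [hA1, hA2, if_true, if_false,
      false_or] at heq h1 h2
    · exact hinj t y t' y' hA1 hA2 heq
    · exact absurd heq (hsep _ _ _ _ hA1 h2).ne
    · exact absurd heq (hsep _ _ _ _ hA2 h1).ne'
    · exact finj t y t' y' h1 h2 (add_right_cancel heq)
  · intro t y h
    by_cases hA1 : A t y
    · simp only [hA1, if_true]
      exact ⟨(min_le_left _ _).trans (hk t y hA1).1, (hk t y hA1).2.trans (le_max_left _ _)⟩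
    · simp only [hA1, if_false]
      have := hl t y (h.resolve_left hA1)
      exact ⟨(min_le_right _ _).trans (by gcongr; exact this.1),
        le_trans (by gcongr; exact this.2) (le_max_right _ _)⟩

/-- The lowest points of the fibres form a graph over the first coordinate, so a set with uniformly
finite fibres is a finite union of graphs. -/
theorem PlaneEmbeds.of_peel_iterate (hM : IsOMinimalExpansion L M) {k k' : M} (n : ℕ)
    {A : M → M → Prop} (hA : DefPred₂ L A) (hk : ∀ t y, A t y → k ≤ t ∧ t ≤ k')
    (h : ∀ t y, ¬ peel^[n] A t y) : PlaneEmbeds L A := by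
  induction n generalizing A with
  | zero =>
    refine ⟨fun _ _ => k, DefFun.const _, fun t y _ _ h1 => absurd h1 (h t y), k, k',
      fun t y h1 => absurd h1 (h t y)⟩
  | succ n ih =>
    have h1 : PlaneEmbeds L (peel A) := ih (hA.peel hM.1) (fun t y h => hk t y h.1)
      (by simpa only [Function.iterate_succ_apply] using h)
    have h2 : PlaneEmbeds L fun t y => A t y ∧ ¬ peel A t y := by
      refine ⟨fun t _ => t, DefFun.var _, ?_, k, k', fun t y h => hk t y h.1⟩
      rintro t y _ y' ⟨hy, hp⟩ ⟨hy', hp'⟩ rfl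
      refine ⟨rfl, ?_⟩
      by_contra hne
      rcases lt_or_gt_of_ne hne with hlt | hlt
      · exact hp' ⟨hy', y, hlt, hy⟩
      · exact hp ⟨hy, y', hlt, hy'⟩
    exact (PlaneEmbeds.union hM (hA.peel hM.1) h1 h2).of_subset fun t y h => by
      by_cases hp : peel A t y
      · exact Or.inl hp
      · exact Or.inr ⟨h, hp⟩

theorem PlaneEmbeds.of_finite (hM : IsOMinimalExpansion L M) {A : M → M → Prop}
    (hA : DefPred₂ L A) {k k' : M} (hk : ∀ t y, A t y → k ≤ y ∧ y ≤ k') {T : Set M}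
    (hT : T.Finite) : PlaneEmbeds L fun t y => t ∈ T ∧ A t y := by
  induction T, hT using Set.Finite.induction_on with
  | empty => exact ⟨fun _ _ => k, DefFun.const _, by simp, k, k', by simp⟩
  | @insert a T _ _ ih =>
    have hd : DefPred₂ L fun t y => t = a ∧ A t y := by
      apply_rules [DefPred.and, DefPred.eq, hA.app, DefFun.var, DefFun.const]
    refine (PlaneEmbeds.union hM hd ⟨fun _ y => y, DefFun.var _, ?_, k, k',
      fun t y h => hk t y h.2⟩ ih).of_subset ?_
    · rintro t y t' y' ⟨rfl, _⟩ ⟨rfl, _⟩ h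
      exact ⟨rfl, h⟩
    · rintro t y ⟨rfl | ht, h⟩
      · exact Or.inl ⟨rfl, h⟩
      · exact Or.inr ⟨ht, h⟩

/-- If infinitely many fibres contain an interval, then endpoints of such intervals can be chosen
definably, and continuity of the choice at a point produces a box. -/
theorem exists_box_of_infinite (hM : IsOMinimalExpansion L M) {A : M → M → Prop}
    (hA : DefPred₂ L A) {k : M} (hk : ∀ t y, A t y → k ≤ y)
    (hinf : {t | {y | A t y}.Infinite}.Infinite) :
    ∃ a b c d, a < b ∧ c < d ∧ ∀ t y, a < t → t < b → c < y → y < d → A t y := by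
  have hS : DefPred₂ L fun t c => k ≤ c ∧ ∃ d, c < d ∧ ∀ y, c < y → y < d → A t y := by
    apply_rules [DefPred.and, DefPred.ex, DefPred.all, DefPred.imp, DefPred.le, DefPred.lt,
      hA.app, DefFun.var, DefFun.const, hM.1]
  have hd : DefPred₁ L fun t => ∃ c, k ≤ c ∧ ∃ d, c < d ∧ ∀ y, c < y → y < d → A t y := by
    apply_rules [DefPred.ex, hS.app, DefFun.var]
  have hsub : {t | {y | A t y}.Infinite} ⊆
      {t | ∃ c, k ≤ c ∧ ∃ d, c < d ∧ ∀ y, c < y → y < d → A t y} := by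
    intro t ht
    have hAt : DefPred₁ L fun y => A t y := by
      apply_rules [hA.app, DefFun.var, DefFun.const]
    obtain ⟨c, d, hcd, h⟩ := hAt.exists_Ioo_of_infinite hM.1 ht
    refine ⟨c, not_lt.1 fun hlt => ?_, d, hcd, h⟩
    obtain ⟨y, hy, hy'⟩ := exists_between (lt_min hcd hlt)
    have := lt_min_iff.1 hy'
    exact absurd (hk t y (h y hy this.1)) (not_le.2 this.2)
  obtain ⟨a, b, hab, h⟩ := hd.exists_Ioo_of_infinite hM.1 (hinf.mono hsub)
  obtain ⟨a', b', -, hab', -, f, hf, hfS⟩ := hS.exists_selection hM (fun t y h => h.1) hab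
    fun t ht => h t ht.1 ht.2
  have hS' : DefPred₂ L fun t d => k ≤ d ∧ f t < d ∧ ∀ y, f t < y → y < d → A t y := by
    apply_rules [DefPred.and, DefPred.ex, DefPred.all, DefPred.imp, DefPred.le, DefPred.lt,
      hA.app, hf.app, DefFun.var, DefFun.const, hM.1]
  obtain ⟨a₂, b₂, -, hab₂, -, g, hg, hgS⟩ := hS'.exists_selection hM (fun t y h => h.1) hab'
    fun t ht => by
      obtain ⟨h1, d, h2, h3⟩ := hfS t ht
      exact ⟨d, h1.trans h2.le, h2, h3⟩
  obtain ⟨t, ht, hnot⟩ := ((Ioo_infinite hab₂).sdiff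
    ((hf.finite_not_continuousAt hM).union (hg.finite_not_continuousAt hM))).nonempty
  simp only [mem_union, mem_ofPred_eq, not_or, not_not] at hnot
  obtain ⟨c, hc1, hc2⟩ := exists_between (hgS t ht).2.1
  obtain ⟨d, hd1, hd2⟩ := exists_between hc2
  have : ∀ᶠ s in 𝓝 t, ∀ y, c < y → y < d → A s y := by
    filter_upwards [hnot.1 (gt_mem_nhds hc1), hnot.2 (lt_mem_nhds hd2), Ioo_mem_nhds ht.1 ht.2]
      with s h1 h2 h3 y hy1 hy2
    exact (hgS s h3).2.2 y (h1.trans hy1) (hy2.trans h2)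
  obtain ⟨u, v, hu, hv, h⟩ := eventually_nhds_iff_Ioo.1 this
  exact ⟨u, v, c, d, hu.trans hv, hd1, fun s y h1 h2 h3 h4 => h s h1 h2 y h3 h4⟩

/-- A bounded planar set without a box has finitely many infinite fibres, and the others are
uniformly finite. -/
theorem PlaneEmbeds.of_no_box (hM : IsOMinimalExpansion L M) {A : M → M → Prop}
    (hA : DefPred₂ L A) {k k' : M} (hk : ∀ t y, A t y → (k ≤ t ∧ t ≤ k') ∧ k ≤ y ∧ y ≤ k')
    (hbox : ¬ ∃ a b c d, a < b ∧ c < d ∧ ∀ t y, a < t → t < b → c < y → y < d → A t y) :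
    PlaneEmbeds L A := by
  have hT : {t | {y | A t y}.Infinite}.Finite := by
    by_contra hinf
    exact hbox (exists_box_of_infinite hM hA (fun t y h => (hk t y h).2.1) hinf)
  set T := {t | {y | A t y}.Infinite}
  have hTn : ∀ t, t ∉ T → {y | A t y}.Finite := fun t ht => not_infinite.1 ht
  clear_value T
  have hTd : DefPred₁ L fun t => t ∈ T := by
    have : DefPred₁ L fun t : M => ∃ a : T, t = a := by
      have := hT.to_subtype
      refine DefPred.exists_finite fun a => ?_
      exact DefPred.eq (DefFun.var _) (DefFun.const _)
    exact this.of_iff fun v => by simp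
  have hA' : DefPred₂ L fun t y => t ∉ T ∧ A t y := by
    apply_rules [DefPred.and, DefPred.not, hTd.app, hA.app, DefFun.var]
  have hA'' : DefPred₂ L fun t y => t ∈ T ∧ A t y := by
    apply_rules [DefPred.and, hTd.app, hA.app, DefFun.var]
  obtain ⟨n, hn⟩ := exists_peel_iterate_empty hM hA' (fun t y h => hk t y h.2) fun t => by
    by_cases ht : t ∈ T
    · simp [ht]
    · exact (hTn t ht).subset fun y hy => hy.2
  have h1 := PlaneEmbeds.of_peel_iterate hM n hA' (fun t y h => (hk t y h.2).1) hn
  have h2 := PlaneEmbeds.of_finite hM hA (fun t y h => (hk t y h).2) hT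
  exact (PlaneEmbeds.union hM hA'' h2 h1).of_subset fun t y h => by
    by_cases ht : t ∈ T
    · exact Or.inl ⟨ht, h⟩
    · exact Or.inr ⟨ht, h⟩

/-- Some member of a finite family of definable functions is injective on a subinterval, or all are
constant on a subinterval. -/
theorem exists_injOn_or_forall_const (hM : IsOMinimal L M) {ι : Type*} {g : ι → M → M}
    (hg : ∀ i, DefFun₁ L (g i)) (s : Finset ι) {a b : M} (hab : a < b) :
    ∃ c d, a ≤ c ∧ c < d ∧ d ≤ b ∧
      ((∃ i, InjOn (g i) (Ioo c d)) ∨ ∀ i ∈ s, ∃ k, ∀ x ∈ Ioo c d, g i x = k) := by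
  classical
  induction s using Finset.induction_on with
  | empty => exact ⟨a, b, le_rfl, hab, le_rfl, by simp⟩
  | insert i s _ ih =>
    obtain ⟨c, d, hac, hcd, hdb, h⟩ := ih
    rcases h with h | h
    · exact ⟨c, d, hac, hcd, hdb, Or.inl h⟩
    obtain ⟨c', d', hac', hcd', hdb', h'⟩ := (hg i).exists_const_or_injOn hM hcd
    refine ⟨c', d', hac.trans hac', hcd', hdb'.trans hdb, ?_⟩
    rcases h' with h' | h'
    · right
      intro j hj
      rcases Finset.mem_insert.1 hj with rfl | hj
      · exact h'
      · obtain ⟨k, hk⟩ := h j hj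
        exact ⟨k, fun x hx => hk x (Ioo_subset_Ioo hac' hdb' hx)⟩
    · exact Or.inl ⟨i, h'⟩

/-- No projection of `X` to two coordinates contains a box. -/
def IsThin {M : Type*} [LT M] {n : ℕ} (X : (Fin n → M) → Prop) : Prop :=
  ∀ i j : Fin n, i < j → ¬ ∃ a b c d, a < b ∧ c < d ∧
    ∀ u v, a < u → u < b → c < v → v < d → ∃ x, X x ∧ x i = u ∧ x j = v

/-- Induction on the number of coordinates: the projection forgetting the last coordinate injects
into the line, so the set becomes planar, and the resulting planar set contains no box. -/
theorem IsThin.exists_injOn (hM : IsOMinimalExpansion L M) {n : ℕ} {X : (Fin n → M) → Prop}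
    (hX : DefPred L X) {k k' : M} (hk : ∀ x, X x → ∀ i, k ≤ x i ∧ x i ≤ k') (hthin : IsThin X) :
    ∃ e : (Fin n → M) → M, DefFun L e ∧ InjOn e {x | X x} ∧
      ∃ l l', ∀ x, X x → l ≤ e x ∧ e x ≤ l' := by
  induction n with
  | zero =>
    exact ⟨fun _ => 0, DefFun.const _, fun x _ y _ _ => Subsingleton.elim x y, 0, 0, by simp⟩
  | succ n ih =>
    have hsnoc : ∀ {α : Type} (t : Fin n → (α → M) → M) (s : (α → M) → M),
        (∀ i, DefFun L (t i)) → DefFun L s →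
        DefPred L fun v : α → M => X (Fin.snoc (α := fun _ => M) (fun i => t i v) (s v)) := by
      intro α t s ht hs
      refine hX.subst (t := fun i v => Fin.snoc (α := fun _ => M) (fun i => t i v) (s v) i) ?_
      intro i
      refine Fin.lastCases ?_ (fun i => ?_) i
      · simpa using hs
      · simpa using ht i
    have hπ : DefPred L fun w : Fin n → M => ∃ y, X (Fin.snoc (α := fun _ => M) w y) := by
      refine DefPred.ex ?_
      exact hsnoc _ _ (fun i => DefFun.var _) (DefFun.var _)
    obtain ⟨e, he, hinj, l, l', hl⟩ := ih hπ
      (by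
        rintro w ⟨y, hy⟩ i
        simpa using hk _ hy i.castSucc)
      (by
        rintro i j hij ⟨a, b, c, d, hab, hcd, h⟩
        refine hthin i.castSucc j.castSucc (by simpa using hij) ⟨a, b, c, d, hab, hcd, ?_⟩
        intro u v h1 h2 h3 h4
        obtain ⟨w, ⟨y, hy⟩, hw1, hw2⟩ := h u v h1 h2 h3 h4
        exact ⟨_, hy, by simpa using hw1, by simpa using hw2⟩)
    let A : M → M → Prop := fun t y => ∃ w : Fin n → M, X (Fin.snoc (α := fun _ => M) w y) ∧ e w = t
    have hA : DefPred₂ L A := by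
      refine DefPred.exT (DefPred.and (hsnoc _ _ (fun i => DefFun.var _) (DefFun.var _)) ?_)
      exact DefPred.eq (he.reindex _) (DefFun.var _)
    have hAe : PlaneEmbeds L A := by
      refine PlaneEmbeds.of_no_box hM hA (k := min k l) (k' := max k' l') ?_ ?_
      · rintro t y ⟨w, hw, rfl⟩
        have h1 := hl w ⟨y, hw⟩
        have h2 : k ≤ y ∧ y ≤ k' := by simpa using hk _ hw (Fin.last n)
        exact ⟨⟨(min_le_right _ _).trans h1.1, h1.2.trans (le_max_right _ _)⟩,
          (min_le_left _ _).trans h2.1, h2.2.trans (le_max_left _ _)⟩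
      rintro ⟨a, b, c, d, hab, hcd, hbox⟩
      -- The coordinates of the inverse of `e`, as definable functions of one variable.
      have hG : ∀ i, DefPred₂ L fun s t => ∃ w : Fin n → M,
          (∃ y, X (Fin.snoc (α := fun _ => M) w y)) ∧ e w = s ∧ w i = t := by
        intro i
        refine DefPred.exT (DefPred.and (hπ.reindex _) (DefPred.and
          (DefPred.eq (he.reindex _) (DefFun.var _)) (DefPred.eq (DefFun.var _) (DefFun.var _))))
      choose g hg hgG using fun i => exists_defFun₁ (hG i) (by
        rintro t y z ⟨w, hw, hwt, rfl⟩ ⟨w', hw', hwt', rfl⟩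
        rw [hinj hw hw' (hwt.trans hwt'.symm)])
      have hgw : ∀ w : Fin n → M, (∃ y, X (Fin.snoc (α := fun _ => M) w y)) → ∀ i,
          g i (e w) = w i := fun w hw i => hgG i _ _ ⟨w, hw, rfl, rfl⟩
      have hlift : ∀ s ∈ Ioo a b, ∀ y ∈ Ioo c d, ∃ w : Fin n → M,
          X (Fin.snoc (α := fun _ => M) w y) ∧ e w = s ∧ ∀ i, g i s = w i := by
        intro s hs y hy
        obtain ⟨w, hw, rfl⟩ := hbox s y hs.1 hs.2 hy.1 hy.2
        exact ⟨w, hw, rfl, hgw w ⟨y, hw⟩⟩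
      obtain ⟨y₀, hy₀⟩ := exists_between hcd
      obtain ⟨a', b', haa, hab', hbb, h⟩ := exists_injOn_or_forall_const hM.1 hg Finset.univ hab
      rcases h with ⟨i, hi⟩ | hconst
      · have himg : DefPred₁ L fun u => ∃ s, a' < s ∧ s < b' ∧ g i s = u := by
          have := hg i
          apply_rules [DefPred.ex, DefPred.and, DefPred.eq, DefPred.lt, this.app, DefFun.var,
            DefFun.const, hM.1]
        have hinf : {u | ∃ s, a' < s ∧ s < b' ∧ g i s = u}.Infinite := by
          refine ((Ioo_infinite hab').image hi).mono ?_
          rintro _ ⟨x, hx, rfl⟩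
          exact ⟨x, hx.1, hx.2, rfl⟩
        obtain ⟨p, q, hpq, h⟩ := himg.exists_Ioo_of_infinite hM.1 hinf
        refine hthin i.castSucc (Fin.last n) (Fin.castSucc_lt_last i) ⟨p, q, c, d, hpq, hcd, ?_⟩
        intro u v h1 h2 h3 h4
        obtain ⟨s, hs1, hs2, rfl⟩ := h u h1 h2
        obtain ⟨w, hw, -, hgw'⟩ := hlift s ⟨haa.trans_lt hs1, hs2.trans_le hbb⟩ v ⟨h3, h4⟩
        exact ⟨_, hw, by simpa using (hgw' i).symm, by simp⟩
      · obtain ⟨s, hs⟩ := exists_between hab'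
        obtain ⟨s', hs'⟩ := exists_between hs.2
        have hs'' : s' ∈ Ioo a' b' := ⟨hs.1.trans hs'.1, hs'.2⟩
        obtain ⟨w, -, hw, hgw1⟩ := hlift s (Ioo_subset_Ioo haa hbb hs) y₀ hy₀
        obtain ⟨w', -, hw', hgw2⟩ := hlift s' (Ioo_subset_Ioo haa hbb hs'') y₀ hy₀
        have : w = w' := funext fun i => by
          obtain ⟨k, hk⟩ := hconst i (Finset.mem_univ i)
          rw [← hgw1, ← hgw2, hk s hs, hk s' hs'']
        exact absurd (hw.symm.trans ((congrArg e this).trans hw')) hs'.1.ne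
    obtain ⟨f, hf, hfinj, m, m', hm⟩ := hAe
    have hAx : ∀ x, X x → A (e (Fin.init x)) (x (Fin.last n)) := fun x hx =>
      ⟨Fin.init x, by rwa [Fin.snoc_init_self], rfl⟩
    refine ⟨fun x => f (e (Fin.init x)) (x (Fin.last n)), ?_, ?_, m, m', fun x hx =>
      hm _ _ (hAx x hx)⟩
    · refine DefFun.comp (t := ![fun x => e (Fin.init x), fun x => x (Fin.last n)]) hf ?_
      simp only [Fin.forall_fin_two]
      exact ⟨he.reindex _, DefFun.var _⟩
    · intro x hx y hy hxy
      obtain ⟨h1, h2⟩ := hfinj _ _ _ _ (hAx x hx) (hAx y hy) hxy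
      have h3 : Fin.init x = Fin.init y := hinj
        ⟨x (Fin.last n), by rwa [Fin.snoc_init_self]⟩
        ⟨y (Fin.last n), by rwa [Fin.snoc_init_self]⟩ h1
      rw [← Fin.snoc_init_self x, ← Fin.snoc_init_self y, h3, h2]

end Embedding

/-! ### Definable topologies on a subset of the line -/

section LineTopology

variable {L : Language} {M : Type*} [L.Structure M] [AddCommGroup M] [LinearOrder M]
  [IsOrderedAddMonoid M] [Nontrivial M] [TopologicalSpace M] [OrderTopology M] [DenselyOrdered M]
  {T : Type*} {ε : T → M} {β : Type*} [Finite β]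

/-- A subset of a type `T` with a coordinate `ε : T → M` is definable if its image in the line
is. -/
def DefSet (L : Language) {M : Type*} [L.Structure M] {T : Type*} (ε : T → M) (A : Set T) : Prop :=
  DefPred₁ L fun z => ∃ x, ε x = z ∧ x ∈ A

/-- The sets `U b` form a basis of the topology of `T` that is definable in the coordinate `ε`. -/
structure IsDefBasis (L : Language) {M : Type*} [L.Structure M] {T : Type*} [TopologicalSpace T]
    (ε : T → M) {β : Type*} (U : (β → M) → Set T) : Prop where
  isBasis : TopologicalSpace.IsTopologicalBasis (range U)
  definable : DefRel L fun z b => ∃ x, ε x = z ∧ x ∈ U b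

/-- The filter of one-sided punctured neighbourhoods of `p ∈ M`, pulled back along the coordinate.
The point `p` itself need not be the coordinate of a point of `T`. -/
def germ (ε : T → M) (s : Bool) (p : M) : Filter T := Filter.comap ε (side s p)

theorem mem_germ {s : Bool} {p : M} {A : Set T} :
    A ∈ germ ε s p ↔ ∀ᶠ z in side s p, ∀ x, ε x = z → x ∈ A :=
  Filter.eventually_comap

theorem germ_le_comap_nhds (s : Bool) (p : M) : germ ε s p ≤ Filter.comap ε (𝓝 p) :=
  Filter.comap_mono (side_le_nhds s p)

theorem DefSet.image_iff (hε : ε.Injective) {A : Set T} {x : T} :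
    (∃ y, ε y = ε x ∧ y ∈ A) ↔ x ∈ A :=
  ⟨fun ⟨_, h, h'⟩ => hε h ▸ h', fun h => ⟨x, rfl, h⟩⟩

theorem DefSet.inter (hε : ε.Injective) {A B : Set T} (hA : DefSet L ε A) (hB : DefSet L ε B) :
    DefSet L ε (A ∩ B) :=
  (DefPred.and hA hB).of_iff fun v => by
    constructor
    · rintro ⟨x, h, h1, h2⟩
      exact ⟨⟨x, h, h1⟩, ⟨x, h, h2⟩⟩
    · rintro ⟨⟨x, h, h1⟩, ⟨y, h', h2⟩⟩
      obtain rfl := hε (h.trans h'.symm)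
      exact ⟨x, h, h1, h2⟩

theorem IsDefBasis.defSet [TopologicalSpace T] {U : (β → M) → Set T} (hU : IsDefBasis L ε U)
    (b : β → M) : DefSet L ε (U b) :=
  hU.definable.app (DefFun.var _) fun _ => DefFun.const _

theorem DefSet.preimage (hR : DefSet L ε univ) {P : M → Prop} (hP : DefPred₁ L P) :
    DefSet L ε {x | P (ε x)} :=
  (DefPred.and hR hP).of_iff fun v => by
    constructor
    · rintro ⟨x, h, h'⟩
      exact ⟨⟨x, h, trivial⟩, h ▸ h'⟩
    · rintro ⟨⟨x, h, -⟩, h'⟩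
      exact ⟨x, h, by simpa [h] using h'⟩

/-- A definable set belongs to a one-sided germ, or its complement does. -/
theorem DefSet.mem_germ_or (hM : IsOMinimal L M) (hε : ε.Injective) {A : Set T}
    (hA : DefSet L ε A) (s : Bool) (p : M) :
    (A ∈ germ ε s p ∧ (germ ε s p).NeBot) ∨ Aᶜ ∈ germ ε s p := by
  rcases DefPred₁.eventually_side_or hM hA s p with h | h
  · refine Or.inl ⟨mem_germ.2 (h.mono ?_),
      Filter.comap_neBot_iff_frequently.2 (h.frequently.mono ?_)⟩
    · rintro _ hz x rfl
      exact (DefSet.image_iff hε).1 hz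
    · rintro z ⟨x, h, _⟩
      exact ⟨x, h⟩
  · exact Or.inr (mem_germ.2 (h.mono fun z hz x hx hxA => hz ⟨x, hx, hxA⟩))

variable [TopologicalSpace T]

theorem IsDefBasis.mem_nhds_iff {U : (β → M) → Set T} (hU : IsDefBasis L ε U) {x : T} {A : Set T} :
    A ∈ 𝓝 x ↔ ∃ b, x ∈ U b ∧ U b ⊆ A := by
  rw [hU.isBasis.mem_nhds_iff]
  exact ⟨fun ⟨_, ⟨b, rfl⟩, h⟩ => ⟨b, h⟩, fun ⟨b, h⟩ => ⟨_, ⟨b, rfl⟩, h⟩⟩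

theorem IsDefBasis.mem_nhds {U : (β → M) → Set T} (hU : IsDefBasis L ε U) {x : T} {b : β → M}
    (h : x ∈ U b) : U b ∈ 𝓝 x :=
  hU.mem_nhds_iff.2 ⟨b, h, Subset.rfl⟩

/-- Definable compactness of bounded sets: a point in the closure of a bounded definable set `A`
but not in `A` is the limit of a one-sided germ along which `A` holds. The germ sits at the supremum
`p` of the lower bounds of the traces on `A` of basic neighbourhoods of the point. -/
theorem IsDefBasis.exists_germ_of_mem_closure (hM : IsOMinimal L M) [T2Space T] (hε : ε.Injective)
    {U : (β → M) → Set T} (hU : IsDefBasis L ε U) {A : Set T} (hA : DefSet L ε A) {l l' : M}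
    (hl : ∀ x ∈ A, l ≤ ε x ∧ ε x ≤ l') {x : T} (hx : x ∈ closure A) (hxA : x ∉ A) :
    ∃ s p, l ≤ p ∧ p ≤ l' ∧ A ∈ germ ε s p ∧ (germ ε s p).NeBot ∧ germ ε s p ≤ 𝓝 x := by
  have hd : DefPred₁ L fun r => ∃ b : β → M, (∃ y, ε y = ε x ∧ y ∈ U b) ∧
      ∀ z, (∃ y, ε y = z ∧ y ∈ A) → (∃ y, ε y = z ∧ y ∈ U b) → r ≤ z := by
    refine DefPred.exT (DefPred.and (hU.definable.app (DefFun.const _) fun _ => DefFun.var _)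
      (DefPred.all (DefPred.imp (DefPred₁.app hA (DefFun.var _)) (DefPred.imp
      (hU.definable.app (DefFun.var _) fun _ => DefFun.var _)
      (DefPred.le hM (DefFun.var _) (DefFun.var _))))))
  have hmeet : ∀ b, x ∈ U b → (U b ∩ A).Nonempty := fun b hb =>
    mem_closure_iff_nhds.1 hx _ (hU.mem_nhds hb)
  obtain ⟨b₁, hb₁, -⟩ := hU.mem_nhds_iff.1 (Filter.univ_mem : univ ∈ 𝓝 x)
  have hlD : ∃ b : β → M, (∃ y, ε y = ε x ∧ y ∈ U b) ∧
      ∀ z, (∃ y, ε y = z ∧ y ∈ A) → (∃ y, ε y = z ∧ y ∈ U b) → l ≤ z := by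
    refine ⟨b₁, ⟨x, rfl, hb₁⟩, ?_⟩
    rintro _ ⟨y, rfl, hy⟩ -
    exact (hl y hy).1
  have hub : ∀ r, (∃ b : β → M, (∃ y, ε y = ε x ∧ y ∈ U b) ∧
      ∀ z, (∃ y, ε y = z ∧ y ∈ A) → (∃ y, ε y = z ∧ y ∈ U b) → r ≤ z) → r ≤ l' := by
    rintro r ⟨b, hb, h⟩
    obtain ⟨y, hyU, hyA⟩ := hmeet b ((DefSet.image_iff hε).1 hb)
    exact (h _ ⟨y, rfl, hyA⟩ ⟨y, rfl, hyU⟩).trans (hl y hyA).2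
  obtain ⟨p, hp⟩ := hd.exists_isLUB hM ⟨l, hlD⟩ ⟨l', hub⟩
  have hsmall : ∀ V ∈ 𝓝 x, ∀ W ∈ 𝓝 x, ∃ b, x ∈ U b ∧ U b ⊆ V ∧ U b ⊆ W := fun V hV W hW => by
    obtain ⟨b, hb, h⟩ := hU.mem_nhds_iff.1 (Filter.inter_mem hV hW)
    exact ⟨b, hb, h.trans inter_subset_left, h.trans inter_subset_right⟩
  have hacc : ∀ b, x ∈ U b → ∀ q r, q < p → p < r → ∃ y ∈ U b ∩ A, q < ε y ∧ ε y < r := by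
    intro b hb q r hq hr
    obtain ⟨q', ⟨b', hb', hq'⟩, hqq'⟩ := (lt_isLUB_iff hp).1 hq
    obtain ⟨b₂, hb₂, h1, h2⟩ := hsmall _ (hU.mem_nhds hb) _
      (hU.mem_nhds ((DefSet.image_iff hε).1 hb'))
    by_contra! hcon
    refine absurd (hp.1 ⟨b₂, ⟨x, rfl, hb₂⟩, ?_⟩) (not_le.2 hr)
    rintro _ ⟨y, rfl, hyA⟩ hy
    have hyU := (DefSet.image_iff hε).1 hy
    exact hcon y ⟨h1 hyU, hyA⟩ (hqq'.trans_le (hq' _ ⟨y, rfl, hyA⟩ ⟨y, rfl, h2 hyU⟩))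
  -- Some basic neighbourhood has no point of `A` with coordinate `p`.
  obtain ⟨b₀, hb₀, hne⟩ : ∃ b, x ∈ U b ∧ ∀ y ∈ U b ∩ A, ε y ≠ p := by
    by_cases h : ∃ y ∈ A, ε y = p
    · obtain ⟨y, hyA, rfl⟩ := h
      have hxy : x ≠ y := fun h => hxA (h ▸ hyA)
      obtain ⟨b, hb, h⟩ := hU.mem_nhds_iff.1 (isOpen_ne.mem_nhds hxy)
      exact ⟨b, hb, fun z hz hzy => h hz.1 (hε hzy)⟩
    · exact ⟨b₁, hb₁, fun y hy hyp => h ⟨y, hy.2, hyp⟩⟩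
  have hside : ∀ b, x ∈ U b → U b ⊆ U b₀ → ∃ s, U b ∩ A ∈ germ ε s p ∧ (germ ε s p).NeBot := by
    intro b hb hsub
    by_contra! hcon
    have hd := (hU.defSet b).inter hε hA
    have h1 : ∀ s, ∀ᶠ z in side s p, ∀ y, ε y = z → y ∉ U b ∩ A := fun s =>
      mem_germ.1 ((hd.mem_germ_or hM hε s p).resolve_left fun h => by
        have := hcon s h.1
        exact h.2.ne (by simpa using this))
    have h2 : ∀ᶠ z in 𝓝[≠] p, ∀ y, ε y = z → y ∉ U b ∩ A := by
      rw [nhdsNE_eq_sup_side]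
      exact Filter.eventually_sup.2 ⟨h1 _, h1 _⟩
    obtain ⟨q, r, hq, hr, h⟩ := eventually_nhds_iff_Ioo.1 (eventually_nhdsWithin_iff.1 h2)
    obtain ⟨y, hy, hqy, hyr⟩ := hacc b hb q r hq hr
    exact h _ hqy hyr (hne y ⟨hsub hy.1, hy.2⟩) y rfl hy
  have hs : ∃ s, ∀ b, x ∈ U b → U b ∩ A ∈ germ ε s p ∧ (germ ε s p).NeBot := by
    by_contra! hcon
    obtain ⟨b₂, hb₂, h2⟩ := hcon true
    obtain ⟨b₃, hb₃, h3⟩ := hcon false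
    obtain ⟨b₄, hb₄, h4, h4'⟩ := hsmall _ (hU.mem_nhds hb₂) _ (hU.mem_nhds hb₃)
    obtain ⟨b, hb, h5, h5'⟩ := hsmall _ (hU.mem_nhds hb₀) _ (hU.mem_nhds hb₄)
    obtain ⟨s, hs, hs'⟩ := hside b hb h5
    cases s
    · exact hs'.ne (by simpa using h3 (Filter.mem_of_superset hs
        (inter_subset_inter_left _ (h5'.trans h4'))))
    · exact hs'.ne (by simpa using h2 (Filter.mem_of_superset hs
        (inter_subset_inter_left _ (h5'.trans h4))))
  obtain ⟨s, hs⟩ := hs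
  refine ⟨s, p, hp.1 hlD, hp.2 hub, Filter.mem_of_superset (hs b₀ hb₀).1 inter_subset_right,
    (hs b₀ hb₀).2, fun V hV => ?_⟩
  obtain ⟨b, hb, h⟩ := hU.mem_nhds_iff.1 hV
  exact Filter.mem_of_superset (hs b hb).1 (inter_subset_left.trans h)

theorem eq_of_le_nhds [T2Space T] {F : Filter T} [F.NeBot] {x y : T} (hx : F ≤ 𝓝 x)
    (hy : F ≤ 𝓝 y) : x = y :=
  eq_of_nhds_neBot (Filter.NeBot.mono ‹_› (le_inf hx hy))

/-- A germ at a point of the line that is neither on the frontier of `T` nor the coordinate of a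
point where the order topology fails to refine the given one can only converge to that point. -/
theorem eq_of_germ_le_nhds [T2Space T] {s : Bool} {p : M} [(germ ε s p).NeBot]
    (hfr : p ∉ frontier {z | ∃ x, ε x = z ∧ x ∈ (univ : Set T)})
    (hgood : ∀ y, ε y = p → Filter.comap ε (𝓝 p) ≤ 𝓝 y) {x : T} (hx : germ ε s p ≤ 𝓝 x) :
    ε x = p := by
  rcases eventually_nhds_or_of_notMem_frontier hfr with h | h
  · obtain ⟨y, hy, -⟩ := h.self_of_nhds
    rw [eq_of_le_nhds hx ((germ_le_comap_nhds s p).trans (hgood y hy)), hy]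
  · have : ∀ᶠ z in side s p, ¬ ∃ x, ε x = z ∧ x ∈ (univ : Set T) := side_le_nhds s p h
    have hf := Filter.comap_neBot_iff_frequently.1 ‹(germ ε s p).NeBot›
    obtain ⟨z, h1, h2⟩ := (hf.and_eventually this).exists
    obtain ⟨y, hy⟩ := h1
    exact absurd ⟨y, hy, trivial⟩ h2

/-- If the order topology refines the given definable Hausdorff topology at all but finitely many
points, then both agree at all but finitely many points: the exceptions are limits of germs at
finitely many points of the line. -/
theorem IsDefBasis.finite_nhds_ne (hM : IsOMinimal L M) [T2Space T] (hε : ε.Injective)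
    {U : (β → M) → Set T} (hU : IsDefBasis L ε U) (hR : DefSet L ε univ) {l l' : M}
    (hl : ∀ x, l ≤ ε x ∧ ε x ≤ l') (hfin : {x | ¬ Filter.comap ε (𝓝 (ε x)) ≤ 𝓝 x}.Finite) :
    {x | 𝓝 x ≠ Filter.comap ε (𝓝 (ε x))}.Finite := by
  set P₀ : Set M := frontier {z | ∃ x, ε x = z ∧ x ∈ (univ : Set T)} ∪
    ε '' {x | ¬ Filter.comap ε (𝓝 (ε x)) ≤ 𝓝 x} with hP₀
  have hP₀fin : P₀.Finite := (DefPred₁.finite_frontier hM hR).union (hfin.image ε)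
  have hE : (⋃ p ∈ P₀, ⋃ s : Bool, {x | (germ ε s p).NeBot ∧ germ ε s p ≤ 𝓝 x}).Finite := by
    refine hP₀fin.biUnion fun p _ => finite_iUnion fun s => Set.Subsingleton.finite ?_
    rintro x ⟨hx, hx'⟩ y ⟨-, hy⟩
    exact eq_of_le_nhds hx' hy
  refine (hfin.union hE).subset fun x hx => ?_
  by_contra hcon
  simp only [mem_union, mem_ofPred_eq, not_or, not_not, mem_iUnion, not_exists, not_and] at hcon
  refine hx (le_antisymm ?_ hcon.1)
  rw [← Filter.tendsto_iff_comap, (nhds_basis_Ioo (ε x)).tendsto_right_iff]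
  rintro ⟨u, v⟩ ⟨hu, hv⟩
  have hA : DefSet L ε {y | ε y ≤ u ∨ v ≤ ε y} := by
    refine DefSet.preimage hR (P := fun z => z ≤ u ∨ v ≤ z) ?_
    exact DefPred.or (DefPred.le hM (DefFun.var _) (DefFun.const _))
      (DefPred.le hM (DefFun.const _) (DefFun.var _))
  have hxA : x ∉ {y | ε y ≤ u ∨ v ≤ ε y} := by
    rintro (h | h)
    · exact absurd h (not_le.2 hu)
    · exact absurd h (not_le.2 hv)
  have hncl : x ∉ closure {y | ε y ≤ u ∨ v ≤ ε y} := by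
    intro hcl
    obtain ⟨s, p, -, -, hAs, hne, hle⟩ := hU.exists_germ_of_mem_closure hM hε hA
      (fun y _ => hl y) hcl hxA
    have hp : p ∉ P₀ := fun hp => hcon.2 p hp s hne hle
    have hxp : ε x = p := by
      refine eq_of_germ_le_nhds (fun h => hp (Or.inl h)) (fun y hy => ?_) hle
      by_contra hbad
      exact hp (Or.inr ⟨y, by simpa [hy] using hbad, hy⟩)
    subst hxp
    have h1 : {y | u < ε y ∧ ε y < v} ∈ germ ε s (ε x) :=
      germ_le_comap_nhds s _ (Filter.preimage_mem_comap (Ioo_mem_nhds hu hv))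
    obtain ⟨y, hy, hy'⟩ := hne.nonempty_of_mem (Filter.inter_mem hAs h1)
    rcases hy with h | h
    · exact absurd h (not_le.2 hy'.1)
    · exact absurd h (not_le.2 hy'.2)
  filter_upwards [isClosed_closure.isOpen_compl.mem_nhds hncl] with y hy
  exact ⟨not_le.1 fun h => hy (subset_closure (Or.inl h)),
    not_le.1 fun h => hy (subset_closure (Or.inr h))⟩

/-- A topology induced by finitely many definable functions of the coordinate is refined by the
order topology at all but finitely many points. -/
theorem finite_not_comap_nhds_le_of_isInducing (hM : IsOMinimalExpansion L M) (hε : ε.Injective)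
    {ι : Type*} [Finite ι] {f : ι → M → M} (hf : ∀ i, DefFun₁ L (f i))
    (hind : IsInducing fun x i => f i (ε x)) :
    {x | ¬ Filter.comap ε (𝓝 (ε x)) ≤ 𝓝 x}.Finite := by
  have hfin : (⋃ i, {z | ¬ ContinuousAt (f i) z}).Finite :=
    finite_iUnion fun i => (hf i).finite_not_continuousAt hM
  refine (hfin.preimage hε.injOn).subset fun x hx => ?_
  by_contra hcon
  simp only [mem_preimage, mem_iUnion, not_exists, mem_ofPred_eq, not_not] at hcon
  refine hx ?_
  rw [hind.nhds_eq_comap, ← Filter.tendsto_iff_comap]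
  exact tendsto_pi_nhds.2 fun i => (hcon i).tendsto.comp Filter.tendsto_comap

/-! ### Definably connected sets -/

/-- An order-convex set of points at which the order topology refines the given one has no
definable separation. -/
theorem not_separated_of_ordConnected (hM : IsOMinimal L M) (hε : ε.Injective) {I : Set M}
    (hI : I.OrdConnected) (hIR : I ⊆ range ε)
    (hgood : ∀ x, ε x ∈ I → Filter.comap ε (𝓝 (ε x)) ≤ 𝓝 x) {U W : Set T} (hU : DefSet L ε U)
    (hUne : U.Nonempty) (hWne : W.Nonempty) (hUo : ∃ O, IsOpen O ∧ U = ε ⁻¹' I ∩ O)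
    (hWo : ∃ O, IsOpen O ∧ W = ε ⁻¹' I ∩ O) (hUW : U ∩ W = ∅) (hcup : U ∪ W = ε ⁻¹' I) : False := by
  obtain ⟨O₁, hO₁, hUO⟩ := hUo
  obtain ⟨O₂, hO₂, hWO⟩ := hWo
  obtain ⟨u, hu⟩ := hUne
  obtain ⟨w, hw⟩ := hWne
  have hdis : ∀ x ∈ W, x ∉ U := fun x hxW hxU => by
    have : x ∈ U ∩ W := ⟨hxU, hxW⟩
    simp [hUW] at this
  have huI : ε u ∈ I := hcup.subset (Or.inl hu)
  have hwI : ε w ∈ I := hcup.subset (Or.inr hw)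
  have hopen : ∀ y, ε y ∈ I → ∀ O, IsOpen O → y ∈ O →
      ∀ᶠ z in 𝓝[I] (ε y), ∃ x, ε x = z ∧ x ∈ ε ⁻¹' I ∩ O := by
    intro y hy O hO hyO
    have := Filter.eventually_comap.1 (hgood y hy (hO.mem_nhds hyO))
    filter_upwards [nhdsWithin_le_nhds this, self_mem_nhdsWithin] with z hz hzI
    obtain ⟨x, rfl⟩ := hIR hzI
    exact ⟨x, rfl, hzI, hz x rfl⟩
  have := DefPred₁.of_ordConnected hM hU hI (fun t ht => ?_) huI hwI ⟨u, rfl, hu⟩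
  · exact hdis w hw ((DefSet.image_iff hε).1 this)
  · obtain ⟨y, rfl⟩ := hIR ht
    rcases hcup.superset (show y ∈ ε ⁻¹' I from ht) with hy | hy
    · left
      exact (hopen y ht O₁ hO₁ (hUO.subset hy).2).mono fun z hz => by rwa [hUO]
    · right
      refine (hopen y ht O₂ hO₂ (hWO.subset hy).2).mono ?_
      rintro _ ⟨x, rfl, hx⟩ h
      exact hdis x (hWO.superset hx) ((DefSet.image_iff hε).1 h)

theorem IsPointOrInterval.ordConnected {I : Set M} (hI : IsPointOrInterval I) : I.OrdConnected := by
  rcases hI with rfl | ⟨a, rfl⟩ | ⟨a, rfl⟩ | ⟨a, rfl⟩ | ⟨a, b, rfl⟩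
  · exact ordConnected_univ
  · exact ordConnected_singleton
  · exact ordConnected_Iio
  · exact ordConnected_Ioi
  · exact ordConnected_Ioo

theorem IsPointOrInterval.defPred (hM : IsOMinimal L M) {I : Set M} (hI : IsPointOrInterval I) :
    DefPred₁ L (· ∈ I) := by
  rcases hI with rfl | ⟨a, rfl⟩ | ⟨a, rfl⟩ | ⟨a, rfl⟩ | ⟨a, b, rfl⟩
  · exact DefPred.const True
  · exact DefPred.eq (DefFun.var _) (DefFun.const _)
  · exact DefPred.lt hM (DefFun.var _) (DefFun.const _)
  · exact DefPred.lt hM (DefFun.const _) (DefFun.var _)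
  · exact DefPred.and (DefPred.lt hM (DefFun.const _) (DefFun.var _))
      (DefPred.lt hM (DefFun.var _) (DefFun.const _))

theorem defPred_mem_of_finite {C : Set M} (hC : C.Finite) : DefPred₁ L (· ∈ C) := by
  have : DefPred₁ L fun t : M => ∃ a : C, t = a := by
    have := hC.to_subtype
    refine DefPred.exists_finite fun a => ?_
    exact DefPred.eq (DefFun.var _) (DefFun.const _)
  exact this.of_iff fun v => by simp

/-- Every definable set is a finite union of points and of intervals avoiding a given finite set. -/
theorem DefSet.exists_finite_cover (hM : IsOMinimal L M) (hε : ε.Injective)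
    {A : Set T} (hA : DefSet L ε A) {E : Set T} (hE : E.Finite) :
    ∃ F : Set (Set T), F.Finite ∧ ⋃₀ F = A ∧ ∀ C ∈ F, DefSet L ε C ∧ (C.Subsingleton ∨
      ∃ I : Set M, I.OrdConnected ∧ I ⊆ range ε ∧ C = ε ⁻¹' I ∧ ∀ x ∈ C, x ∉ E) := by
  have hd : DefPred₁ L fun z => (∃ x, ε x = z ∧ x ∈ A) ∧ z ∉ ε '' E := by
    have h1 := defPred_mem_of_finite (L := L) (hE.image ε)
    exact DefPred.and hA (DefPred.not h1)
  obtain ⟨F, hF, hI, hFA⟩ := hd.exists_finite_sUnion hM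
  have hsub : ∀ I ∈ F, ∀ z ∈ I, (∃ x, ε x = z ∧ x ∈ A) ∧ z ∉ ε '' E := fun I hIF z hz => by
    have : z ∈ {z | (∃ x, ε x = z ∧ x ∈ A) ∧ z ∉ ε '' E} := hFA ▸ mem_sUnion_of_mem hz hIF
    exact this
  refine ⟨(fun I => ε ⁻¹' I) '' F ∪ singleton '' (E ∩ A), (hF.image _).union
    ((hE.inter_of_left A).image _), ?_, ?_⟩
  · ext x
    constructor
    · rintro ⟨_, ⟨I, hIF, rfl⟩ | ⟨y, hy, rfl⟩, hx⟩
      · exact (DefSet.image_iff hε).1 (hsub I hIF _ hx).1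
      · rw [mem_singleton_iff.1 hx]
        exact hy.2
    · intro hx
      by_cases hxE : x ∈ E
      · exact ⟨{x}, Or.inr ⟨x, ⟨hxE, hx⟩, rfl⟩, rfl⟩
      · have : ε x ∈ ⋃₀ F := by
          rw [← hFA]
          refine ⟨⟨x, rfl, hx⟩, ?_⟩
          rintro ⟨y, hy, hyx⟩
          exact hxE (hε hyx ▸ hy)
        obtain ⟨I, hIF, hxI⟩ := this
        exact ⟨_, Or.inl ⟨I, hIF, rfl⟩, hxI⟩
  · rintro _ (⟨I, hIF, rfl⟩ | ⟨y, hy, rfl⟩)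
    · refine ⟨?_, Or.inr ⟨I, (hI I hIF).ordConnected, fun z hz => ?_, rfl, fun x hx hxE => ?_⟩⟩
      · refine ((hI I hIF).defPred hM).of_iff fun v => ?_
        constructor
        · rintro ⟨x, hx, hxI⟩
          exact hx ▸ hxI
        · intro hv
          obtain ⟨⟨x, hx, -⟩, -⟩ := hsub I hIF _ hv
          exact ⟨x, hx, by simpa [hx] using hv⟩
      · obtain ⟨⟨x, hx, -⟩, -⟩ := hsub I hIF _ hz
        exact ⟨x, hx⟩
      · exact (hsub I hIF _ hx).2 ⟨x, hxE, rfl⟩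
    · refine ⟨?_, Or.inl subsingleton_singleton⟩
      have : DefPred₁ L fun z => z = ε y := DefPred.eq (DefFun.var _) (DefFun.const _)
      exact this.of_iff fun v => ⟨fun ⟨x, hx, hxy⟩ => by rw [← hx, mem_singleton_iff.1 hxy],
        fun h => ⟨y, h.symm, rfl⟩⟩

end LineTopology

/-! ### Totally separated intervals -/

section Separated

variable {L : Language} {M : Type*} [L.Structure M] [AddCommGroup M] [LinearOrder M]
  [IsOrderedAddMonoid M] [Nontrivial M] [TopologicalSpace M] [OrderTopology M] [DenselyOrdered M]
  {T : Type*} {ε : T → M} {β : Type*} [Finite β] [TopologicalSpace T]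

/-- Some infinite definable set is definably separated between any two of its points. -/
def HasSeparatedSet (L : Language) {M : Type*} [L.Structure M] {T : Type*} [TopologicalSpace T]
    (ε : T → M) : Prop :=
  ∃ A : Set T, DefSet L ε A ∧ A.Infinite ∧ ∀ x ∈ A, ∀ y ∈ A, x ≠ y → ∃ U W : Set T,
    DefSet L ε U ∧ DefSet L ε W ∧ (x ∈ U ∧ y ∈ W ∨ y ∈ U ∧ x ∈ W) ∧
    (∃ O, IsOpen O ∧ U = A ∩ O) ∧ (∃ O, IsOpen O ∧ W = A ∩ O) ∧ U ∩ W = ∅ ∧ U ∪ W = A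

/-- Suppose that infinitely many points have a neighbourhood missing a right germ at the point. On a
suitable interval every initial segment is then open, by uniformity, and closed, because no germ at
a point of the interval converges to another point of the interval. -/
theorem IsDefBasis.hasSeparatedSet_of_right (hM : IsOMinimalExpansion L M) [T2Space T]
    (hε : ε.Injective) {U : (β → M) → Set T} (hU : IsDefBasis L ε U) (hR : DefSet L ε univ)
    (hinf : {x | ¬ germ ε true (ε x) ≤ 𝓝 x}.Infinite) : HasSeparatedSet L ε := by
  obtain ⟨R, hRdef⟩ : ∃ R : M → (β → M) → Prop, R = fun z b => ∃ x, ε x = z ∧ x ∈ U b := ⟨_, rfl⟩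
  have hRd : DefRel L R := hRdef ▸ hU.definable
  have hRx : ∀ x b, R (ε x) b ↔ x ∈ U b := fun x b => by rw [hRdef]; exact DefSet.image_iff hε
  have hRz : ∀ z b, R z b → ∃ x, ε x = z ∧ x ∈ U b := fun z b h => by rwa [hRdef] at h
  have hbad : DefPred₁ L fun z => ∃ b : β → M, R z b ∧ ∀ᶠ w in side true z, ¬ R w b := by
    refine DefPred.exT (DefPred.and (hRd.app (DefFun.var _) fun _ => DefFun.var _)
      (DefPred.eventually_side hM.1 true (DefFun.var _) (DefPred.not
      (hRd.app (DefFun.var _) fun _ => DefFun.var _))))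
  have hbadinf : {z | ∃ b : β → M, R z b ∧ ∀ᶠ w in side true z, ¬ R w b}.Infinite := by
    refine (hinf.image hε.injOn).mono ?_
    rintro _ ⟨x, hx, rfl⟩
    obtain ⟨V, hV, hVg⟩ := Filter.not_le.1 hx
    obtain ⟨b, hb, hbV⟩ := hU.mem_nhds_iff.1 hV
    refine ⟨b, (hRx x b).2 hb, ?_⟩
    have := ((hU.defSet b).mem_germ_or hM.1 hε true (ε x)).resolve_left
      fun h => hVg (Filter.mem_of_superset h.1 hbV)
    refine (mem_germ.1 this).mono fun w hw hRw => ?_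
    obtain ⟨y, rfl, hy⟩ := hRz w b hRw
    exact hw y rfl hy
  obtain ⟨c₀, d₀, hcd₀, hI₀⟩ := hbad.exists_Ioo_of_infinite hM.1 hbadinf
  have hrange : ∀ z, c₀ < z → z < d₀ → ∃ x, ε x = z := fun z h1 h2 => by
    obtain ⟨b, hb, -⟩ := hI₀ z h1 h2
    obtain ⟨x, hx, -⟩ := hRz z b hb
    exact ⟨x, hx⟩
  -- `Lim s p q`: the germ at `p` on the side `s` converges to the point with coordinate `q`.
  let Lim : Bool → M → M → Prop := fun s p q => (∃ b, R q b) ∧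
    ∀ b : β → M, R q b → ∀ᶠ w in side s p, R w b
  have hLimd : ∀ s, DefPred₂ L (Lim s) := fun s => by
    refine DefPred.and (DefPred.exT (hRd.app (DefFun.var _) fun _ => DefFun.var _))
      (DefPred.allT (DefPred.imp (hRd.app (DefFun.var _) fun _ => DefFun.var _)
      (DefPred.eventually_side hM.1 s (DefFun.var _)
      (hRd.app (DefFun.var _) fun _ => DefFun.var _))))
  have hLimu : ∀ s p q q', Lim s p q → Lim s p q' → q = q' := by
    rintro s p q q' ⟨⟨b, hb⟩, h⟩ ⟨⟨b', hb'⟩, h'⟩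
    obtain ⟨x, rfl, hx⟩ := hRz q b hb
    obtain ⟨y, rfl, hy⟩ := hRz q' b' hb'
    by_contra hne
    obtain ⟨V, W, hV, hW, hxV, hyW, hVW⟩ := t2_separation fun hxy : x = y => hne (congrArg ε hxy)
    obtain ⟨b₁, hb₁, h1⟩ := hU.mem_nhds_iff.1 (hV.mem_nhds hxV)
    obtain ⟨b₂, hb₂, h2⟩ := hU.mem_nhds_iff.1 (hW.mem_nhds hyW)
    obtain ⟨w, hw1, hw2⟩ := ((h b₁ ((hRx x b₁).2 hb₁)).and (h' b₂ ((hRx y b₂).2 hb₂))).exists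
    obtain ⟨v, rfl, hv⟩ := hRz w b₁ hw1
    exact disjoint_left.1 hVW (h1 hv) (h2 ((hRx v b₂).1 hw2))
  have hLimev : ∀ s p s', ∀ᶠ q in side s' p, ¬ Lim s p q := by
    intro s p s'
    by_cases h : ∃ a, Lim s p a
    · obtain ⟨a, ha⟩ := h
      have : ∀ᶠ q in 𝓝[≠] p, q ≠ a := by
        rcases eq_or_ne p a with rfl | hne
        · exact self_mem_nhdsWithin
        · exact nhdsWithin_le_nhds (isOpen_ne.mem_nhds hne)
      exact Filter.Eventually.mono (side_le_nhdsNE s' p this) fun q hq hl =>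
        hq (hLimu s p q a hl ha)
    · exact .of_forall fun q hq => h ⟨q, hq⟩
  have hQ : DefPred₂ L fun t s => (∃ b : β → M, R t b ∧ ∀ w, t < w → w ≤ s → ¬ R w b) ∧
      ¬ Lim true t s ∧ ¬ Lim false t s := by
    have h1 := hLimd true
    have h2 := hLimd false
    refine DefPred.and (DefPred.exT (DefPred.and (hRd.app (DefFun.var _) fun _ => DefFun.var _)
      (DefPred.all (DefPred.imp (DefPred.lt hM.1 (DefFun.var _) (DefFun.var _)) (DefPred.imp
      (DefPred.le hM.1 (DefFun.var _) (DefFun.var _)) (DefPred.not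
      (hRd.app (DefFun.var _) fun _ => DefFun.var _)))))))
      (DefPred.and (DefPred.not h1) (DefPred.not h2))
  obtain ⟨c₁, d₁, hc₁, hcd₁, hd₁, hI₁⟩ := hQ.exists_Ioo_forall_lt hM hcd₀ fun t ht => by
    obtain ⟨b, hb, hev⟩ := hI₀ t ht.1 ht.2
    obtain ⟨u, hu, hw⟩ := eventually_side_true.1 hev
    have h1 : ∀ᶠ s in side true t, s < u := side_le_nhds true t (gt_mem_nhds hu)
    filter_upwards [h1, hLimev true t true, hLimev false t true] with s h1 h2 h3
    exact ⟨⟨b, hb, fun w hw1 hw2 => hw w hw1 (hw2.trans_lt h1)⟩, h2, h3⟩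
  have hQ' : DefPred₂ L fun t s => ¬ Lim true t s ∧ ¬ Lim false t s :=
    DefPred.and (DefPred.not (hLimd true)) (DefPred.not (hLimd false))
  obtain ⟨c, d, hc, hcd, hd, hI⟩ := hQ'.exists_Ioo_forall_gt hM hcd₁ fun t _ =>
    (hLimev true t false).and (hLimev false t false)
  have hopen : ∀ t s, c < t → t < s → s < d → ∃ b : β → M, R t b ∧ ∀ w, t < w → w ≤ s → ¬ R w b :=
    fun t s h1 h2 h3 => (hI₁ t s (hc.trans_lt h1) h2 (h3.trans_le hd)).1
  have hnolim : ∀ σ p q, c < p → p < d → c < q → q < d → p ≠ q → ¬ Lim σ p q := by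
    intro σ p q h1 h2 h3 h4 hne
    have : ¬ Lim true p q ∧ ¬ Lim false p q := by
      rcases lt_or_gt_of_ne hne with h | h
      · exact (hI₁ p q (hc.trans_lt h1) h (h4.trans_le hd)).2
      · exact hI p q h3 h h2
    cases σ
    · exact this.2
    · exact this.1
  have hrange' : ∀ z, c < z → z < d → ∃ x, ε x = z := fun z h1 h2 =>
    hrange z ((hc₁.trans hc).trans_lt h1) (h2.trans_le (hd.trans hd₁))
  obtain ⟨c', hcc', hc'd⟩ := exists_between hcd
  obtain ⟨d', hcd', hdd'⟩ := exists_between hc'd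
  have key : ∀ x y, c' < ε x → ε x < ε y → ε y < d' → ∃ V W : Set T,
      DefSet L ε V ∧ DefSet L ε W ∧ (x ∈ V ∧ y ∈ W) ∧
      (∃ O, IsOpen O ∧ V = {u | c' < ε u ∧ ε u < d'} ∩ O) ∧
      (∃ O, IsOpen O ∧ W = {u | c' < ε u ∧ ε u < d'} ∩ O) ∧ V ∩ W = ∅ ∧
      V ∪ W = {u | c' < ε u ∧ ε u < d'} := by
    intro x y hx hxy hy
    have hVd : DefSet L ε {u | c' < ε u ∧ ε u ≤ ε x} := by
      refine DefSet.preimage hR (P := fun z => c' < z ∧ z ≤ ε x) ?_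
      exact DefPred.and (DefPred.lt hM.1 (DefFun.const _) (DefFun.var _))
        (DefPred.le hM.1 (DefFun.var _) (DefFun.const _))
    have hWd : DefSet L ε {u | ε x < ε u ∧ ε u < d'} := by
      refine DefSet.preimage hR (P := fun z => ε x < z ∧ z < d') ?_
      exact DefPred.and (DefPred.lt hM.1 (DefFun.const _) (DefFun.var _))
        (DefPred.lt hM.1 (DefFun.var _) (DefFun.const _))
    refine ⟨{u | c' < ε u ∧ ε u ≤ ε x}, {u | ε x < ε u ∧ ε u < d'}, hVd, hWd,
      ⟨⟨hx, le_rfl⟩, ⟨hxy, hy⟩⟩,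
      ⟨interior ({u | c' < ε u ∧ ε u ≤ ε x} ∪ {u | c' < ε u ∧ ε u < d'}ᶜ), isOpen_interior, ?_⟩,
      ⟨(closure {u | c' < ε u ∧ ε u ≤ ε x})ᶜ, isClosed_closure.isOpen_compl, ?_⟩, ?_, ?_⟩
    · ext u
      constructor
      · rintro ⟨hu1, hu2⟩
        refine ⟨⟨hu1, hu2.trans_lt (hxy.trans hy)⟩, mem_interior_iff_mem_nhds.2 ?_⟩
        obtain ⟨b, hb, hw⟩ := hopen (ε u) d' (hcc'.trans hu1) (hu2.trans_lt (hxy.trans hy)) hdd'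
        refine Filter.mem_of_superset (hU.mem_nhds ((hRx u b).1 hb)) fun v hv => ?_
        by_cases hvA : c' < ε v ∧ ε v < d'
        · refine Or.inl ⟨hvA.1, not_lt.1 fun hlt => ?_⟩
          exact hw _ (hu2.trans_lt hlt) hvA.2.le ((hRx v b).2 hv)
        · exact Or.inr hvA
      · rintro ⟨hu, hu'⟩
        rcases interior_subset hu' with h | h
        · exact h
        · exact absurd hu h
    · ext u
      constructor
      · rintro ⟨hu1, hu2⟩
        refine ⟨⟨hx.trans hu1, hu2⟩, fun hcl => ?_⟩
        obtain ⟨s, p, hp1, hp2, -, hne, hle⟩ := hU.exists_germ_of_mem_closure hM.1 hε hVd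
          (fun v hv => ⟨hv.1.le, hv.2⟩) hcl fun h => absurd h.2 (not_le.2 hu1)
        have hpc : c < p := hcc'.trans_le hp1
        have hpd : p < d := hp2.trans_lt ((hu1.trans hu2).trans hdd')
        refine hnolim s p (ε u) hpc hpd ((hcc'.trans hx).trans hu1) (hu2.trans hdd')
          (hp2.trans_lt hu1).ne ⟨?_, fun b hb => ?_⟩
        · obtain ⟨b, hb, -⟩ := hU.mem_nhds_iff.1 (Filter.univ_mem : univ ∈ 𝓝 u)
          exact ⟨b, (hRx u b).2 hb⟩
        · have h1 := mem_germ.1 (hle (hU.mem_nhds ((hRx u b).1 hb)))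
          have h2 : ∀ᶠ z in side s p, z ∈ Ioo c d := side_le_nhds s p (Ioo_mem_nhds hpc hpd)
          filter_upwards [h1, h2] with z h1 h2
          obtain ⟨v, rfl⟩ := hrange' z h2.1 h2.2
          exact (hRx v b).2 (h1 v rfl)
      · rintro ⟨hu, hu'⟩
        exact ⟨not_le.1 fun h => hu' (subset_closure ⟨hu.1, h⟩), hu.2⟩
    · refine eq_empty_iff_forall_notMem.2 fun u hu => ?_
      exact absurd hu.1.2 (not_le.2 hu.2.1)
    · ext u
      constructor
      · rintro (h | h)
        · exact ⟨h.1, h.2.trans_lt (hxy.trans hy)⟩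
        · exact ⟨hx.trans h.1, h.2⟩
      · intro h
        rcases le_or_gt (ε u) (ε x) with h' | h'
        · exact Or.inl ⟨h.1, h'⟩
        · exact Or.inr ⟨h', h.2⟩
  refine ⟨{u | c' < ε u ∧ ε u < d'}, ?_, ?_, fun x hx y hy hxy => ?_⟩
  · refine DefSet.preimage hR (P := fun z => c' < z ∧ z < d') ?_
    exact DefPred.and (DefPred.lt hM.1 (DefFun.const _) (DefFun.var _))
      (DefPred.lt hM.1 (DefFun.var _) (DefFun.const _))
  · refine Set.Infinite.of_image ε ((Ioo_infinite hcd').mono fun z hz => ?_)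
    obtain ⟨x, rfl⟩ := hrange' z (hcc'.trans hz.1) (hz.2.trans hdd')
    exact ⟨x, hz, rfl⟩
  · rcases lt_or_gt_of_ne (hε.ne hxy) with h | h
    · obtain ⟨V, W, h1, h2, h3, h4⟩ := key x y hx.1 h hy.2
      exact ⟨V, W, h1, h2, Or.inl h3, h4⟩
    · obtain ⟨V, W, h1, h2, h3, h4⟩ := key y x hy.1 h hx.2
      exact ⟨V, W, h1, h2, Or.inr h3, h4⟩

theorem DefSet.neg_iff (hM : IsOMinimalExpansion L M) {A : Set T} :
    DefSet L (fun x => - ε x) A ↔ DefSet L ε A := by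
  constructor <;> intro h
  · have : DefPred₁ L fun z => ∃ x, - ε x = - z ∧ x ∈ A :=
      DefPred₁.app h (DefFun.neg hM (DefFun.var 0))
    exact this.of_iff fun v => by simp
  · have : DefPred₁ L fun z => ∃ x, ε x = - z ∧ x ∈ A :=
      DefPred₁.app h (DefFun.neg hM (DefFun.var 0))
    exact this.of_iff fun v => by simp [neg_eq_iff_eq_neg]

/-- If the order topology fails to refine the given definable Hausdorff topology at infinitely many
points, then some infinite definable set is definably totally separated. -/
theorem IsDefBasis.hasSeparatedSet (hM : IsOMinimalExpansion L M) [T2Space T]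
    (hε : ε.Injective) {U : (β → M) → Set T} (hU : IsDefBasis L ε U) (hR : DefSet L ε univ)
    (hinf : {x | ¬ Filter.comap ε (𝓝 (ε x)) ≤ 𝓝 x}.Infinite) : HasSeparatedSet L ε := by
  have hsub : {x | ¬ Filter.comap ε (𝓝 (ε x)) ≤ 𝓝 x} ⊆
      {x | ¬ germ ε true (ε x) ≤ 𝓝 x} ∪ {x | ¬ germ ε false (ε x) ≤ 𝓝 x} := by
    intro x hx
    by_contra hcon
    simp only [mem_union, mem_ofPred_eq, not_or, not_not] at hcon
    refine hx ?_
    have : 𝓝 (ε x) = pure (ε x) ⊔ (side false (ε x) ⊔ side true (ε x)) := by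
      rw [← nhdsNE_eq_sup_side, sup_comm, nhdsNE_sup_pure]
    rw [this, Filter.comap_sup, Filter.comap_sup]
    refine sup_le ?_ (sup_le hcon.2 hcon.1)
    intro V hV
    exact ⟨{ε x}, rfl, fun y hy => by
      have : y = x := hε hy
      exact this ▸ mem_of_mem_nhds hV⟩
  rcases Set.infinite_union.1 (hinf.mono hsub) with h | h
  · exact hU.hasSeparatedSet_of_right hM hε hR h
  -- The left-sided case is the right-sided one for the reversed coordinate.
  · have hU' : IsDefBasis L (fun x => - ε x) U := by
      refine ⟨hU.isBasis, ?_⟩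
      have := hU.definable.app (DefFun.neg hM (DefFun.var (Sum.inl ())))
        (t := fun i (v : Unit ⊕ β → M) => v (Sum.inr i)) fun _ => DefFun.var _
      exact this.of_iff fun v => by simp [neg_eq_iff_eq_neg]
    have hinf' : {x | ¬ germ (fun x => - ε x) true (- ε x) ≤ 𝓝 x}.Infinite := by
      refine Set.Infinite.mono (s := {x | ¬ germ ε false (ε x) ≤ 𝓝 x})
        (fun x hx hle => hx (le_trans ?_ hle)) h
      intro V hV
      obtain ⟨u, hu, hV⟩ := eventually_side_true.1 (mem_germ.1 hV)
      refine mem_germ.2 (eventually_side_false.2 ⟨-u, neg_lt_of_neg_lt hu, ?_⟩)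
      rintro _ h1 h2 y rfl
      exact hV _ (neg_lt_neg h2) (neg_lt_of_neg_lt h1) y rfl
    obtain ⟨A, hA, hAinf, hsep⟩ := hU'.hasSeparatedSet_of_right hM (neg_injective.comp hε)
      ((DefSet.neg_iff hM).2 hR) hinf'
    refine ⟨A, (DefSet.neg_iff hM).1 hA, hAinf, fun x hx y hy hxy => ?_⟩
    obtain ⟨V, W, h1, h2, h3⟩ := hsep x hx y hy hxy
    exact ⟨V, W, (DefSet.neg_iff hM).1 h1, (DefSet.neg_iff hM).1 h2, h3⟩

end Separated

/-! ### Embedding a finite graph -/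

section Graph

variable {L : Language} {M : Type*} [L.Structure M] [AddCommGroup M] [LinearOrder M]
  [IsOrderedAddMonoid M] [Nontrivial M] [TopologicalSpace M] [OrderTopology M] [DenselyOrdered M]
  {T : Type*} {ε : T → M} {β : Type*} [Finite β] [TopologicalSpace T]

/-- A finite set of cut points on the line, enclosing `T`, such that away from the cut points `T` is
a union of whole gaps and carries the order topology. The points of `T` whose coordinate is a cut
point are the vertices of a finite graph, and the gaps contained in `T` are its edges. -/
structure IsCutSet (ε : T → M) (C : Finset M) : Prop where
  frontier_subset : frontier {z | ∃ x, ε x = z ∧ x ∈ (univ : Set T)} ⊆ C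
  nhds_eq : ∀ x, ε x ∉ C → 𝓝 x = Filter.comap ε (𝓝 (ε x))
  exists_lt : ∀ x, ∃ c ∈ C, c < ε x
  exists_gt : ∀ x, ∃ c ∈ C, ε x < c

/-- The germ at `c` on the side `s` is nontrivial and converges to `x`: the corresponding end of an
edge is attached to `x`. -/
def IsAttached (ε : T → M) (s : Bool) (c : M) (x : T) : Prop :=
  (germ ε s c).NeBot ∧ germ ε s c ≤ 𝓝 x

theorem IsCutSet.eq_of_isAttached [T2Space T] {C : Finset M} (hC : IsCutSet ε C) {s : Bool} {p : M}
    (hp : p ∉ C) {x : T} (h : IsAttached ε s p x) : ε x = p := by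
  have := h.1
  refine eq_of_germ_le_nhds (fun h => hp (hC.frontier_subset h)) (fun y hy => ?_) h.2
  rw [hC.nhds_eq y (hy ▸ hp), hy]

theorem IsCutSet.mem_of_isAttached {C : Finset M} (hC : IsCutSet ε C) {s : Bool} {p : M}
    (hp : p ∈ C) {x : T} (h : IsAttached ε s p x) : ε x ∈ C := by
  by_contra hx
  have := h.1
  have h1 : Filter.Tendsto ε (germ ε s p) (𝓝 (ε x)) :=
    Filter.tendsto_iff_comap.2 (hC.nhds_eq x hx ▸ h.2)
  have h2 : Filter.Tendsto ε (germ ε s p) (𝓝 p) :=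
    Filter.tendsto_iff_comap.2 (germ_le_comap_nhds s p)
  exact hx (tendsto_nhds_unique h1 h2 ▸ hp)

/-- A definable function of the coordinate is continuous if it is order-continuous off the cut
points and has the right limits along the ends of edges. -/
theorem IsCutSet.continuous_comp (hM : IsOMinimal L M) [T2Space T] (hε : ε.Injective)
    {U : (β → M) → Set T} (hU : IsDefBasis L ε U) (hR : DefSet L ε univ) {l l' : M}
    (hl : ∀ x, l ≤ ε x ∧ ε x ≤ l') {C : Finset M} (hC : IsCutSet ε C) {f : M → M}
    (hf : DefFun₁ L f) (hcont : ∀ p, p ∉ C → ContinuousAt f p)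
    (hlim : ∀ s p x, p ∈ C → ε x ∈ C → IsAttached ε s p x →
      Filter.Tendsto f (side s p) (𝓝 (f (ε x)))) : Continuous fun x => f (ε x) := by
  refine continuous_iff_continuousAt.2 fun x => ?_
  rw [ContinuousAt, (nhds_basis_Ioo (f (ε x))).tendsto_right_iff]
  rintro ⟨u, v⟩ ⟨hu, hv⟩
  have hA : DefSet L ε {y | f (ε y) ≤ u ∨ v ≤ f (ε y)} := by
    refine DefSet.preimage hR (P := fun z => f z ≤ u ∨ v ≤ f z) ?_
    exact DefPred.or (DefPred.le hM (hf.app (DefFun.var _)) (DefFun.const _))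
      (DefPred.le hM (DefFun.const _) (hf.app (DefFun.var _)))
  have hxA : x ∉ {y | f (ε y) ≤ u ∨ v ≤ f (ε y)} := by
    rintro (h | h)
    · exact absurd h (not_le.2 hu)
    · exact absurd h (not_le.2 hv)
  have hncl : x ∉ closure {y | f (ε y) ≤ u ∨ v ≤ f (ε y)} := by
    intro hcl
    obtain ⟨s, p, -, -, hAs, hne, hle⟩ := hU.exists_germ_of_mem_closure hM hε hA
      (fun y _ => hl y) hcl hxA
    have ht : Filter.Tendsto f (side s p) (𝓝 (f (ε x))) := by
      by_cases hp : p ∈ C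
      · exact hlim s p x hp (hC.mem_of_isAttached hp ⟨hne, hle⟩) ⟨hne, hle⟩
      · rw [hC.eq_of_isAttached hp ⟨hne, hle⟩]
        exact (hcont p hp).mono_left (side_le_nhds s p)
    have h0 : f ⁻¹' Ioo u v ∈ side s p := ht (Ioo_mem_nhds hu hv)
    have h1 : ε ⁻¹' (f ⁻¹' Ioo u v) ∈ germ ε s p := Filter.preimage_mem_comap h0
    obtain ⟨y, hy, hy'⟩ := hne.nonempty_of_mem (Filter.inter_mem hAs h1)
    rcases hy with h | h
    · exact absurd h (not_le.2 hy'.1)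
    · exact absurd h (not_le.2 hy'.2)
  filter_upwards [isClosed_closure.isOpen_compl.mem_nhds hncl] with y hy
  exact ⟨not_le.1 fun h => hy (subset_closure (Or.inl h)),
    not_le.1 fun h => hy (subset_closure (Or.inr h))⟩

/-- The tent over the interval `(a, b)`: the distance to the complement of the interval. -/
def tent (a b t : M) : M := max 0 (min (t - a) (b - t))

theorem defFun_tent (hM : IsOMinimalExpansion L M) (a b : M) : DefFun₁ L (tent a b) := by
  refine DefFun₁.of_defFun ?_
  unfold tent
  apply_rules [DefFun.max, DefFun.min, DefFun.sub, DefFun.var, DefFun.const, hM, hM.1]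

theorem continuous_tent (a b : M) : Continuous (tent a b) := by
  unfold tent
  fun_prop

theorem IsCutSet.continuous_tent_comp (hM : IsOMinimalExpansion L M) [T2Space T] (hε : ε.Injective)
    {U : (β → M) → Set T} (hU : IsDefBasis L ε U) (hR : DefSet L ε univ) {l l' : M}
    (hl : ∀ x, l ≤ ε x ∧ ε x ≤ l') {C : Finset M} (hC : IsCutSet ε C) {a b : M}
    (hab : ∀ c ∈ C, c ≤ a ∨ b ≤ c) : Continuous fun x => tent a b (ε x) := by
  have h0 : ∀ c ∈ C, tent a b c = 0 := fun c hc => by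
    have := hab c hc
    unfold tent
    grind
  refine hC.continuous_comp hM.1 hε hU hR hl (defFun_tent hM a b)
    (fun p _ => (continuous_tent a b).continuousAt) fun s p x hp hx _ => ?_
  rw [h0 _ hx, ← h0 p hp]
  exact (continuous_tent a b).continuousAt.tendsto.mono_left (side_le_nhds s p)

/-- The tent over an interval and the tents over its two halves determine the position of a point of
the interval, topologically. The tents over the halves tell on which side of the midpoint a point
lies. -/
theorem le_nhds_of_tendsto_tent {a b m t : M} (hm : m + m = a + b) (hat : a < t) (htb : t < b)
    {F : Filter M} (h1 : Filter.Tendsto (tent a b) F (𝓝 (tent a b t)))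
    (h2 : Filter.Tendsto (tent a m) F (𝓝 (tent a m t)))
    (h3 : Filter.Tendsto (tent m b) F (𝓝 (tent m b t))) : F ≤ 𝓝 t := by
  rw [(nhds_basis_Ioo t).ge_iff]
  rintro ⟨u, v⟩ ⟨hu, hv⟩
  simp only at hu hv
  rcases lt_trichotomy t m with hlt | rfl | hgt
  · have e1 : 0 < tent a m t := by unfold tent; grind
    have e2 : u - a < tent a b t ∧ tent a b t < v - a := by unfold tent; grind
    filter_upwards [h2 (lt_mem_nhds e1), h1 (Ioo_mem_nhds e2.1 e2.2)] with z hz1 hz2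
    simp only [mem_preimage, mem_Ioo, mem_ofPred_eq, tent] at hz1 hz2 ⊢
    grind
  · have e1 : max 0 (max (u - a) (b - v)) < tent a b t := by unfold tent; grind
    filter_upwards [h1 (lt_mem_nhds e1)] with z hz
    simp only [mem_preimage, mem_Ioo, mem_ofPred_eq, tent] at hz ⊢
    grind
  · have e1 : 0 < tent m b t := by unfold tent; grind
    have e2 : b - v < tent a b t ∧ tent a b t < b - u := by unfold tent; grind
    filter_upwards [h3 (lt_mem_nhds e1), h1 (Ioo_mem_nhds e2.1 e2.2)] with z hz1 hz2
    simp only [mem_preimage, mem_Ioo, mem_ofPred_eq, tent] at hz1 hz2 ⊢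
    grind

open scoped Classical in
/-- The distance to `c`, truncated at `δ`, on those sides of `c` on which the end of an edge is
attached to `g`, and `δ` elsewhere. -/
noncomputable def endDist (ε : T → M) (g : T) (δ c t : M) : M :=
  if c < t ∧ IsAttached ε true c g then min δ (t - c)
  else if t < c ∧ IsAttached ε false c g then min δ (c - t) else δ

open scoped Classical in
/-- The truncated distance to the vertex `g`, measured along the edges. At a cut point other than
the coordinate of `g` it takes the value `δ`, because there it has to be the common limit along all
the edges attached to that vertex. -/
noncomputable def vertexDist (ε : T → M) (C : Finset M) (hC : C.Nonempty) (g : T) (δ t : M) : M :=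
  if t = ε g then 0 else if t ∈ C then δ else C.inf' hC (endDist ε g δ) t

theorem defFun_endDist (hM : IsOMinimalExpansion L M) (g : T) (δ c : M) :
    DefFun₁ L (endDist ε g δ c) := by
  classical
  refine DefFun₁.of_defFun ?_
  unfold endDist
  refine DefFun.ite (DefPred.and (DefPred.lt hM.1 (DefFun.const _) (DefFun.var _))
    (DefPred.const _)) (DefFun.min hM.1 (DefFun.const _) (DefFun.sub hM (DefFun.var _)
    (DefFun.const _))) (DefFun.ite (DefPred.and (DefPred.lt hM.1 (DefFun.var _) (DefFun.const _))
    (DefPred.const _)) (DefFun.min hM.1 (DefFun.const _) (DefFun.sub hM (DefFun.const _)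
    (DefFun.var _))) (DefFun.const _))

theorem endDist_le {g : T} {δ c t : M} : endDist ε g δ c t ≤ δ := by
  unfold endDist
  split_ifs
  · exact min_le_left _ _
  · exact min_le_left _ _
  · exact le_rfl

theorem endDist_pos {g : T} {δ c t : M} (hδ : 0 < δ) : 0 < endDist ε g δ c t := by
  unfold endDist
  split_ifs with h1 h2
  · exact lt_min hδ (sub_pos.2 h1.1)
  · exact lt_min hδ (sub_pos.2 h2.1)
  · exact hδ

theorem continuousAt_endDist {g : T} {δ c t : M} (ht : t ≠ c) :
    ContinuousAt (endDist ε g δ c) t := by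
  classical
  rcases lt_or_gt_of_ne ht with h | h
  · have : ContinuousAt (fun t => if IsAttached ε false c g then min δ (c - t) else δ) t := by
      split_ifs <;> fun_prop
    refine this.congr ((gt_mem_nhds h).mono fun z hz => ?_)
    have hz' : z < c := hz
    simp [endDist, hz', hz'.not_gt]
  · have : ContinuousAt (fun t => if IsAttached ε true c g then min δ (t - c) else δ) t := by
      split_ifs <;> fun_prop
    refine this.congr ((lt_mem_nhds h).mono fun z hz => ?_)
    have hz' : c < z := hz
    simp [endDist, hz', hz'.not_gt]

theorem defFun_vertexDist (hM : IsOMinimalExpansion L M) {C : Finset M} (hC : C.Nonempty)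
    (g : T) (δ : M) : DefFun₁ L (vertexDist ε C hC g δ) := by
  classical
  have hinf : DefFun₁ L (C.inf' hC (endDist ε g δ)) := by
    refine Finset.inf'_induction hC _ (p := DefFun₁ L) (fun f hf f' hf' => ?_)
      fun c _ => defFun_endDist hM g δ c
    exact DefFun₁.of_defFun (DefFun.min hM.1 (hf.app (DefFun.var _)) (hf'.app (DefFun.var _)))
  have hmem : DefPred₁ L (· ∈ C) := defPred_mem_of_finite C.finite_toSet
  refine DefFun₁.of_defFun ?_
  unfold vertexDist
  exact DefFun.ite (DefPred.eq (DefFun.var _) (DefFun.const _)) (DefFun.const _)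
    (DefFun.ite (hmem.app (DefFun.var _)) (DefFun.const _) (hinf.app (DefFun.var _)))

theorem eventually_notMem_finset (C : Finset M) (p : M) : ∀ᶠ z in 𝓝[≠] p, z ∉ C := by
  have : ((C : Set M) \ {p})ᶜ ∈ 𝓝 p :=
    (C.finite_toSet.sdiff).isClosed.isOpen_compl.mem_nhds (by simp)
  filter_upwards [nhdsWithin_le_nhds this, self_mem_nhdsWithin] with z h1 h2 h3
  exact h1 ⟨h3, h2⟩

theorem vertexDist_eq {C : Finset M} (hC : C.Nonempty) {g : T} (hg : ε g ∈ C) {δ t : M}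
    (ht : t ∉ C) : vertexDist ε C hC g δ t = C.inf' hC (endDist ε g δ) t := by
  have : t ≠ ε g := fun h => ht (h ▸ hg)
  simp [vertexDist, this, ht]

theorem continuousAt_vertexDist {C : Finset M} (hC : C.Nonempty) {g : T} (hg : ε g ∈ C)
    {δ p : M} (hp : p ∉ C) : ContinuousAt (vertexDist ε C hC g δ) p := by
  have hinf : ContinuousAt (C.inf' hC (endDist ε g δ)) p := by
    refine Finset.inf'_induction hC _ (p := fun f => ContinuousAt f p)
      (fun f hf f' hf' => hf.min hf') fun c hc => continuousAt_endDist fun h => hp (h ▸ hc)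
  refine hinf.congr ?_
  filter_upwards [C.finite_toSet.isClosed.isOpen_compl.mem_nhds (by simpa using hp)] with z hz
  exact (vertexDist_eq hC hg (by simpa using hz)).symm

theorem tendsto_vertexDist [T2Space T] {C : Finset M} (hC : C.Nonempty) {g : T} (hg : ε g ∈ C)
    {δ : M} (hδ : 0 < δ) (hsep : ∀ c ∈ C, ∀ c' ∈ C, c ≠ c' → δ < |c - c'|) (hε : ε.Injective)
    {s : Bool} {p : M} {x : T} (hp : p ∈ C) (hx : ε x ∈ C) (hatt : IsAttached ε s p x) :
    Filter.Tendsto (vertexDist ε C hC g δ) (side s p) (𝓝 (vertexDist ε C hC g δ (ε x))) := by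
  have hnot : ∀ᶠ z in side s p, z ∉ C := side_le_nhdsNE s p (eventually_notMem_finset C p)
  have hside : ∀ᶠ z in side s p, if s then p < z else z < p := by
    cases s <;> exact self_mem_nhdsWithin
  rcases eq_or_ne x g with rfl | hxg
  · have h0 : vertexDist ε C hC x δ (ε x) = 0 := by simp [vertexDist]
    rw [h0, (nhds_basis_Ioo (0 : M)).tendsto_right_iff]
    rintro ⟨u, v⟩ ⟨hu, hv⟩
    have hnear : ∀ᶠ z in side s p, p - v < z ∧ z < p + v :=
      side_le_nhds s p (Ioo_mem_nhds (sub_lt_self p hv) (lt_add_of_pos_right p hv))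
    filter_upwards [hnot, hside, hnear] with z h1 h2 h3
    rw [vertexDist_eq hC hx h1, Finset.inf'_apply]
    refine ⟨hu.trans ((Finset.lt_inf'_iff _).2 fun c _ => endDist_pos hδ), ?_⟩
    refine (Finset.inf'_le _ hp).trans_lt ?_
    cases s
    · have h2' : z < p := by simpa using h2
      have : endDist ε x δ p z = min δ (p - z) := by simp [endDist, h2', h2'.not_gt, hatt]
      rw [this]
      exact (min_le_right _ _).trans_lt (sub_lt_comm.1 h3.1)
    · have h2' : p < z := by simpa using h2
      have : endDist ε x δ p z = min δ (z - p) := by simp [endDist, h2', hatt]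
      rw [this]
      exact (min_le_right _ _).trans_lt (sub_lt_iff_lt_add'.2 h3.2)
  · have h0 : vertexDist ε C hC g δ (ε x) = δ := by simp [vertexDist, hε.ne hxg, hx]
    rw [h0]
    have hfar : ∀ᶠ z in side s p, ∀ c ∈ C, c ≠ p → δ < |z - c| := by
      refine (Filter.eventually_all_finset C).2 fun c hc => ?_
      by_cases hcp : c = p
      · exact .of_forall fun z h => absurd hcp h
      · have hcont : ContinuousAt (fun z => |z - c|) p := by fun_prop
        have : ∀ᶠ z in 𝓝 p, δ < |z - c| :=
          hcont (lt_mem_nhds (hsep p hp c hc fun h => hcp h.symm))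
        exact Filter.Eventually.mono (side_le_nhds s p this) fun z hz _ => hz
    refine tendsto_const_nhds.congr' ?_
    filter_upwards [hnot, hside, hfar] with z h1 h2 h3
    rw [vertexDist_eq hC hg h1, Finset.inf'_apply]
    refine le_antisymm ((Finset.le_inf'_iff _ _).2 fun c hc => ?_) ?_
    · by_cases hcp : c = p
      · subst hcp
        have hna : ¬ IsAttached ε s c g := fun h => hxg (by
          have := hatt.1
          exact eq_of_le_nhds hatt.2 h.2)
        cases s
        · have h2' : z < c := by simpa using h2
          simp [endDist, h2'.not_gt, hna]
        · have h2' : c < z := by simpa using h2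
          simp [endDist, h2'.not_gt, hna]
      · have := h3 c hc hcp
        unfold endDist
        split_ifs with h4 h5
        · rw [abs_of_pos (sub_pos.2 h4.1)] at this
          exact le_min le_rfl this.le
        · rw [abs_of_neg (sub_neg.2 h5.1), neg_sub] at this
          exact le_min le_rfl this.le
        · exact le_rfl
    · exact (Finset.inf'_le _ hp).trans endDist_le

/-- The distance to the vertex `g` along the edges controls the neighbourhoods of `g`. -/
theorem le_nhds_of_tendsto_vertexDist {C : Finset M} (hC : C.Nonempty) {g : T} {δ : M}
    (hδ : 0 < δ) (hε : ε.Injective) {F : Filter T}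
    (hF : Filter.Tendsto (fun x => vertexDist ε C hC g δ (ε x)) F
      (𝓝 (vertexDist ε C hC g δ (ε g)))) : F ≤ 𝓝 g := by
  intro V hV
  have hη : ∀ᶠ η in side true (0 : M), ∀ c ∈ C, (IsAttached ε true c g →
      ∀ y, c < ε y → ε y - c < η → y ∈ V) ∧
      (IsAttached ε false c g → ∀ y, ε y < c → c - ε y < η → y ∈ V) := by
    refine (Filter.eventually_all_finset C).2 fun c _ => Filter.Eventually.and ?_ ?_
    · by_cases h : IsAttached ε true c g
      · obtain ⟨u, hu, hV'⟩ := eventually_side_true.1 (mem_germ.1 (h.2 hV))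
        refine eventually_side_true.2 ⟨u - c, sub_pos.2 hu, fun η _ h2 _ y hy hy' => ?_⟩
        exact hV' _ hy (by simpa using hy'.trans h2) y rfl
      · exact .of_forall fun _ h' => absurd h' h
    · by_cases h : IsAttached ε false c g
      · obtain ⟨u, hu, hV'⟩ := eventually_side_false.1 (mem_germ.1 (h.2 hV))
        refine eventually_side_true.2 ⟨c - u, sub_pos.2 hu, fun η _ h2 _ y hy hy' => ?_⟩
        exact hV' _ (by simpa using hy'.trans h2) hy y rfl
      · exact .of_forall fun _ h' => absurd h' h
  have hle : ∀ᶠ η in side true (0 : M), η < δ := side_le_nhds true 0 (gt_mem_nhds hδ)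
  have hpos : ∀ᶠ η in side true (0 : M), 0 < η := self_mem_nhdsWithin
  obtain ⟨η, ⟨hη, hηδ⟩, hη0⟩ := ((hη.and hle).and hpos).exists
  have h0 : vertexDist ε C hC g δ (ε g) = 0 := by simp [vertexDist]
  rw [h0] at hF
  filter_upwards [hF (gt_mem_nhds hη0)] with y hy
  simp only [mem_preimage, mem_ofPred_eq, vertexDist] at hy
  split_ifs at hy with h1 h2
  · exact hε h1 ▸ mem_of_mem_nhds hV
  · exact absurd hy (not_lt.2 hηδ.le)
  · rw [Finset.inf'_apply, Finset.inf'_lt_iff] at hy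
    obtain ⟨c, hc, hlt⟩ := hy
    unfold endDist at hlt
    split_ifs at hlt with h3 h4
    · exact (hη c hc).1 h3.2 y h3.1 ((min_lt_iff.1 hlt).resolve_left (not_lt.2 hηδ.le))
    · exact (hη c hc).2 h4.2 y h4.1 ((min_lt_iff.1 hlt).resolve_left (not_lt.2 hηδ.le))
    · exact absurd hlt (not_lt.2 hηδ.le)

theorem exists_lt_abs_sub (C : Finset M) :
    ∃ δ : M, 0 < δ ∧ ∀ c ∈ C, ∀ c' ∈ C, c ≠ c' → δ < |c - c'| := by
  have h : ∀ᶠ δ in side true (0 : M), ∀ c ∈ C, ∀ c' ∈ C, c ≠ c' → δ < |c - c'| := by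
    refine (Filter.eventually_all_finset C).2 fun c _ =>
      (Filter.eventually_all_finset C).2 fun c' _ => ?_
    by_cases hcc : c = c'
    · exact .of_forall fun _ h => absurd hcc h
    · exact Filter.Eventually.mono (side_le_nhds true 0
        (gt_mem_nhds (abs_pos.2 (sub_ne_zero.2 hcc)))) fun _ h _ => h
  have hpos : ∀ᶠ δ in side true (0 : M), 0 < δ := self_mem_nhdsWithin
  obtain ⟨δ, h1, h2⟩ := (hpos.and h).exists
  exact ⟨δ, h1, h2⟩

/-- The tents over the edges and their halves, together with the distances to the vertices, embed
the graph. -/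
theorem IsCutSet.exists_isInducing (hM : IsOMinimalExpansion L M) [T2Space T] (hε : ε.Injective)
    {U : (β → M) → Set T} (hU : IsDefBasis L ε U) (hR : DefSet L ε univ) {l l' : M}
    (hl : ∀ x, l ≤ ε x ∧ ε x ≤ l') {C : Finset M} (hC : IsCutSet ε C) (hCne : C.Nonempty) :
    ∃ (k : ℕ) (f : Fin k → M → M), (∀ i, DefFun₁ L (f i)) ∧ IsInducing fun x i => f i (ε x) := by
  obtain ⟨δ, hδ, hsep⟩ := exists_lt_abs_sub C
  choose mid hmid using fun a b : M => exists_add_self_eq hM (a + b)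
  let 𝓕 : Set (M → M) := (vertexDist ε C hCne · δ) '' {g | ε g ∈ C} ∪
    {f | ∃ a ∈ C, ∃ b ∈ C, a < b ∧ (∀ c ∈ C, c ≤ a ∨ b ≤ c) ∧
      (f = tent a b ∨ f = tent a (mid a b) ∨ f = tent (mid a b) b)}
  have hfin : 𝓕.Finite := by
    refine ((C.finite_toSet.preimage hε.injOn).image _).union ?_
    refine Set.Finite.subset (C.finite_toSet.biUnion fun a _ => C.finite_toSet.biUnion fun b _ =>
      toFinite {tent a b, tent a (mid a b), tent (mid a b) b}) ?_
    rintro f ⟨a, ha, b, hb, -, -, h⟩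
    simp only [mem_iUnion]
    exact ⟨a, ha, b, hb, h⟩
  have hdef : ∀ f ∈ 𝓕, DefFun₁ L f := by
    rintro f (⟨g, -, rfl⟩ | ⟨a, -, b, -, -, -, rfl | rfl | rfl⟩)
    · exact defFun_vertexDist hM hCne g δ
    all_goals exact defFun_tent hM _ _
  have hcont : ∀ f ∈ 𝓕, Continuous fun x => f (ε x) := by
    rintro f (⟨g, hg, rfl⟩ | ⟨a, -, b, -, hlt, hab, rfl | rfl | rfl⟩)
    · exact hC.continuous_comp hM.1 hε hU hR hl (defFun_vertexDist hM hCne g δ)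
        (fun p hp => continuousAt_vertexDist hCne hg hp)
        fun s p x hp hx h => tendsto_vertexDist hCne hg hδ hsep hε hp hx h
    · exact hC.continuous_tent_comp hM hε hU hR hl hab
    · have := hmid a b
      refine hC.continuous_tent_comp hM hε hU hR hl fun c hc => ?_
      have := hab c hc
      grind
    · have := hmid a b
      refine hC.continuous_tent_comp hM hε hU hR hl fun c hc => ?_
      have := hab c hc
      grind
  have hnhds : ∀ x (F : Filter T), (∀ f ∈ 𝓕, Filter.Tendsto (fun y => f (ε y)) F (𝓝 (f (ε x)))) →
      F ≤ 𝓝 x := by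
    intro x F hF
    by_cases hx : ε x ∈ C
    · exact le_nhds_of_tendsto_vertexDist hCne hδ hε (hF _ (Or.inl ⟨x, hx, rfl⟩))
    · obtain ⟨a, ha, hax⟩ := hC.exists_lt x
      obtain ⟨b, hb, hxb⟩ := hC.exists_gt x
      obtain ⟨p, hp, q, hq, hpx, hxq, hgap⟩ := exists_gap C.finite_toSet (by simpa using hx) ha hb
        hax hxb
      have hpq : ∀ c ∈ C, c ≤ p ∨ q ≤ c := fun c hc => by
        by_contra! h
        exact hgap c h.1 h.2 hc
      have hmem : ∀ f, (f = tent p q ∨ f = tent p (mid p q) ∨ f = tent (mid p q) q) → f ∈ 𝓕 :=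
        fun f h => Or.inr ⟨p, hp, q, hq, hpx.trans hxq, hpq, h⟩
      rw [hC.nhds_eq x hx, ← Filter.map_le_iff_le_comap]
      refine le_nhds_of_tendsto_tent (hmid p q) hpx hxq ?_ ?_ ?_ <;>
        rw [Filter.tendsto_map'_iff] <;> refine hF _ (hmem _ ?_) <;> simp
  have := hfin.to_subtype
  obtain ⟨k, ⟨e⟩⟩ := Finite.exists_equiv_fin 𝓕
  refine ⟨k, fun i => (e.symm i).1, fun i => hdef _ (e.symm i).2, isInducing_iff_nhds.2 fun x => ?_⟩
  have hc : Continuous fun (x : T) (i : Fin k) => (e.symm i).1 (ε x) :=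
    continuous_pi fun i => hcont _ (e.symm i).2
  refine le_antisymm (Filter.tendsto_iff_comap.1 hc.continuousAt.tendsto) (hnhds x _ fun f hf => ?_)
  have h := (continuous_apply (e ⟨f, hf⟩)).continuousAt.tendsto.comp
    (Filter.tendsto_comap (f := fun (x : T) (i : Fin k) => (e.symm i).1 (ε x))
      (x := 𝓝 fun i => (e.symm i).1 (ε x)))
  simpa [Function.comp_def] using h

/-- If the order topology refines the given definable Hausdorff topology at all but finitely many
points, then finitely many definable functions of the coordinate induce the topology. -/
theorem IsDefBasis.exists_isInducing (hM : IsOMinimalExpansion L M) [T2Space T] (hε : ε.Injective)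
    {U : (β → M) → Set T} (hU : IsDefBasis L ε U) (hR : DefSet L ε univ) {l l' : M}
    (hl : ∀ x, l ≤ ε x ∧ ε x ≤ l') (hfin : {x | ¬ Filter.comap ε (𝓝 (ε x)) ≤ 𝓝 x}.Finite) :
    ∃ (k : ℕ) (f : Fin k → M → M), (∀ i, DefFun₁ L (f i)) ∧ IsInducing fun x i => f i (ε x) := by
  classical
  have hE := hU.finite_nhds_ne hM.1 hε hR hl hfin
  obtain ⟨m, hm⟩ := exists_lt l
  obtain ⟨m', hm'⟩ := exists_gt l'
  have hCfin : (insert m (insert m' (frontier {z | ∃ x, ε x = z ∧ x ∈ (univ : Set T)} ∪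
      ε '' {x | 𝓝 x ≠ Filter.comap ε (𝓝 (ε x))}))).Finite :=
    (((DefPred₁.finite_frontier hM.1 hR).union (hE.image ε)).insert m').insert m
  have hC : IsCutSet ε hCfin.toFinset := by
    refine ⟨fun z hz => ?_, fun x hx => ?_, fun x => ⟨m, ?_, hm.trans_le (hl x).1⟩,
      fun x => ⟨m', ?_, (hl x).2.trans_lt hm'⟩⟩
    · simp only [Finite.coe_toFinset]
      exact Or.inr (Or.inr (Or.inl hz))
    · by_contra hne
      exact hx (hCfin.mem_toFinset.2 (Or.inr (Or.inr (Or.inr ⟨x, hne, rfl⟩))))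
    · exact hCfin.mem_toFinset.2 (Or.inl rfl)
    · exact hCfin.mem_toFinset.2 (Or.inr (Or.inl rfl))
  exact hC.exists_isInducing hM hε hU hR hl ⟨m, hCfin.mem_toFinset.2 (Or.inl rfl)⟩

end Graph

/-! ### Definable components -/

section Components

variable {L : Language} {M : Type*} [L.Structure M] {n : ℕ} {X : Set (Fin n → M)}
  {τ : TopologicalSpace X} {A C D U W : Set X}

theorem DefinableIn.inter (hA : DefinableIn L A) (hC : DefinableIn L C) :
    DefinableIn L (A ∩ C) := by
  unfold DefinableIn at *
  rw [image_inter Subtype.val_injective]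
  exact Definable.inter hA hC

theorem DefinableIn.sUnion {F : Set (Set X)} (hF : F.Finite) (h : ∀ C ∈ F, DefinableIn L C) :
    DefinableIn L (⋃₀ F) := by
  have := hF.to_subtype
  have key : (univ : Set M).Definable L (⋃ C : F, ((↑) : X → Fin n → M) '' C.1) :=
    definable_iUnion_of_finite fun C => h C C.2
  unfold DefinableIn
  rwa [sUnion_eq_iUnion, image_iUnion]

/-- A definably connected set lies on one side of a definable separation of a larger set. -/
theorem DefConnected.subset_or_subset (hC : DefConnected L τ C) (hCd : DefinableIn L C)
    (hU : DefinableIn L U) (hW : DefinableIn L W) (hUo : ∃ O, IsOpen[τ] O ∧ U = A ∩ O)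
    (hWo : ∃ O, IsOpen[τ] O ∧ W = A ∩ O) (hdis : U ∩ W = ∅) (hcup : U ∪ W = A) (hCA : C ⊆ A) :
    C ⊆ U ∨ C ⊆ W := by
  by_contra! h
  obtain ⟨⟨x, hx, hxU⟩, ⟨y, hy, hyW⟩⟩ := And.intro (not_subset.1 h.1) (not_subset.1 h.2)
  have hxW : x ∈ W := (hcup ▸ hCA hx : x ∈ U ∪ W).resolve_left hxU
  have hyU : y ∈ U := (hcup ▸ hCA hy : y ∈ U ∪ W).resolve_right hyW
  obtain ⟨O, hO, rfl⟩ := hUo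
  obtain ⟨O', hO', rfl⟩ := hWo
  refine hC ⟨_, _, hCd.inter hU, hCd.inter hW, ⟨y, hy, hyU⟩, ⟨x, hx, hxW⟩, ⟨O, hO, ?_⟩,
    ⟨O', hO', ?_⟩, ?_, ?_⟩
  · rw [← inter_assoc, inter_eq_left.2 hCA]
  · rw [← inter_assoc, inter_eq_left.2 hCA]
  · rw [← inter_inter_distrib_left, hdis, inter_empty]
  · rw [← inter_union_distrib_left, hcup, inter_eq_left.2 hCA]

/-- Definably connected sets all meeting one definably connected set have a definably connected
union with it. -/
theorem DefConnected.union_sUnion (hD : DefConnected L τ D) (hDd : DefinableIn L D)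
    {F : Set (Set X)} (hF : ∀ C ∈ F, DefinableIn L C ∧ DefConnected L τ C ∧ (C ∩ D).Nonempty) :
    DefConnected L τ (D ∪ ⋃₀ F) := by
  rintro ⟨U, W, hU, hW, ⟨u, hu⟩, ⟨w, hw⟩, hUo, hWo, hdis, hcup⟩
  have hdisj : Disjoint U W := disjoint_iff_inter_eq_empty.2 hdis
  have hsplit : ∀ C, DefConnected L τ C → DefinableIn L C → C ⊆ D ∪ ⋃₀ F → C ⊆ U ∨ C ⊆ W :=
    fun C h h' h'' => h.subset_or_subset h' hU hW hUo hWo hdis hcup h''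
  have hFsub : ∀ C ∈ F, C ⊆ D ∪ ⋃₀ F := fun C hC =>
    (subset_sUnion_of_mem hC).trans subset_union_right
  have huU : u ∈ D ∪ ⋃₀ F := hcup ▸ Or.inl hu
  have hwW : w ∈ D ∪ ⋃₀ F := hcup ▸ Or.inr hw
  rcases hsplit D hD hDd subset_union_left with h | h
  · have hsub : D ∪ ⋃₀ F ⊆ U := by
      refine union_subset h (sUnion_subset fun C hC => ?_)
      obtain ⟨hCd, hCc, x, hxC, hxD⟩ := hF C hC
      exact (hsplit C hCc hCd (hFsub C hC)).resolve_right fun hCW =>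
        disjoint_left.1 hdisj (h hxD) (hCW hxC)
    exact disjoint_left.1 hdisj (hsub hwW) hw
  · have hsub : D ∪ ⋃₀ F ⊆ W := by
      refine union_subset h (sUnion_subset fun C hC => ?_)
      obtain ⟨hCd, hCc, x, hxC, hxD⟩ := hF C hC
      exact (hsplit C hCc hCd (hFsub C hC)).resolve_left fun hCU =>
        disjoint_left.1 hdisj (hCU hxC) (h hxD)
    exact disjoint_left.1 hdisj hu (hsub huU)

/-- A finite union of definable definably connected sets has finitely many components: the maximal
ones among the nonempty definably connected unions of subfamilies. -/
theorem finitelyManyDefComponents_sUnion {F : Set (Set X)} (hF : F.Finite)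
    (h : ∀ C ∈ F, DefinableIn L C ∧ DefConnected L τ C) :
    FinitelyManyDefComponents L τ (⋃₀ F) := by
  let S : Set (Set X) := {D | (∃ G ⊆ F, D = ⋃₀ G) ∧ D.Nonempty ∧ DefConnected L τ D}
  have hSfin : S.Finite := by
    refine (hF.finite_subsets.image sUnion).subset ?_
    rintro D ⟨⟨G, hG, rfl⟩, -⟩
    exact ⟨G, hG, rfl⟩
  have hSdef : ∀ D ∈ S, DefinableIn L D := by
    rintro D ⟨⟨G, hG, rfl⟩, -⟩
    exact DefinableIn.sUnion (hF.subset hG) fun C hC => (h C (hG hC)).1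
  have hSsub : ∀ D ∈ S, D ⊆ ⋃₀ F := by
    rintro D ⟨⟨G, hG, rfl⟩, -⟩
    exact sUnion_subset_sUnion hG
  -- The union of the members of `F` meeting a definably connected set contains that set.
  have henl : ∀ D, D ⊆ ⋃₀ F → D.Nonempty → DefinableIn L D → DefConnected L τ D →
      ∃ D' ∈ S, D ⊆ D' := by
    intro D hDF hDne hDd hDc
    have hsub : D ⊆ ⋃₀ {C ∈ F | (C ∩ D).Nonempty} := by
      intro x hx
      obtain ⟨C, hC, hxC⟩ := hDF hx
      exact ⟨C, ⟨hC, x, hxC, hx⟩, hxC⟩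
    refine ⟨_, ⟨⟨_, sep_subset _ _, rfl⟩, hDne.mono hsub, ?_⟩, hsub⟩
    rw [← union_eq_right.2 hsub]
    exact hDc.union_sUnion hDd fun C hC => ⟨(h C hC.1).1, (h C hC.1).2, hC.2⟩
  refine ⟨{C | Maximal (· ∈ S) C}, hSfin.subset fun C hC => hC.prop, fun C hC => ?_, ?_, ?_⟩
  · refine ⟨⟨hSsub C hC.prop, hSdef C hC.prop, hC.prop.2.2⟩, fun D hD hCD => ?_⟩
    obtain ⟨D', hD', hsub⟩ := henl D hD.1 (hC.prop.2.1.mono hCD) hD.2.1 hD.2.2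
    exact hsub.trans (hC.le_of_ge hD' (le_trans hCD hsub))
  · intro C hC D hD hne
    by_contra hdis
    obtain ⟨x, hxC, hxD⟩ := not_disjoint_iff.1 hdis
    have hcon : DefConnected L τ (C ∪ ⋃₀ {D}) := by
      refine hC.prop.2.2.union_sUnion (hSdef C hC.prop) ?_
      rintro _ rfl
      exact ⟨hSdef _ hD.prop, hD.prop.2.2, x, hxD, hxC⟩
    rw [sUnion_singleton] at hcon
    obtain ⟨E, hE, hsub⟩ := henl (C ∪ D) (union_subset (hSsub C hC.prop) (hSsub D hD.prop))
      ⟨x, Or.inl hxC⟩ (by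
        rw [← sUnion_pair]
        refine DefinableIn.sUnion (toFinite _) ?_
        rintro _ (rfl | rfl)
        · exact hSdef _ hC.prop
        · exact hSdef _ hD.prop) hcon
    exact hne ((hC.eq_of_le hE (subset_union_left.trans hsub)).trans
      (hD.eq_of_le hE (subset_union_right.trans hsub)).symm)
  · refine subset_antisymm (sUnion_subset fun C hC => hSsub C hC.prop) fun x hx => ?_
    obtain ⟨C, hC, hxC⟩ := hx
    have hCS : C ∈ S := ⟨⟨{C}, singleton_subset_iff.2 hC, (sUnion_singleton C).symm⟩, ⟨x, hxC⟩,
      (h C hC).2⟩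
    obtain ⟨D, hCD, hD⟩ := hSfin.exists_le_maximal hCS
    exact ⟨D, hD, hCD hxC⟩

end Components

/-! ### Comparison of two topologies -/

section Compare

variable {T : Type*} {t t' : TopologicalSpace T}

theorem familyLE_familyAt_iff {B B' : Set (Set T)} (hB : @TopologicalSpace.IsTopologicalBasis T t B)
    (hB' : @TopologicalSpace.IsTopologicalBasis T t' B') (x : T) :
    FamilyLE (familyAt B x) (familyAt B' x) ↔ @nhds T t' x ≤ @nhds T t x := by
  have h1 := @TopologicalSpace.IsTopologicalBasis.nhds_hasBasis T t B hB x
  have h2 := @TopologicalSpace.IsTopologicalBasis.nhds_hasBasis T t' B' hB' x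
  exact (h2.le_basis_iff h1).symm

/-- If `t'` refines `t` at all points outside a finite set, then every `t`-open set outside it is
`t'`-open; conversely, removing a finite set from a `t`-open set leaves a `t`-open set. -/
theorem finite_not_nhds_le_iff (ht : @T1Space T t) :
    {x | ¬ @nhds T t' x ≤ @nhds T t x}.Finite ↔
      ∃ G : Set T, G.Finite ∧ ∀ U, IsOpen[t] U → U ⊆ Gᶜ → IsOpen[t'] U := by
  constructor
  · refine fun h => ⟨_, h, fun U hU hUG => ?_⟩
    rw [@isOpen_iff_mem_nhds T t' U]
    intro x hx
    exact not_not.1 (hUG hx) (@IsOpen.mem_nhds T t x U hU hx)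
  · rintro ⟨G, hG, h⟩
    refine hG.subset fun x hx => ?_
    by_contra hxG
    refine hx fun V hV => ?_
    rw [@mem_nhds_iff T t x V] at hV
    obtain ⟨O, hOV, hO, hxO⟩ := hV
    have h1 : IsOpen[t] (O ∩ Gᶜ) := @IsOpen.inter T t O Gᶜ hO (@Set.Finite.isClosed T t ht G hG).1
    exact Filter.mem_of_superset (@IsOpen.mem_nhds T t' x (O ∩ Gᶜ) (h _ h1 inter_subset_right)
      ⟨hxO, hxG⟩) (inter_subset_left.trans hOV)

end Compare

/-! ### The coordinate on a one-dimensional set -/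

section Coordinate

variable {L : Language} {M : Type*} [L.Structure M] [AddCommGroup M] [LinearOrder M]
  [IsOrderedAddMonoid M] [Nontrivial M] [TopologicalSpace M] [OrderTopology M] [DenselyOrdered M]
  {n : ℕ} {X : Set (Fin n → M)} {e : (Fin n → M) → M}

/-- A box in the projection to two coordinates would make the dimension at least two. -/
theorem isThin_of_hasDim (hdim : HasDim X 1) : IsThin (· ∈ X) := by
  rintro i j hij ⟨a, b, c, d, hab, hcd, h⟩
  have hmono : StrictMono ![i, j] := by
    intro p q hpq
    fin_cases p <;> fin_cases q <;> simp_all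
  have h2 : 2 ≤ 1 := hdim.2 ⟨OrderEmbedding.ofStrictMono _ hmono, by
    obtain ⟨u, hu⟩ := exists_between hab
    obtain ⟨v, hv⟩ := exists_between hcd
    have hopen : IsOpen {w : Fin 2 → M | (a < w 0 ∧ w 0 < b) ∧ c < w 1 ∧ w 1 < d} := by
      refine IsOpen.and (IsOpen.and ?_ ?_) (IsOpen.and ?_ ?_) <;>
        refine isOpen_lt ?_ ?_ <;> fun_prop
    refine ⟨![u, v], mem_interior.2 ⟨_, fun w hw => ?_, hopen, ?_⟩⟩
    · obtain ⟨x, hx, h0, h1⟩ := h (w 0) (w 1) hw.1.1 hw.1.2 hw.2.1 hw.2.2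
      refine ⟨x, hx, ?_⟩
      ext p
      fin_cases p
      · exact h0
      · exact h1
    · exact ⟨hu, hv⟩⟩
  omega

theorem exists_bounds_of_isBdd (hX : IsBdd X) : ∃ k k' : M, ∀ x ∈ X, ∀ i, k ≤ x i ∧ x i ≤ k' := by
  obtain ⟨a, b, hab⟩ := hX
  obtain ⟨k, hk⟩ := (finite_range a).bddBelow
  obtain ⟨k', hk'⟩ := (finite_range b).bddAbove
  exact ⟨k, k', fun x hx i => ⟨(hk ⟨i, rfl⟩).trans ((hab hx).1 i), ((hab hx).2 i).trans
    (hk' ⟨i, rfl⟩)⟩⟩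

theorem DefPred.exists_subtype {α : Type*} (hX : DefPred L (· ∈ X))
    {P : (α → M) → (Fin n → M) → Prop}
    (hP : DefPred L fun w : α ⊕ Fin n → M => P (fun a => w (Sum.inl a)) fun i => w (Sum.inr i)) :
    DefPred L fun v => ∃ x : X, P v x :=
  (DefPred.exT (P := fun v u => u ∈ X ∧ P v u) ((hX.reindex Sum.inr).and hP)).of_iff fun _ =>
    ⟨fun ⟨x, h⟩ => ⟨x, x.2, h⟩, fun ⟨x, hx, h⟩ => ⟨⟨x, hx⟩, h⟩⟩

/-- The definable function `e` is injective and bounded on the definable set `X`, so that it serves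
as a coordinate on `X`. -/
structure IsCoordinate (L : Language) {M : Type*} [L.Structure M] [LinearOrder M] {n : ℕ}
    (X : Set (Fin n → M)) (e : (Fin n → M) → M) : Prop where
  defPred : DefPred L (· ∈ X)
  defFun : DefFun L e
  injOn : InjOn e X
  bdd : ∃ l l' : M, ∀ x : X, l ≤ e x ∧ e x ≤ l'

theorem IsCoordinate.injective (he : IsCoordinate L X e) : (fun x : X => e x).Injective :=
  he.injOn.injective

theorem IsCoordinate.defSet_univ (he : IsCoordinate L X e) :
    DefSet L (fun x : X => e x) univ :=
  DefPred.exists_subtype he.defPred (P := fun v u => e u = v 0 ∧ True)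
    (DefPred.and (DefPred.eq (he.defFun.reindex _) (DefFun.var _)) (DefPred.const _))

theorem IsCoordinate.definableIn_iff (he : IsCoordinate L X e) {A : Set X} :
    DefinableIn L A ↔ DefSet L (fun x : X => e x) A := by
  constructor <;> intro h
  · have h1 : DefPred L (· ∈ ((↑) : X → Fin n → M) '' A) := ⟨h⟩
    refine (DefPred.exT (P := fun v u => e u = v 0 ∧ u ∈ ((↑) : X → Fin n → M) '' A)
      (DefPred.and (DefPred.eq (he.defFun.reindex _) (DefFun.var _)) (h1.reindex _))).of_iff
      fun v => ?_
    exact ⟨fun ⟨x, hx, hxA⟩ => ⟨x, hx, x, hxA, rfl⟩, fun ⟨_, hu, x, hxA, hx⟩ =>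
      ⟨x, (congrArg e hx).trans hu, hxA⟩⟩
  · have h1 : DefPred L fun w => w ∈ X ∧ ∃ x : X, e x = e w ∧ x ∈ A :=
      he.defPred.and (DefPred₁.app h he.defFun)
    refine (h1.of_iff (P := fun w => w ∈ ((↑) : X → Fin n → M) '' A) fun w => ?_).1
    constructor
    · rintro ⟨x, hx, rfl⟩
      exact ⟨x.2, x, rfl, hx⟩
    · rintro ⟨hw, x, hx, hxA⟩
      exact ⟨x, hxA, he.injOn x.2 hw hx⟩

/-- Definable functions on `X` are definable functions of the coordinate. -/
theorem IsCoordinate.exists_defFun₁ (he : IsCoordinate L X e) {g : X → M}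
    (hg : DefPred L fun w : Fin n ⊕ Unit → M =>
      ∃ x : X, (x : Fin n → M) = (fun i => w (Sum.inl i)) ∧ g x = w (Sum.inr ())) :
    ∃ f, DefFun₁ L f ∧ ∀ x : X, f (e x) = g x := by
  have hG : DefPred₂ L fun t y => ∃ x : X, e x = t ∧ g x = y := by
    have h1 : DefPred L fun w : Fin 2 ⊕ Fin n → M =>
        ∃ x : X, (x : Fin n → M) = (fun i => w (Sum.inr i)) ∧ g x = w (Sum.inl 1) :=
      hg.reindex (Sum.elim Sum.inr fun _ => Sum.inl 1)
    refine (DefPred.exT (P := fun v u => e u = v 0 ∧ ∃ x : X, (x : Fin n → M) = u ∧ g x = v 1)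
      (DefPred.and (DefPred.eq (he.defFun.reindex _) (DefFun.var _)) h1)).of_iff fun v => ?_
    exact ⟨fun ⟨x, hx, hg⟩ => ⟨x, hx, x, rfl, hg⟩, fun ⟨_, hu, x, hx, hg⟩ => ⟨x, hx ▸ hu, hg⟩⟩
  obtain ⟨f, hf, hf'⟩ := OMin.exists_defFun₁ hG (by
    rintro _ _ _ ⟨x, rfl, rfl⟩ ⟨y, hy, rfl⟩
    rw [he.injective hy])
  exact ⟨f, hf, fun x => hf' _ _ ⟨x, rfl, rfl⟩⟩

theorem isTopologicalBasis_affineBasis (X : Set (Fin n → M)) :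
    TopologicalSpace.IsTopologicalBasis (affineBasis X) := by
  refine TopologicalSpace.isTopologicalBasis_of_isOpen_of_nhds ?_ ?_
  · rintro _ ⟨b, c, rfl⟩
    simp only [ofPred_forall]
    refine isOpen_iInter_of_finite fun i => ?_
    have hi : Continuous fun x : X => (x : Fin n → M) i :=
      (continuous_apply i).comp continuous_subtype_val
    exact (isOpen_lt continuous_const hi).and (isOpen_lt hi continuous_const)
  · intro x V hx hV
    have h1 : V ∈ 𝓝 x := hV.mem_nhds hx
    rw [nhds_subtype_eq_comap, nhds_pi, (Filter.HasBasis.comap _ (Filter.hasBasis_pi fun i =>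
      nhds_basis_Ioo ((x : Fin n → M) i))).mem_iff] at h1
    obtain ⟨⟨I, p⟩, ⟨hI, hp⟩, hsub⟩ := h1
    choose b hb using fun i => exists_lt ((x : Fin n → M) i)
    choose c hc using fun i => exists_gt ((x : Fin n → M) i)
    classical
    refine ⟨_, ⟨fun i => if i ∈ I then (p i).1 else b i, fun i => if i ∈ I then (p i).2 else c i,
      rfl⟩, fun i => ?_, fun y hy => hsub fun i hi => ?_⟩
    · by_cases h : i ∈ I
      · simpa [h] using hp i h
      · simpa [h] using ⟨hb i, hc i⟩
    · simpa [hi] using hy i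

/-- The affine topology agrees with the order topology of the coordinate at all but finitely many
points. -/
theorem IsCoordinate.finite_nhds_affine_ne (hM : IsOMinimalExpansion L M)
    (he : IsCoordinate L X e) :
    {x : X | 𝓝 x ≠ Filter.comap (fun x : X => e x) (𝓝 (e x))}.Finite := by
  obtain ⟨l, l', hl⟩ := he.bdd
  have hcoord : ∀ i : Fin n, ∃ f, DefFun₁ L f ∧ ∀ x : X, f (e x) = (x : Fin n → M) i := fun i => by
    refine he.exists_defFun₁ ?_
    have h1 : DefPred L fun w : Fin n ⊕ Unit → M => (fun i => w (Sum.inl i)) ∈ X :=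
      he.defPred.reindex _
    refine (h1.and (DefPred.eq (DefFun.var (Sum.inl i)) (DefFun.var (Sum.inr ())))).of_iff
      fun w => ?_
    constructor
    · rintro ⟨x, hx, hi⟩
      exact ⟨hx ▸ x.2, hi ▸ (congrFun hx i).symm⟩
    · rintro ⟨hw, hi⟩
      exact ⟨⟨_, hw⟩, rfl, hi⟩
  choose f hf hfx using hcoord
  have hind : IsInducing fun (x : X) i => f i (e x) := by
    simpa only [hfx] using IsInducing.subtypeVal
  have hU : IsDefBasis L (fun x : X => e x) fun b : Fin n ⊕ Fin n → M =>
      {x : X | ∀ i, b (Sum.inl i) < (x : Fin n → M) i ∧ (x : Fin n → M) i < b (Sum.inr i)} := by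
    constructor
    · convert isTopologicalBasis_affineBasis X using 1
      ext V
      constructor
      · rintro ⟨b, rfl⟩
        exact ⟨_, _, rfl⟩
      · rintro ⟨b, c, rfl⟩
        exact ⟨Sum.elim b c, rfl⟩
    · refine DefPred.exists_subtype he.defPred (P := fun v u => e u = v (Sum.inl ()) ∧
        ∀ i, v (Sum.inr (Sum.inl i)) < u i ∧ u i < v (Sum.inr (Sum.inr i))) ?_
      refine DefPred.and (DefPred.eq (he.defFun.reindex _) (DefFun.var _))
        (DefPred.forall_finite fun i => DefPred.and ?_ ?_) <;>
      exact DefPred.lt hM.1 (DefFun.var _) (DefFun.var _)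
  exact hU.finite_nhds_ne hM.1 he.injective he.defSet_univ hl
    (finite_not_comap_nhds_le_of_isInducing hM he.injective hf hind)

/-- To refine a given topology at all but finitely many points means the same for the affine
topology as for the order topology of the coordinate. -/
theorem IsCoordinate.finite_not_affine_le_iff (hM : IsOMinimalExpansion L M)
    (he : IsCoordinate L X e) (N : X → Filter X) :
    {x : X | ¬ 𝓝 x ≤ N x}.Finite ↔
      {x : X | ¬ Filter.comap (fun x : X => e x) (𝓝 (e x)) ≤ N x}.Finite := by
  have h := he.finite_nhds_affine_ne hM
  constructor <;> intro h' <;> refine (h.union h').subset fun x hx => ?_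
  · refine or_iff_not_imp_left.2 fun h1 => ?_
    rwa [mem_ofPred_eq, not_not.1 h1]
  · refine or_iff_not_imp_left.2 fun h1 => ?_
    rwa [mem_ofPred_eq, ← not_not.1 h1]

theorem IsCoordinate.exists_isDefBasis [TopologicalSpace X] (he : IsCoordinate L X e)
    {B : Set (Set X)} (hB : DefinableFamily L B) (hτ : TopologicalSpace.IsTopologicalBasis B) :
    ∃ (m : ℕ) (U : (Fin m → M) → Set X), IsDefBasis L (fun x : X => e x) U := by
  obtain ⟨m, φ, hφ, rfl⟩ := hB
  refine ⟨m, fun b => {x : X | Sum.elim (x : Fin n → M) b ∈ φ}, ?_, ?_⟩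
  · convert hτ using 1
    ext V
    exact exists_congr fun b => eq_comm
  · have h1 : DefPred L (· ∈ φ) := ⟨hφ⟩
    refine DefPred.exists_subtype he.defPred (P := fun v u => e u = v (Sum.inl ()) ∧
      Sum.elim u (fun i => v (Sum.inr i)) ∈ φ) (DefPred.and
        (DefPred.eq (he.defFun.reindex _) (DefFun.var _)) ?_)
    refine (h1.reindex (Sum.elim Sum.inr fun i => Sum.inl (Sum.inr i))).of_iff fun w => ?_
    rw [iff_iff_eq]
    congr 1
    ext (i | i) <;> rfl

/-! ### The conditions in terms of the coordinate -/

variable [τ : TopologicalSpace X]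

theorem IsCoordinate.finite_of_defHomeomorphicToAffine (hM : IsOMinimalExpansion L M)
    (he : IsCoordinate L X e) (h : DefHomeomorphicToAffine L τ) :
    {x : X | ¬ Filter.comap (fun x : X => e x) (𝓝 (e x)) ≤ 𝓝 x}.Finite := by
  obtain ⟨k, Y, -, f, hf⟩ := h
  have hgraph : DefPred L fun z : Fin n ⊕ Fin k → M =>
    ∃ x : X, z = Sum.elim (x : Fin n → M) (f x : Fin k → M) := ⟨hf⟩
  have hcoord : ∀ i : Fin k, ∃ g, DefFun₁ L g ∧ ∀ x : X, g (e x) = (f x : Fin k → M) i := by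
    refine fun i => he.exists_defFun₁ ?_
    have h1 : DefPred L fun w : (Fin n ⊕ Unit) ⊕ Fin k → M => ∃ x : X,
        (fun j => w (Sum.map Sum.inl id j)) = Sum.elim (x : Fin n → M) (f x : Fin k → M) :=
      hgraph.reindex (Sum.map Sum.inl id)
    refine (DefPred.exT (P := fun v u => (∃ x : X, (fun j => Sum.elim v u (Sum.map Sum.inl id j)) =
      Sum.elim (x : Fin n → M) (f x : Fin k → M)) ∧ u i = v (Sum.inr ()))
      (DefPred.and (h1.of_iff fun w => ?_)
        (DefPred.eq (DefFun.var _) (DefFun.var _)))).of_iff fun v => ?_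
    · refine exists_congr fun x => ?_
      rw [iff_iff_eq]
      congr 1
      ext (j | j) <;> rfl
    · constructor
      · rintro ⟨x, hx, hi⟩
        refine ⟨f x, ⟨x, ?_⟩, hi⟩
        ext (j | j)
        · exact (congrFun hx j).symm
        · rfl
      · rintro ⟨u, ⟨x, hx⟩, hi⟩
        exact ⟨x, funext fun j => (congrFun hx (Sum.inl j)).symm,
          (congrFun hx (Sum.inr i)).symm.trans hi⟩
  choose g hg hgx using hcoord
  refine finite_not_comap_nhds_le_of_isInducing hM he.injective hg ?_
  simp only [hgx]
  exact IsInducing.subtypeVal.comp f.isInducing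

theorem IsCoordinate.defHomeomorphicToAffine (hM : IsOMinimalExpansion L M) [T2Space X]
    (he : IsCoordinate L X e) {m : ℕ} {U : (Fin m → M) → Set X}
    (hU : IsDefBasis L (fun x : X => e x) U)
    (hfin : {x : X | ¬ Filter.comap (fun x : X => e x) (𝓝 (e x)) ≤ 𝓝 x}.Finite) :
    DefHomeomorphicToAffine L τ := by
  obtain ⟨l, l', hl⟩ := he.bdd
  obtain ⟨k, f, hf, hind⟩ := hU.exists_isInducing hM he.injective he.defSet_univ hl hfin
  refine ⟨k, range fun (x : X) i => f i (e x), ?_, hind.isEmbedding.toHomeomorph, ?_⟩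
  · refine (DefPred.of_iff (P := fun y => y ∈ range fun (x : X) i => f i (e x))
      (fun y => ?_) (DefPred.exists_subtype he.defPred (P := fun v u => ∀ i, f i (e u) = v i)
      (DefPred.forall_finite fun i => DefPred.eq ((hf i).app (he.defFun.reindex _))
        (DefFun.var _)))).1
    exact exists_congr fun x => funext_iff
  · refine (DefPred.of_iff (fun y => ?_) (DefPred.exists_subtype he.defPred
      (P := fun v : Fin n ⊕ Fin k → M => fun u => (∀ i, v (Sum.inl i) = u i) ∧
        ∀ i, v (Sum.inr i) = f i (e u)) (DefPred.and
      (DefPred.forall_finite fun i => DefPred.eq (DefFun.var _) (DefFun.var _))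
      (DefPred.forall_finite fun i => DefPred.eq (DefFun.var _)
        ((hf i).app (he.defFun.reindex _)))))).1
    refine exists_congr fun x => ?_
    rw [funext_iff, Sum.forall]
    rfl

/-- Points, and order-convex sets avoiding the exceptional points, are definably connected. -/
theorem IsCoordinate.finitelyManyDefComponents (hM : IsOMinimalExpansion L M)
    (he : IsCoordinate L X e)
    (hfin : {x : X | ¬ Filter.comap (fun x : X => e x) (𝓝 (e x)) ≤ 𝓝 x}.Finite)
    {A : Set X} (hA : DefinableIn L A) : FinitelyManyDefComponents L τ A := by
  obtain ⟨F, hF, rfl, hFC⟩ := (he.definableIn_iff.1 hA).exists_finite_cover hM.1 he.injective hfin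
  refine finitelyManyDefComponents_sUnion hF fun C hC => ⟨he.definableIn_iff.2 (hFC C hC).1, ?_⟩
  rintro ⟨U, W, hU, -, hUne, hWne, hUo, hWo, hdis, hcup⟩
  rcases (hFC C hC).2 with h | ⟨I, hI, hIR, rfl, hgood⟩
  · obtain ⟨u, hu⟩ := hUne
    obtain ⟨w, hw⟩ := hWne
    have huw : u = w := h (hcup.subset (Or.inl hu)) (hcup.subset (Or.inr hw))
    exact hdis.subset ⟨hu, huw ▸ hw⟩
  · exact not_separated_of_ordConnected hM.1 he.injective hI hIR
      (fun x hx => not_not.1 (hgood x hx)) (he.definableIn_iff.1 hU) hUne hWne hUo hWo hdis hcup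

/-- In a set that is definably separated between any two points all components are singletons, so
there are infinitely many of them if the set is infinite. -/
theorem IsCoordinate.finite_of_finitelyManyDefComponents (hM : IsOMinimalExpansion L M) [T2Space X]
    (he : IsCoordinate L X e) {m : ℕ} {U : (Fin m → M) → Set X}
    (hU : IsDefBasis L (fun x : X => e x) U)
    (h : ∀ A : Set X, DefinableIn L A → FinitelyManyDefComponents L τ A) :
    {x : X | ¬ Filter.comap (fun x : X => e x) (𝓝 (e x)) ≤ 𝓝 x}.Finite := by
  by_contra hinf
  obtain ⟨A, hA, hAinf, hsep⟩ := hU.hasSeparatedSet hM he.injective he.defSet_univ hinf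
  obtain ⟨F, hF, hFC, -, rfl⟩ := h A (he.definableIn_iff.2 hA)
  refine hAinf (hF.sUnion fun C hC => Set.Subsingleton.finite fun x hx y hy => ?_)
  by_contra hxy
  obtain ⟨⟨hCA, hCd, hCc⟩, -⟩ := hFC C hC
  obtain ⟨V, W, hV, hW, hxV, hVo, hWo, hdis, hcup⟩ := hsep x (hCA hx) y (hCA hy) hxy
  have hdisj : Disjoint V W := disjoint_iff_inter_eq_empty.2 hdis
  rcases hCc.subset_or_subset hCd (he.definableIn_iff.2 hV) (he.definableIn_iff.2 hW) hVo hWo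
    hdis hcup hCA with h1 | h1 <;> rcases hxV with h2 | h2
  · exact disjoint_left.1 hdisj (h1 hy) h2.2
  · exact disjoint_left.1 hdisj (h1 hx) h2.2
  · exact disjoint_left.1 hdisj h2.1 (h1 hx)
  · exact disjoint_left.1 hdisj h2.1 (h1 hy)

end Coordinate

end OMin

theorem mainTheorem1 {L : FirstOrder.Language} {M : Type*} [L.Structure M]
    [AddGroup M] [LinearOrder M] [AddLeftMono M] [AddRightMono M] [Nontrivial M]
    [TopologicalSpace M] [OrderTopology M]
    (hM : OMin.IsOMinimalExpansion L M)
    {n : ℕ} (X : Set (Fin n → M))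
    (hX : (Set.univ : Set M).Definable L X) (hbdd : OMin.IsBdd X) (hdim : OMin.HasDim X 1)
    (τ : TopologicalSpace X) (B : Set (Set X)) (hB : OMin.DefinableFamily L B)
    (hτ : @TopologicalSpace.IsTopologicalBasis X τ B) (hT2 : @T2Space X τ) :
    List.TFAE [
      OMin.DefHomeomorphicToAffine L τ,
      ∀ A : Set X, OMin.DefinableIn L A → OMin.FinitelyManyDefComponents L τ A,
      {x : X | ¬ OMin.FamilyLE (OMin.familyAt B x)
        (OMin.familyAt (OMin.affineBasis X) x)}.Finite,
      ∃ G : Set X, G.Finite ∧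
        ∀ U : Set X, IsOpen[τ] U → U ⊆ Gᶜ → IsOpen[instTopologicalSpaceSubtype] U] := by
  let : AddCommGroup M :=
    { ‹AddGroup M› with add_comm := OMin.add_comm_of_isOMinimalExpansion hM }
  have : IsOrderedAddMonoid M := { add_le_add_left := fun _ _ h c => add_le_add_left h c }
  have : DenselyOrdered M := OMin.denselyOrdered_of_isOMinimalExpansion hM
  obtain ⟨k, k', hk⟩ := OMin.exists_bounds_of_isBdd hbdd
  obtain ⟨e, hdef, hinj, l, l', hl⟩ :=
    OMin.IsThin.exists_injOn hM ⟨hX⟩ hk (OMin.isThin_of_hasDim hdim)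
  have he : OMin.IsCoordinate L X e := ⟨⟨hX⟩, hdef, hinj, l, l', fun x => hl x x.2⟩
  obtain ⟨m, U, hU⟩ := he.exists_isDefBasis hB hτ
  -- By the comparison of the affine topology with the order topology of `e`, the third condition
  -- becomes a condition on `e` and `τ` alone.
  have h3 : {x : X | ¬ OMin.FamilyLE (OMin.familyAt B x)
        (OMin.familyAt (OMin.affineBasis X) x)}.Finite ↔
      {x : X | ¬ Filter.comap (fun x : X => e x) (𝓝 (e x)) ≤ @nhds X τ x}.Finite := by
    simp only [OMin.familyLE_familyAt_iff hτ (OMin.isTopologicalBasis_affineBasis X)]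
    exact he.finite_not_affine_le_iff hM _
  tfae_have 1 → 3 := fun h => h3.2 (he.finite_of_defHomeomorphicToAffine hM h)
  tfae_have 3 → 1 := fun h => he.defHomeomorphicToAffine hM hU (h3.1 h)
  tfae_have 3 → 2 := fun h A hA => he.finitelyManyDefComponents hM (h3.1 h) hA
  tfae_have 2 → 3 := fun h => h3.2 (he.finite_of_finitelyManyDefComponents hM hU h)
  tfae_have 3 ↔ 4 := by
    simp only [OMin.familyLE_familyAt_iff hτ (OMin.isTopologicalBasis_affineBasis X)]
    exact OMin.finite_not_nhds_le_iff inferInstance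
  tfae_finish
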